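/- Notation. Let $n\in\mathbb N$, let $|\cdot|$ be the Euclidean norm on $\mathbb R^n$, and write $\partial^\alpha$, $\xi^\alpha$, $|\alpha|=\alpha_1+\dots+\alpha_n$ for multi-indices $\alpha\in\mathbb Z_{\ge0}^n$. Let $\Lambda\in C^\infty(\mathbb R^n)$ be a positive function and $\mu\in\mathbb R$ such that there are positive constants $\mu_0\le\mu_1\le\mu$ and $C_0\le C_1$ with $$C_0(1+|\xi|)^{\mu_0}\le\Lambda(\xi)\le C_1(1+|\xi|)^{\mu_1},\qquad \xi\in\mathbb R^n,$$ and such that for all multi-indices $\alpha$ and all $\gamma\in\{0,1\}^n$ there is a constant $C_{\alpha,\gamma}>0$ with $$|\xi^\gamma(\partial^{\alpha+\gamma}\Lambda)(\xi)|\le C_{\alpha,\gamma}\,\Lambda(\xi)^{1-\frac1\mu|\alpha|},\qquad \xi\in\mathbb R^n.$$ Let $\rho\in(0,\frac1\mu]$. For $k\in\mathbb R$, let $S^k_{\rho,\Lambda}$ be the set of all $\sigma\in C^\infty(\mathbb R^n\times\mathbb R^n)$ (complex-valued) such that for all multi-indices $\alpha,\beta$ there is $C_{\alpha,\beta}>0$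 with $$|(\partial_x^\alpha\partial_\xi^\beta\sigma)(x,\xi)|\le C_{\alpha,\beta}\,\Lambda(\xi)^{k-\rho|\beta|},\qquad x,\xi\in\mathbb R^n,$$ and let $M^k_{\rho,\Lambda}$ be the set of all $\sigma$ with $\xi^\gamma(\partial_\xi^\gamma\sigma)(x,\xi)\in S^k_{\rho,\Lambda}$ for every $\gamma\in\{0,1\}^n$. For $\varphi$ in the Schwartz space $\mathcal S=\mathcal S(\mathbb R^n)$ put $$(T_\sigma\varphi)(x)=(2\pi)^{-n/2}\int_{\mathbb R^n}e^{ix\cdot\xi}\sigma(x,\xi)\hat\varphi(\xi)\,d\xi,\qquad \hat\varphi(\xi)=(2\pi)^{-n/2}\int_{\mathbb R^n}e^{-ix\cdot\xi}\varphi(x)\,dx.$$ For $k\in\mathbb R$ let $J_k$ be the operator $T_{\sigma_k}$ with $\sigma_k(x,\xi)=\Lambda(\xi)^{-k}$, and let $\|\varphi\|_{k,2,\Lambda}=\|J_{-k}\varphi\|_{L^2(\mathbb R^n)}$. Let $(u,v)=\int_{\mathbb R^n}u\,\overline v\,dx$. Theorem (Gårding's inequality for $M$-elliptic operators). Let $m\in\mathbb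 R$ and let $\sigma\in M^{2m}_{\rho,\Lambda}$ be strongly $M$-elliptic, that is, there are constants $C,R>0$ with $$\operatorname{Re}\sigma(x,\xi)\ge C\,\Lambda(\xi)^{2m}\qquad\text{for all }x\in\mathbb R^n\text{ and all }\xi\in\mathbb R^n\text{ with }|\xi|\ge R.$$ Then there is a constant $C'>0$ and, for every real number $s\ge\frac\rho2$, a constant $C_s>0$ such that $$\operatorname{Re}(T_\sigma\varphi,\varphi)\ge C'\,\|\varphi\|_{m,2,\Lambda}^2-C_s\,\|\varphi\|_{m-s,2,\Lambda}^2\qquad\text{for all }\varphi\in\mathcal S.$$ -/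

import Mathlib

open MeasureTheory
open scoped ContDiff SchwartzMap ComplexConjugate

noncomputable section

namespace MElliptic

variable {n : ℕ} {F : Type*} [NormedAddCommGroup F] [NormedSpace ℝ F]

/-- The partial derivative `∂f/∂x_i` of a function on `ℝⁿ`. -/
def partialDeriv (i : Fin n) (f : EuclideanSpace ℝ (Fin n) → F) :
    EuclideanSpace ℝ (Fin n) → F :=
  fun x => fderiv ℝ f x (EuclideanSpace.single i (1 : ℝ))

/-- The iterated partial derivative `∂^α f = ∂_1^{α_1} ⋯ ∂_n^{α_n} f` for a multi-index `α`. -/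
def multiDeriv (α : Fin n → ℕ) (f : EuclideanSpace ℝ (Fin n) → F) :
    EuclideanSpace ℝ (Fin n) → F :=
  (List.finRange n).foldr (fun i g => (partialDeriv i)^[α i] g) f

/-- The length `|α| = α_1 + ⋯ + α_n` of a multi-index. -/
def multiLength (α : Fin n → ℕ) : ℕ := ∑ i, α i

/-- The monomial `ξ^γ = ξ_1^{γ_1} ⋯ ξ_n^{γ_n}`. -/
def monomial (γ : Fin n → ℕ) (ξ : EuclideanSpace ℝ (Fin n)) : ℝ := ∏ i, ξ i ^ γ i

/-- `Λ` is a weight function with polynomial growth, with constant `μ` in its derivative bounds: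
it is positive and smooth, `C₀ (1 + |ξ|)^{μ₀} ≤ Λ(ξ) ≤ C₁ (1 + |ξ|)^{μ₁}` for some positive
`μ₀ ≤ μ₁ ≤ μ` and `C₀ ≤ C₁`, and `|ξ^γ ∂^{α+γ} Λ(ξ)| ≤ C_{α,γ} Λ(ξ)^{1 - |α|/μ}` for all
multi-indices `α` and all `γ ∈ {0,1}ⁿ`. -/
structure IsWeight (Λ : EuclideanSpace ℝ (Fin n) → ℝ) (μ : ℝ) : Prop where
  pos : ∀ ξ, 0 < Λ ξ
  smooth : ContDiff ℝ ∞ Λ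
  growth : ∃ μ₀ μ₁ C₀ C₁ : ℝ, 0 < μ₀ ∧ μ₀ ≤ μ₁ ∧ μ₁ ≤ μ ∧ 0 < C₀ ∧ C₀ ≤ C₁ ∧
    ∀ ξ, C₀ * (1 + ‖ξ‖) ^ μ₀ ≤ Λ ξ ∧ Λ ξ ≤ C₁ * (1 + ‖ξ‖) ^ μ₁
  deriv_bound : ∀ α γ : Fin n → ℕ, (∀ j, γ j ≤ 1) → ∃ C : ℝ, 0 < C ∧
    ∀ ξ, |monomial γ ξ * multiDeriv (α + γ) Λ ξ| ≤ C * Λ ξ ^ (1 - 1 / μ * (multiLength α : ℝ))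

/-- The mixed derivative `∂_x^α ∂_ξ^β σ` of a function `σ(x, ξ)`. -/
def mixedDeriv (α β : Fin n → ℕ)
    (σ : EuclideanSpace ℝ (Fin n) → EuclideanSpace ℝ (Fin n) → ℂ) :
    EuclideanSpace ℝ (Fin n) → EuclideanSpace ℝ (Fin n) → ℂ :=
  fun x ξ => multiDeriv α (fun y => multiDeriv β (σ y) ξ) x

/-- The symbol class `S^m_{ρ,Λ}`: smooth functions `σ(x, ξ)` with
`|∂_x^α ∂_ξ^β σ(x, ξ)| ≤ C_{α,β} Λ(ξ)^{m - ρ|β|}` for all multi-indices `α` and `β`. -/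
structure IsSymbolS (Λ : EuclideanSpace ℝ (Fin n) → ℝ) (ρ m : ℝ)
    (σ : EuclideanSpace ℝ (Fin n) → EuclideanSpace ℝ (Fin n) → ℂ) : Prop where
  smooth : ContDiff ℝ ∞
    (fun p : EuclideanSpace ℝ (Fin n) × EuclideanSpace ℝ (Fin n) => σ p.1 p.2)
  bound : ∀ α β : Fin n → ℕ, ∃ C : ℝ, 0 < C ∧
    ∀ x ξ, ‖mixedDeriv α β σ x ξ‖ ≤ C * Λ ξ ^ (m - ρ * (multiLength β : ℝ))

/-- The symbol class `M^m_{ρ,Λ}`: those `σ` for which `ξ^γ ∂_ξ^γ σ(x, ξ)` lies in `S^m_{ρ,Λ}`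
for every `γ ∈ {0,1}ⁿ`. -/
def IsSymbolM (Λ : EuclideanSpace ℝ (Fin n) → ℝ) (ρ m : ℝ)
    (σ : EuclideanSpace ℝ (Fin n) → EuclideanSpace ℝ (Fin n) → ℂ) : Prop :=
  ∀ γ : Fin n → ℕ, (∀ j, γ j ≤ 1) →
    IsSymbolS Λ ρ m (fun x ξ => (monomial γ ξ : ℂ) * multiDeriv γ (σ x) ξ)

/-- Strong `M`-ellipticity of order `m`: `Re σ(x, ξ) ≥ C Λ(ξ)^m` for all `x` and all
`|ξ| ≥ R`, for some positive constants `C` and `R`. -/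
def IsStronglyMElliptic (Λ : EuclideanSpace ℝ (Fin n) → ℝ) (m : ℝ)
    (σ : EuclideanSpace ℝ (Fin n) → EuclideanSpace ℝ (Fin n) → ℂ) : Prop :=
  ∃ C R : ℝ, 0 < C ∧ 0 < R ∧ ∀ x ξ, R ≤ ‖ξ‖ → C * Λ ξ ^ m ≤ (σ x ξ).re

/-- The Fourier transform `φ̂(ξ) = (2π)^{-n/2} ∫ e^{-i x·ξ} φ(x) dx`. -/
def fourierHat (φ : EuclideanSpace ℝ (Fin n) → ℂ) (ξ : EuclideanSpace ℝ (Fin n)) : ℂ :=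
  (((2 * Real.pi) ^ (-(n : ℝ) / 2) : ℝ) : ℂ) *
    ∫ x, Complex.exp (-(Complex.I * ((inner ℝ x ξ : ℝ) : ℂ))) * φ x

/-- The pseudo-differential operator
`(T_σ φ)(x) = (2π)^{-n/2} ∫ e^{i x·ξ} σ(x, ξ) φ̂(ξ) dξ`. -/
def pseudoDiff (σ : EuclideanSpace ℝ (Fin n) → EuclideanSpace ℝ (Fin n) → ℂ)
    (φ : EuclideanSpace ℝ (Fin n) → ℂ) (x : EuclideanSpace ℝ (Fin n)) : ℂ :=
  (((2 * Real.pi) ^ (-(n : ℝ) / 2) : ℝ) : ℂ) *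
    ∫ ξ, Complex.exp (Complex.I * ((inner ℝ x ξ : ℝ) : ℂ)) * σ x ξ * fourierHat φ ξ

/-- The operator `J_m`, the pseudo-differential operator with symbol `Λ(ξ)^{-m}`. -/
def besselJ (Λ : EuclideanSpace ℝ (Fin n) → ℝ) (m : ℝ)
    (φ : EuclideanSpace ℝ (Fin n) → ℂ) : EuclideanSpace ℝ (Fin n) → ℂ :=
  pseudoDiff (fun _ ξ => ((Λ ξ ^ (-m) : ℝ) : ℂ)) φ

/-- The Sobolev norm `‖φ‖_{m,2,Λ} = ‖J_{-m} φ‖_{L²}`. -/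
def sobolevNorm (Λ : EuclideanSpace ℝ (Fin n) → ℝ) (m : ℝ)
    (φ : EuclideanSpace ℝ (Fin n) → ℂ) : ℝ :=
  (eLpNorm (besselJ Λ (-m) φ) 2 volume).toReal

/-- The pairing `(u, v) = ∫ u(x) \overline{v(x)} dx`. -/
def pairing (u v : EuclideanSpace ℝ (Fin n) → ℂ) : ℂ := ∫ x, u x * conj (v x)

end MElliptic

end

noncomputable section

namespace MElliptic

open FourierTransform Complex
open scoped ENNReal

/-! The proof replaces the form `(T_σ φ, φ)` by an anti-Wick form, for which pointwise positivity of
a symbol gives positivity of the form. No parametrix or symbol composition is needed.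

Write `(T_a φ, φ)` as the integral of `a` against the kernel `formKer φ` on phase space. For a
window `χ` the nonnegative density `|stft χ φ|²` is the average of translates of `formKer φ` against
`formKer χ` (`integral_formKer_mul_formKer_add`). Hence the anti-Wick form of `a` averages the forms
of translates of `a` (`SymB.antiWick_eq`). If `formKer χ` has integral 1, the two forms differ by an
average of forms of differences of `a` under translation.

These are estimated by a weighted Calderón–Vaillancourt bound (`exists_form_bound`): if finitely
many derivatives of `a` are at most `A w(ξ)`, the form is at most a constant times `A ∫ w |φ̂|²`.
Its proof integrates by parts with the resolvents `(1 - ∂_j)⁻¹`, first in frequency and then in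
position, until both factors are square integrable by Plancherel. A frequency translation gains
`Λ^{-ρ}` and is of lower order. A position translation gains nothing, but enters with the first
position moment of `formKer χ`, which dilation makes as small as desired (`exists_window`).

Ellipticity gives `Re σ ≥ c Λ^{2m} - K Λ^{2m-ρ}` everywhere
(`IsStronglyMElliptic.exists_re_lower_bound`). Integrating against `|stft χ φ|²`, returning to the
ordinary forms and choosing `χ` so that the position error costs half of `c`, one gets the
inequality with an error of order `2m - ρ` (`exists_form_lower_bound`). Pointwise interpolation
between powers of `Λ` then reaches every `s ≥ ρ/2` (`exists_weightedSq_interpolation`). -/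

/-- Euclidean space `ℝⁿ`. -/
abbrev Sp (n : ℕ) := EuclideanSpace ℝ (Fin n)

variable {n : ℕ}

/-! ### Plancherel's theorem on `L¹ ∩ L²` -/

/-- The `L²` transform agrees with the distributional one, so against a test function it moves onto
that function. Fubini does the same for the integral transform of an `L¹` function. Equal pairings
with all test functions give equality almost everywhere. -/
theorem fourierInv_toLp_ae_eq {G : Sp n → ℂ} (h1 : Integrable G) (h2 : MemLp G 2) :
    (𝓕⁻ (h2.toLp G) : Lp ℂ 2 (volume : Measure (Sp n))) =ᵐ[volume] 𝓕⁻ G := by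
  have hcont : Continuous (𝓕⁻ G) := by
    have : Continuous (𝓕 G) := VectorFourier.fourierIntegral_continuous
      Real.continuous_fourierChar (by exact continuous_inner) h1
    have h : 𝓕⁻ G = fun x => 𝓕 G (-x) := by
      ext x; rw [Real.fourierInv_eq_fourier_neg]
    rw [h]; exact this.comp continuous_neg
  apply ae_eq_of_integral_contDiff_smul_eq
  · exact (Lp.memLp _).locallyIntegrable (by norm_num)
  · exact hcont.locallyIntegrable
  intro g hg hg'
  have hgc : HasCompactSupport (fun x => (g x : ℂ)) := hg'.comp_left (g := fun r : ℝ => (r : ℂ)) rfl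
  have hgs : ContDiff ℝ ∞ (fun x => (g x : ℂ)) := Complex.ofRealCLM.contDiff.comp hg
  set γ : 𝓢(Sp n, ℂ) := hgc.toSchwartzMap hgs with hγ
  have hγx : ∀ x, γ x = (g x : ℂ) := fun x => rfl
  have key := congrArg (fun T => T γ) (Lp.fourierInv_toTemperedDistribution_eq (h2.toLp G))
  simp only [TemperedDistribution.fourierInv_apply, Lp.toTemperedDistribution_apply] at key
  have e1 : ∀ (h : Sp n → ℂ), ∫ x, g x • h x = ∫ x, γ x • h x := by
    intro h; congr 1
  rw [e1, e1, ← key]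
  have e2 : ∫ x, (𝓕⁻ γ) x • (h2.toLp G : Sp n → ℂ) x = ∫ x, (𝓕⁻ γ) x • G x := by
    apply integral_congr_ae
    filter_upwards [h2.coeFn_toLp] with x hx
    rw [hx]
  rw [e2]
  have hflip := VectorFourier.integral_fourierIntegral_smul_eq_flip (L := -innerₗ (Sp n))
    (μ := volume) (ν := volume) (f := γ) (g := G) Real.continuous_fourierChar
    (by exact continuous_inner.neg) γ.integrable h1
  have e3 : ∀ (f : Sp n → ℂ) (w : Sp n), VectorFourier.fourierIntegral Real.fourierChar volume
      (-innerₗ (Sp n)) f w = 𝓕⁻ f w := by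
    intro f w
    rw [Real.fourierInv_eq]
    simp [VectorFourier.fourierIntegral]
  have e4 : (-innerₗ (Sp n)).flip = -innerₗ (Sp n) := by
    ext a b; simp [real_inner_comm]
  rw [e4] at hflip
  simp only [e3] at hflip
  rw [← hflip, SchwartzMap.fourierInv_coe]

theorem lintegral_fourierInv_sq {G : Sp n → ℂ} (h1 : Integrable G) (h2 : MemLp G 2) :
    ∫⁻ x, ‖𝓕⁻ G x‖ₑ ^ 2 = ∫⁻ x, ‖G x‖ₑ ^ 2 := by
  have a : eLpNorm (𝓕⁻ G) 2 volume = eLpNorm G 2 volume := by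
    rw [← eLpNorm_congr_ae (fourierInv_toLp_ae_eq h1 h2), ← eLpNorm_congr_ae h2.coeFn_toLp]
    have h : ‖(𝓕⁻ (h2.toLp G) : Lp ℂ 2 (volume : Measure (Sp n)))‖ = ‖h2.toLp G‖ :=
      (Lp.fourierTransformₗᵢ (Sp n) ℂ).symm.norm_map _
    rw [Lp.norm_def, Lp.norm_def] at h
    exact (ENNReal.toReal_eq_toReal_iff' (Lp.eLpNorm_ne_top _) (Lp.eLpNorm_ne_top _)).1 h
  have b := eLpNorm_nnreal_pow_eq_lintegral (p := 2) (f := 𝓕⁻ G) (μ := volume) two_ne_zero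
  have c := eLpNorm_nnreal_pow_eq_lintegral (p := 2) (f := G) (μ := volume) two_ne_zero
  simp only [ENNReal.coe_ofNat, NNReal.coe_ofNat, ENNReal.rpow_ofNat] at b c
  rw [← b, ← c, a]

/-! ### The Fourier transform with the unitary normalization -/

/-- The normalizing factor `(2π)^{-n/2}`. -/
def cn (n : ℕ) : ℝ := (2 * Real.pi) ^ (-(n : ℝ) / 2)

theorem cn_pos (n : ℕ) : 0 < cn n := by unfold cn; positivity

/-- The inverse Fourier transform `(2π)^{-n/2} ∫ e^{i x·q} G(q) dq`. -/
def invHat (G : Sp n → ℂ) (x : Sp n) : ℂ :=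
  (cn n : ℂ) * ∫ q, Complex.exp (Complex.I * ((inner ℝ x q : ℝ) : ℂ)) * G q

theorem invHat_eq (G : Sp n → ℂ) (x : Sp n) :
    invHat G x = (cn n : ℂ) * 𝓕⁻ G ((2 * Real.pi)⁻¹ • x) := by
  rw [invHat, Real.fourierInv_eq']
  congr 2
  ext q
  rw [smul_eq_mul, inner_smul_right, real_inner_comm]
  congr 2
  have : (Real.pi : ℂ) ≠ 0 := by exact_mod_cast Real.pi_ne_zero
  push_cast
  field_simp

theorem fourierHat_eq (φ : Sp n → ℂ) (ξ : Sp n) :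
    fourierHat φ ξ = (cn n : ℂ) * 𝓕 φ ((2 * Real.pi)⁻¹ • ξ) := by
  rw [fourierHat, Real.fourier_eq']
  congr 2
  ext q
  rw [smul_eq_mul, inner_smul_right]
  congr 2
  have : (Real.pi : ℂ) ≠ 0 := by exact_mod_cast Real.pi_ne_zero
  push_cast
  field_simp

theorem fourierHat_eq_invHat (φ : Sp n → ℂ) (ξ : Sp n) :
    fourierHat φ ξ = invHat φ (-ξ) := by
  simp only [fourierHat, invHat, cn, inner_neg_left, real_inner_comm]
  push_cast
  simp only [mul_neg]

/-- The squared normalization cancels the Jacobian of the frequency scaling by `(2π)⁻¹`; this makes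
`invHat` unitary and inverse to `hatS`. -/
theorem cn_sq_mul (n : ℕ) : cn n ^ 2 * (2 * Real.pi) ^ n = 1 := by
  rw [cn, ← Real.rpow_natCast, ← Real.rpow_mul (by positivity), ← Real.rpow_natCast,
    ← Real.rpow_add (by positivity)]
  have : -(n : ℝ) / 2 * ((2 : ℕ) : ℝ) + n = 0 := by push_cast; ring
  rw [this, Real.rpow_zero]

theorem lintegral_comp_smul_twoPi (F : Sp n → ℝ≥0∞) :
    ∫⁻ x, F ((2 * Real.pi)⁻¹ • x) = ENNReal.ofReal ((2 * Real.pi) ^ n) * ∫⁻ x, F x := by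
  have hr : (2 * Real.pi)⁻¹ ≠ 0 := by positivity
  have hm : MeasurableEmbedding (fun x : Sp n => (2 * Real.pi)⁻¹ • x) :=
    (Homeomorph.smulOfNeZero _ hr).measurableEmbedding
  rw [← hm.lintegral_map F, Measure.map_addHaar_smul _ hr, lintegral_smul_measure]
  simp only [finrank_euclideanSpace, Fintype.card_fin, inv_pow, inv_inv, smul_eq_mul]
  rw [abs_of_pos (by positivity)]

theorem lintegral_invHat_sq {G : Sp n → ℂ} (h1 : Integrable G) (h2 : MemLp G 2) :
    ∫⁻ x, ‖invHat G x‖ₑ ^ 2 = ∫⁻ x, ‖G x‖ₑ ^ 2 := by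
  simp only [invHat_eq, enorm_mul, mul_pow]
  rw [lintegral_const_mul' _ _ (by finiteness),
    lintegral_comp_smul_twoPi (fun y => ‖𝓕⁻ G y‖ₑ ^ 2), lintegral_fourierInv_sq h1 h2, ← mul_assoc]
  have : ‖((cn n : ℝ) : ℂ)‖ₑ ^ 2 * ENNReal.ofReal ((2 * Real.pi) ^ n) = 1 := by
    rw [← ofReal_norm, Complex.norm_real, Real.norm_of_nonneg (cn_pos n).le,
      ← ENNReal.ofReal_pow (cn_pos n).le, ← ENNReal.ofReal_mul (by positivity), cn_sq_mul,
      ENNReal.ofReal_one]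
  rw [this, one_mul]

/-- Multiplication by a nonzero scalar as a continuous linear equivalence. -/
def scaleEquiv (r : ℝ) (hr : r ≠ 0) : Sp n ≃L[ℝ] Sp n :=
  ContinuousLinearEquiv.smulLeft (Units.mk0 r hr)

/-- `invHat` of a Schwartz function, as a Schwartz function. -/
def invHatS (G : 𝓢(Sp n, ℂ)) : 𝓢(Sp n, ℂ) :=
  (cn n : ℂ) • SchwartzMap.compCLMOfContinuousLinearEquiv ℂ
    (scaleEquiv (2 * Real.pi)⁻¹ (by positivity)) (𝓕⁻ G)

theorem invHatS_apply (G : 𝓢(Sp n, ℂ)) (x : Sp n) : invHatS G x = invHat G x := by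
  rw [invHat_eq, ← SchwartzMap.fourierInv_coe]
  rfl

/-- `fourierHat` of a Schwartz function, as a Schwartz function. -/
def hatS (G : 𝓢(Sp n, ℂ)) : 𝓢(Sp n, ℂ) :=
  (cn n : ℂ) • SchwartzMap.compCLMOfContinuousLinearEquiv ℂ
    (scaleEquiv (2 * Real.pi)⁻¹ (by positivity)) (𝓕 G)

theorem hatS_apply (G : 𝓢(Sp n, ℂ)) (x : Sp n) : hatS G x = fourierHat G x := by
  rw [fourierHat_eq, ← SchwartzMap.fourier_coe]
  rfl

theorem invHat_hatS (φ : 𝓢(Sp n, ℂ)) (x : Sp n) : invHat (hatS φ) x = φ x := by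
  have h2 : (2 * Real.pi) ≠ 0 := by positivity
  have e : ∀ y, 𝓕 φ ((2 * Real.pi)⁻¹ • y) = (cn n : ℂ)⁻¹ * hatS φ y := by
    intro y
    have : (cn n : ℂ) ≠ 0 := by exact_mod_cast (cn_pos n).ne'
    rw [hatS_apply, fourierHat_eq, ← SchwartzMap.fourier_coe]
    field_simp
  have hφ : φ x = 𝓕⁻ (𝓕 φ) x := by simp
  have hc : (cn n : ℂ) ≠ 0 := by exact_mod_cast (cn_pos n).ne'
  rw [hφ, SchwartzMap.fourierInv_coe, Real.fourierInv_eq']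
  have hs := Measure.integral_comp_smul (volume : Measure (Sp n))
    (fun v => Complex.exp ((((2 * Real.pi * inner ℝ v x) : ℝ) : ℂ) * I) • 𝓕 φ v)
    (2 * Real.pi)⁻¹
  simp only [finrank_euclideanSpace, Fintype.card_fin, inv_pow, inv_inv] at hs
  rw [abs_of_pos (by positivity)] at hs
  have h5 : ∀ y : Sp n, Complex.exp ((((2 * Real.pi *
        inner ℝ ((2 * Real.pi)⁻¹ • y) x) : ℝ) : ℂ) * I) • 𝓕 φ ((2 * Real.pi)⁻¹ • y)
        = (cn n : ℂ)⁻¹ * (Complex.exp (I * ((inner ℝ x y : ℝ) : ℂ)) * hatS φ y) := by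
    intro y
    rw [e, smul_eq_mul, inner_smul_left, real_inner_comm]
    simp only [conj_trivial]
    have : 2 * Real.pi * ((2 * Real.pi)⁻¹ * inner ℝ x y) = inner ℝ x y := by
      field_simp
    rw [this, mul_comm I]
    ring
  simp only [h5] at hs
  rw [integral_const_mul, Complex.real_smul] at hs
  have h6 : (cn n : ℂ) ^ 2 * (((2 * Real.pi) ^ n : ℝ) : ℂ) = 1 := by
    exact_mod_cast cn_sq_mul n
  rw [invHat, ← one_mul (∫ v, _ • 𝓕 φ v), ← h6, mul_assoc, ← hs]
  field_simp

/-! ### Directional derivatives -/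

section Dir

variable {V W : Type*} [NormedAddCommGroup V] [NormedSpace ℝ V]
  [NormedAddCommGroup W] [NormedSpace ℝ W]

/-- The derivative of `f` in the direction `v`. -/
def dir (v : V) (f : V → W) : V → W := fun p => fderiv ℝ f p v

theorem contDiff_dir {f : V → W} (hf : ContDiff ℝ ∞ f) (v : V) : ContDiff ℝ ∞ (dir v f) :=
  (hf.fderiv_right (m := ∞) (by simp)).clm_apply contDiff_const

theorem dir_comm {f : V → W} (hf : ContDiff ℝ ∞ f) (v w : V) :
    dir v (dir w f) = dir w (dir v f) := by
  have hd : Differentiable ℝ (fderiv ℝ f) :=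
    (hf.fderiv_right (m := ∞) (by simp)).differentiable (by simp)
  have key : ∀ (a b : V) (p : V), dir a (dir b f) p = fderiv ℝ (fderiv ℝ f) p a b := by
    intro a b p
    unfold dir
    rw [fderiv_clm_apply (hd p) (differentiableAt_const b)]
    simp
  ext p
  rw [key, key]
  exact (hf.contDiffAt.isSymmSndFDerivAt
    (by simpa using WithTop.coe_le_coe.2 (le_top (a := (2 : ℕ∞))))) v w

theorem norm_sub_le_of_norm_fderiv_le_segment {f : V → W} (hf : Differentiable ℝ f) (p u : V)
    {D : ℝ} (h : ∀ t ∈ Set.Icc (0 : ℝ) 1, ‖fderiv ℝ f (p + t • u) u‖ ≤ D) :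
    ‖f (p + u) - f p‖ ≤ D := by
  have hd : ∀ t : ℝ, HasDerivAt (fun t : ℝ => f (p + t • u)) (fderiv ℝ f (p + t • u) u) t := by
    intro t
    have h1 : HasDerivAt (fun t : ℝ => p + t • u) u t := by
      simpa using ((hasDerivAt_id t).smul_const u).const_add p
    exact (hf (p + t • u)).hasFDerivAt.comp_hasDerivAt t h1
  have := norm_image_sub_le_of_norm_deriv_le_segment_01' (f := fun t : ℝ => f (p + t • u))
    (f' := fun t => fderiv ℝ f (p + t • u) u) (C := D)
    (fun t _ => (hd t).hasDerivWithinAt) (fun t ht => h t ⟨ht.1, ht.2.le⟩)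
  simpa using this

end Dir

/-! ### Compositions of powers of operators that commute on a stable class -/

section Fold

variable {X : Type*} (T : Fin n → X → X) (P : X → Prop)

/-- The composition of the powers `T_i^{α_i}` along a list of indices. -/
def foldOps (l : List (Fin n)) (α : Fin n → ℕ) (f : X) : X :=
  l.foldr (fun i g => (T i)^[α i] g) f

theorem foldOps_pred {T : Fin n → X → X} {P : X → Prop} (hP : ∀ i f, P f → P (T i f))
    (l : List (Fin n)) (α : Fin n → ℕ)
    {f : X} (hf : P f) : P (foldOps T l α f) := by
  induction l with
  | nil => exact hf
  | cons i l ih =>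
    change P ((T i)^[α i] (foldOps T l α f))
    exact Function.Iterate.rec P ih (fun g hg => hP i g hg) _

theorem foldOps_comm {T : Fin n → X → X} {P : X → Prop} {S : X → X}
    (hP : ∀ i f, P f → P (T i f)) (hS : ∀ i f, P f → S (T i f) = T i (S f))
    (l : List (Fin n)) (α : Fin n → ℕ) {f : X} (hf : P f) :
    S (foldOps T l α f) = foldOps T l α (S f) := by
  have aux : ∀ i (m : ℕ) g, P g → S ((T i)^[m] g) = (T i)^[m] (S g) := by
    intro i m
    induction m with
    | zero => intro g _; rfl
    | succ m ih => intro g hg; simp only [Function.iterate_succ_apply]; rw [ih _ (hP i g hg), hS i g hg]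
  induction l with
  | nil => rfl
  | cons i l ih =>
    change S ((T i)^[α i] (foldOps T l α f)) = (T i)^[α i] (foldOps T l α (S f))
    rw [aux i _ _ (foldOps_pred hP l α hf), ih]

theorem foldOps_single_of_notMem {T : Fin n → X → X} {l : List (Fin n)} {j : Fin n} (hj : j ∉ l)
    (α : Fin n → ℕ) (f : X) : foldOps T l (α + Pi.single j 1) f = foldOps T l α f := by
  induction l with
  | nil => rfl
  | cons i l ih =>
    have hij : i ≠ j := fun h => hj (by simp [h])
    change (T i)^[(α + Pi.single j 1 : Fin n → ℕ) i] (foldOps T l (α + Pi.single j 1) f) =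
      (T i)^[α i] (foldOps T l α f)
    rw [ih (fun h => hj (by simp [h]))]
    simp [hij]

/-- The extra `T j` is commuted inwards until it meets the power of `T j` already present; `Nodup`
ensures that only that one exponent changes. Commutation is assumed only on the class `P`, which
will be the smooth functions. -/
theorem foldOps_single {T : Fin n → X → X} {P : X → Prop}
    (hP : ∀ i f, P f → P (T i f)) (hc : ∀ i j f, P f → T j (T i f) = T i (T j f))
    {l : List (Fin n)} (hl : l.Nodup) {j : Fin n} (hj : j ∈ l)
    (α : Fin n → ℕ) {f : X} (hf : P f) :
    T j (foldOps T l α f) = foldOps T l (α + Pi.single j 1) f := by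
  induction l with
  | nil => simp at hj
  | cons i l ih =>
    change T j ((T i)^[α i] (foldOps T l α f)) =
      (T i)^[(α + Pi.single j 1 : Fin n → ℕ) i] (foldOps T l (α + Pi.single j 1) f)
    have hn := List.nodup_cons.1 hl
    by_cases hij : i = j
    · subst hij
      rw [foldOps_single_of_notMem hn.1]
      simp [Function.iterate_succ_apply']
    · have hj' : j ∈ l := by
        rcases List.mem_cons.1 hj with h | h
        · exact absurd h.symm hij
        · exact h
      rw [← ih hn.2 hj']
      have := foldOps_comm (S := T j) hP (fun i f hf => hc i j f hf) [i] (fun _ => α i)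
        (foldOps_pred hP l α hf)
      simpa [foldOps, hij] using this

theorem foldOps_dir_single {V W : Type*} [NormedAddCommGroup V] [NormedSpace ℝ V]
    [NormedAddCommGroup W] [NormedSpace ℝ W] (v : Fin n → V) (j : Fin n) (α : Fin n → ℕ)
    {f : V → W} (hf : ContDiff ℝ ∞ f) :
    dir (v j) (foldOps (fun i => dir (v i)) (List.finRange n) α f) =
      foldOps (fun i => dir (v i)) (List.finRange n) (α + Pi.single j 1) f :=
  foldOps_single (T := fun i => dir (v i)) (P := fun f : V → W => ContDiff ℝ ∞ f)
    (fun _ _ h => contDiff_dir h _)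
    (fun _ _ _ h => dir_comm h _ _) (List.nodup_finRange n) (List.mem_finRange j) α hf

end Fold

/-! ### Multi-index derivatives and mixed derivatives on phase space -/

section Multi

variable {F : Type*} [NormedAddCommGroup F] [NormedSpace ℝ F]

theorem multiDeriv_eq_foldOps (α : Fin n → ℕ) (f : Sp n → F) :
    multiDeriv α f = foldOps partialDeriv (List.finRange n) α f := rfl

theorem partialDeriv_multiDeriv (j : Fin n) (α : Fin n → ℕ) {f : Sp n → F} (hf : ContDiff ℝ ∞ f) :
    partialDeriv j (multiDeriv α f) = multiDeriv (α + Pi.single j 1) f :=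
  foldOps_dir_single (fun i => EuclideanSpace.single i (1 : ℝ)) j α hf

theorem multiDeriv_zero (f : Sp n → F) : multiDeriv 0 f = f := by
  rw [multiDeriv_eq_foldOps]
  induction List.finRange n with
  | nil => rfl
  | cons i l ih => exact ih

theorem multiDeriv_single (j : Fin n) {f : Sp n → F} (hf : ContDiff ℝ ∞ f) :
    multiDeriv (Pi.single j 1) f = partialDeriv j f := by
  have := partialDeriv_multiDeriv j 0 hf
  rw [zero_add, multiDeriv_zero] at this
  exact this.symm

/-- The partial derivative in the `j`-th space variable. -/
def dX (j : Fin n) : (Sp n × Sp n → F) → Sp n × Sp n → F :=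
  dir (EuclideanSpace.single j (1 : ℝ), 0)

/-- The partial derivative in the `j`-th frequency variable. -/
def dXi (j : Fin n) : (Sp n × Sp n → F) → Sp n × Sp n → F :=
  dir (0, EuclideanSpace.single j (1 : ℝ))

theorem partialDeriv_slice_left {H : Sp n × Sp n → F} (hH : ContDiff ℝ ∞ H) (j : Fin n)
    (x ξ : Sp n) : partialDeriv j (fun y => H (y, ξ)) x = dX j H (x, ξ) := by
  have h1 : HasFDerivAt (fun y : Sp n => (y, ξ)) (ContinuousLinearMap.inl ℝ (Sp n) (Sp n)) x :=
    hasFDerivAt_prodMk_left x ξ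
  have h2 := ((hH.differentiable (by simp)) (x, ξ)).hasFDerivAt.comp x h1
  have h3 : fderiv ℝ (fun y => H (y, ξ)) x = _ := h2.fderiv
  rw [partialDeriv, h3]
  simp [dX, dir]

theorem partialDeriv_slice_right {H : Sp n × Sp n → F} (hH : ContDiff ℝ ∞ H) (j : Fin n)
    (x ξ : Sp n) : partialDeriv j (fun η => H (x, η)) ξ = dXi j H (x, ξ) := by
  have h1 : HasFDerivAt (fun η : Sp n => (x, η)) (ContinuousLinearMap.inr ℝ (Sp n) (Sp n)) ξ :=
    hasFDerivAt_prodMk_right x ξ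
  have h2 := ((hH.differentiable (by simp)) (x, ξ)).hasFDerivAt.comp ξ h1
  have h3 : fderiv ℝ (fun y => H (x, y)) ξ = _ := h2.fderiv
  rw [partialDeriv, h3]
  simp [dXi, dir]

/-- The mixed derivative as an operator on functions of `(x, ξ)`. -/
def mixed (α β : Fin n → ℕ) (H : Sp n × Sp n → F) : Sp n × Sp n → F :=
  foldOps dX (List.finRange n) α (foldOps dXi (List.finRange n) β H)

theorem contDiff_foldOps_dir (v : Fin n → Sp n × Sp n) (l : List (Fin n)) (α : Fin n → ℕ)
    {H : Sp n × Sp n → F} (hH : ContDiff ℝ ∞ H) :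
    ContDiff ℝ ∞ (foldOps (fun j => dir (v j)) l α H) :=
  foldOps_pred (P := fun f : Sp n × Sp n → F => ContDiff ℝ ∞ f)
    (fun _ _ h => contDiff_dir h _) l α hH

theorem contDiff_mixed (α β : Fin n → ℕ) {H : Sp n × Sp n → F} (hH : ContDiff ℝ ∞ H) :
    ContDiff ℝ ∞ (mixed α β H) :=
  contDiff_foldOps_dir _ _ _ (contDiff_foldOps_dir _ _ _ hH)

theorem mixed_zero (H : Sp n × Sp n → F) : mixed 0 0 H = H := by
  have : ∀ (T : Fin n → (Sp n × Sp n → F) → Sp n × Sp n → F) (l : List (Fin n))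
      (G : Sp n × Sp n → F), foldOps T l 0 G = G := by
    intro T l G
    induction l with
    | nil => rfl
    | cons i l ih => exact ih
  rw [mixed, this, this]

theorem dX_mixed (j : Fin n) (α β : Fin n → ℕ) {H : Sp n × Sp n → F} (hH : ContDiff ℝ ∞ H) :
    dX j (mixed α β H) = mixed (α + Pi.single j 1) β H :=
  foldOps_dir_single (fun i => (EuclideanSpace.single i (1 : ℝ), 0)) j α
    (contDiff_foldOps_dir _ _ _ hH)

theorem dXi_mixed (j : Fin n) (α β : Fin n → ℕ) {H : Sp n × Sp n → F} (hH : ContDiff ℝ ∞ H) :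
    dXi j (mixed α β H) = mixed α (β + Pi.single j 1) H := by
  have h := foldOps_dir_single (fun i => ((0 : Sp n), EuclideanSpace.single i (1 : ℝ))) j β hH
  refine Eq.trans ?_ (congrArg (foldOps dX (List.finRange n) α) h)
  exact foldOps_comm (T := dX) (S := dXi j) (P := fun f : Sp n × Sp n → F => ContDiff ℝ ∞ f)
    (fun _ _ h => contDiff_dir h _) (fun _ _ h => dir_comm h _ _) _ α
    (contDiff_foldOps_dir _ _ _ hH)

/-- Here `r` restricts a function on phase space to a slice. Used once in each variable, it turns
iterated derivatives of slices into derivatives on phase space, where all of them commute. -/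
theorem multiDeriv_slice (S : Fin n → (Sp n × Sp n → F) → Sp n × Sp n → F)
    (r : (Sp n × Sp n → F) → Sp n → F) (hS : ∀ j H, ContDiff ℝ ∞ H → ContDiff ℝ ∞ (S j H))
    (hr : ∀ j H, ContDiff ℝ ∞ H → partialDeriv j (r H) = r (S j H))
    (α : Fin n → ℕ) {H : Sp n × Sp n → F} (hH : ContDiff ℝ ∞ H) :
    multiDeriv α (r H) = r (foldOps S (List.finRange n) α H) := by
  rw [multiDeriv_eq_foldOps]
  have aux : ∀ i (m : ℕ) G, ContDiff ℝ ∞ G → (partialDeriv i)^[m] (r G) = r ((S i)^[m] G) := by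
    intro i m
    induction m with
    | zero => intro g _; rfl
    | succ m ih =>
      intro g hg
      simp only [Function.iterate_succ_apply]
      rw [hr i g hg, ih _ (hS i g hg)]
  induction List.finRange n with
  | nil => rfl
  | cons i l ih =>
    change (partialDeriv i)^[α i] (foldOps partialDeriv l α (r H)) =
      r ((S i)^[α i] (foldOps S l α H))
    rw [ih, aux i _ _ (foldOps_pred (P := fun f : Sp n × Sp n → F => ContDiff ℝ ∞ f) hS l α hH)]

theorem mixedDeriv_eq_mixed {σ : Sp n → Sp n → ℂ}
    (hσ : ContDiff ℝ ∞ (fun p : Sp n × Sp n => σ p.1 p.2)) (α β : Fin n → ℕ) (x ξ : Sp n) :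
    mixedDeriv α β σ x ξ = mixed α β (fun p : Sp n × Sp n => σ p.1 p.2) (x, ξ) := by
  have h1 : ∀ y, multiDeriv β (σ y) ξ =
      foldOps dXi (List.finRange n) β (fun p : Sp n × Sp n => σ p.1 p.2) (y, ξ) := fun y =>
    congrFun (multiDeriv_slice dXi (fun H η => H (y, η)) (fun _ _ h => contDiff_dir h _)
      (fun j H h => funext fun η => partialDeriv_slice_right h j y η) β hσ) ξ
  simp only [mixedDeriv, h1]
  exact congrFun (multiDeriv_slice dX (fun H y => H (y, ξ)) (fun _ _ h => contDiff_dir h _)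
      (fun j H h => funext fun η => partialDeriv_slice_left h j η ξ) α
      (contDiff_foldOps_dir _ _ _ hσ)) x

theorem sum_single_eq (u : Sp n) : ∑ j, u j • EuclideanSpace.single j (1 : ℝ) = u := by
  simpa using (EuclideanSpace.basisFun (Fin n) ℝ).sum_repr u

theorem norm_clm_le {L : Sp n →L[ℝ] F} {B : ℝ}
    (h : ∀ j, ‖L (EuclideanSpace.single j 1)‖ ≤ B) (u : Sp n) : ‖L u‖ ≤ n * ‖u‖ * B := by
  conv_lhs => rw [← sum_single_eq u, map_sum]
  refine (norm_sum_le _ _).trans ?_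
  have : ∀ j ∈ Finset.univ, ‖L (u j • EuclideanSpace.single j (1 : ℝ))‖ ≤ ‖u‖ * B := by
    intro j _
    rw [map_smul, norm_smul]
    exact mul_le_mul (PiLp.norm_apply_le u j) (h j) (norm_nonneg _) (norm_nonneg _)
  refine (Finset.sum_le_sum this).trans ?_
  simp [mul_assoc]

end Multi

/-! ### Tempered weights -/

/-- A positive continuous function satisfying Peetre's inequality. -/
structure Tempered (w : Sp n → ℝ) : Prop where
  pos : ∀ ξ, 0 < w ξ
  cont : Continuous w
  peetre : ∃ (C : ℝ) (M : ℕ), 0 < C ∧ ∀ ξ η, w (ξ + η) ≤ C * (1 + ‖η‖) ^ M * w ξ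

/-! ### Peetre inequalities for powers of the weight -/

namespace IsWeight

variable {Λ : Sp n → ℝ} {μ : ℝ}

theorem mu_pos (h : IsWeight Λ μ) : 0 < μ := by
  obtain ⟨μ₀, μ₁, _, _, h0, h1, h2, _⟩ := h.growth
  linarith

theorem lower (h : IsWeight Λ μ) : ∃ c, 0 < c ∧ ∀ ξ, c ≤ Λ ξ := by
  obtain ⟨μ₀, μ₁, C₀, C₁, h0, h1, h2, h3, h4, h5⟩ := h.growth
  refine ⟨C₀, h3, fun ξ => le_trans ?_ (h5 ξ).1⟩
  have : (1 : ℝ) ≤ (1 + ‖ξ‖) ^ μ₀ := Real.one_le_rpow (by linarith [norm_nonneg ξ]) h0.le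
  nlinarith

theorem rpow_le_rpow (h : IsWeight Λ μ) {a b : ℝ} (hab : a ≤ b) :
    ∃ C, 0 < C ∧ ∀ ξ, Λ ξ ^ a ≤ C * Λ ξ ^ b := by
  obtain ⟨c, hc, hl⟩ := h.lower
  refine ⟨c ^ (a - b), by positivity, fun ξ => ?_⟩
  have hp := h.pos ξ
  have : Λ ξ ^ a = Λ ξ ^ (a - b) * Λ ξ ^ b := by rw [← Real.rpow_add hp]; ring_nf
  rw [this]
  exact mul_le_mul_of_nonneg_right (Real.rpow_le_rpow_of_nonpos hc (hl ξ) (by linarith))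
    (Real.rpow_nonneg hp.le _)

theorem fderiv_bound (h : IsWeight Λ μ) :
    ∃ C, 0 < C ∧ ∀ ξ u, ‖fderiv ℝ Λ ξ u‖ ≤ C * Λ ξ ^ (1 - 1 / μ) * ‖u‖ := by
  have h1 : ∀ j : Fin n, ∃ C : ℝ, 0 < C ∧ ∀ ξ, |partialDeriv j Λ ξ| ≤ C * Λ ξ ^ (1 - 1 / μ) := by
    intro j
    -- The first order case, with `γ = 0`.
    obtain ⟨C, hC, hb⟩ := h.deriv_bound (Pi.single j 1) 0 (by simp)
    refine ⟨C, hC, fun ξ => ?_⟩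
    have := hb ξ
    rw [add_zero, multiDeriv_single j h.smooth] at this
    simpa [monomial, multiLength] using this
  choose C hC hb using h1
  refine ⟨n * (∑ j, C j) + 1, ?_, fun ξ u => ?_⟩
  · have : 0 ≤ ∑ j, C j := Finset.sum_nonneg fun j _ => (hC j).le
    positivity
  · have hp : 0 < Λ ξ ^ (1 - 1 / μ) := Real.rpow_pos_of_pos (h.pos ξ) _
    have := norm_clm_le (L := fderiv ℝ Λ ξ) (B := (∑ j, C j) * Λ ξ ^ (1 - 1 / μ)) (fun j => by
      refine (hb j ξ).trans ?_
      gcongr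
      exact Finset.single_le_sum (fun j _ => (hC j).le) (Finset.mem_univ j)) u
    refine this.trans ?_
    have : 0 ≤ Λ ξ ^ (1 - 1 / μ) * ‖u‖ := by positivity
    nlinarith

theorem fderiv_rpow (h : IsWeight Λ μ) (k : ℝ) (ξ : Sp n) :
    HasFDerivAt (fun ξ => Λ ξ ^ k) ((k * Λ ξ ^ (k - 1)) • fderiv ℝ Λ ξ) ξ :=
  ((h.smooth.differentiable (by simp)) ξ).hasFDerivAt.rpow_const (Or.inl (h.pos ξ).ne')

theorem fderiv_rpow_bound (h : IsWeight Λ μ) (k : ℝ) :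
    ∃ C, 0 < C ∧ ∀ ξ u, ‖fderiv ℝ (fun ξ => Λ ξ ^ k) ξ u‖ ≤ C * Λ ξ ^ (k - 1 / μ) * ‖u‖ := by
  obtain ⟨C, hC, hb⟩ := h.fderiv_bound
  refine ⟨(|k| + 1) * C, by positivity, fun ξ u => ?_⟩
  rw [(h.fderiv_rpow k ξ).fderiv]
  have hp := h.pos ξ
  rw [_root_.smul_apply, norm_smul, Real.norm_eq_abs, abs_mul,
    abs_of_pos (Real.rpow_pos_of_pos hp _)]
  have e : Λ ξ ^ (k - 1 / μ) = Λ ξ ^ (k - 1) * Λ ξ ^ (1 - 1 / μ) := by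
    rw [← Real.rpow_add hp]; ring_nf
  rw [e]
  calc |k| * Λ ξ ^ (k - 1) * ‖fderiv ℝ Λ ξ u‖
      ≤ (|k| + 1) * Λ ξ ^ (k - 1) * (C * Λ ξ ^ (1 - 1 / μ) * ‖u‖) := by
        gcongr
        · linarith
        · exact hb ξ u
    _ = _ := by ring

/-- The gradient of `Λ^{1/μ}` is bounded, because the exponent `k - 1/μ` in `fderiv_rpow_bound`
vanishes at `k = 1/μ`. So `Λ^{1/μ}` is Lipschitz; being bounded below, it absorbs the additive
increment into a factor `D (1 + |η|)`. Raising to the power `μ` concludes. -/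
theorem peetre_base (h : IsWeight Λ μ) :
    ∃ (C : ℝ) (M : ℕ), 1 ≤ C ∧ ∀ ξ η, Λ (ξ + η) ≤ C * (1 + ‖η‖) ^ M * Λ ξ := by
  obtain ⟨C, hC, hb⟩ := h.fderiv_rpow_bound (1 / μ)
  obtain ⟨c, hc, hl⟩ := h.lower
  have hμ := h.mu_pos
  have hd : Differentiable ℝ (fun ξ => Λ ξ ^ (1 / μ)) := fun ξ =>
    (h.fderiv_rpow (1 / μ) ξ).differentiableAt
  set D := max 1 (C / c ^ (1 / μ)) with hD
  have hD1 : 1 ≤ D := le_max_left _ _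
  have key : ∀ ξ η, Λ (ξ + η) ^ (1 / μ) ≤ D * (1 + ‖η‖) * Λ ξ ^ (1 / μ) := by
    intro ξ η
    have h1 := norm_sub_le_of_norm_fderiv_le_segment hd ξ η (D := C * ‖η‖) (fun t _ => by
      simpa using hb (ξ + t • η) η)
    have h2 : Λ (ξ + η) ^ (1 / μ) ≤ Λ ξ ^ (1 / μ) + C * ‖η‖ := by
      have := (abs_le.1 h1).2; linarith
    have h3 : c ^ (1 / μ) ≤ Λ ξ ^ (1 / μ) :=
      Real.rpow_le_rpow hc.le (hl ξ) (by positivity)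
    have h4 : 0 < c ^ (1 / μ) := by positivity
    have h5 : C ≤ D * c ^ (1 / μ) := by
      rw [← div_le_iff₀ h4]; exact le_max_right _ _
    have h6 : C ≤ D * Λ ξ ^ (1 / μ) := h5.trans (by gcongr)
    have h7 : Λ ξ ^ (1 / μ) ≤ D * Λ ξ ^ (1 / μ) := le_mul_of_one_le_left
      (Real.rpow_nonneg (h.pos ξ).le _) hD1
    have := mul_le_mul_of_nonneg_right h6 (norm_nonneg η)
    nlinarith
  refine ⟨D ^ μ, ⌈μ⌉₊, Real.one_le_rpow hD1 hμ.le, fun ξ η => ?_⟩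
  have e : ∀ ξ, (Λ ξ ^ (1 / μ)) ^ μ = Λ ξ := fun ξ => by
    rw [← Real.rpow_mul (h.pos ξ).le, one_div_mul_cancel hμ.ne', Real.rpow_one]
  have hp := h.pos ξ
  calc Λ (ξ + η) = (Λ (ξ + η) ^ (1 / μ)) ^ μ := (e _).symm
    _ ≤ (D * (1 + ‖η‖) * Λ ξ ^ (1 / μ)) ^ μ :=
      Real.rpow_le_rpow (Real.rpow_nonneg (h.pos _).le _) (key ξ η) hμ.le
    _ = D ^ μ * (1 + ‖η‖) ^ μ * Λ ξ := by
      rw [Real.mul_rpow (by positivity) (by positivity), Real.mul_rpow (by positivity)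
        (by positivity), e]
    _ ≤ D ^ μ * (1 + ‖η‖) ^ ⌈μ⌉₊ * Λ ξ := by
      gcongr
      rw [← Real.rpow_natCast]
      exact Real.rpow_le_rpow_of_exponent_le (by linarith [norm_nonneg η]) (Nat.le_ceil μ)

theorem tempered_rpow (h : IsWeight Λ μ) (k : ℝ) : Tempered (fun ξ => Λ ξ ^ k) := by
  refine ⟨fun ξ => Real.rpow_pos_of_pos (h.pos ξ) _,
    h.smooth.continuous.rpow_const fun ξ => Or.inl (h.pos ξ).ne', ?_⟩
  obtain ⟨C, M, hC, hb⟩ := h.peetre_base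
  refine ⟨C ^ |k|, ⌈(M : ℝ) * |k|⌉₊, by positivity, fun ξ η => ?_⟩
  have h1 : (C * (1 + ‖η‖) ^ M) ^ |k| ≤ C ^ |k| * (1 + ‖η‖) ^ ⌈(M : ℝ) * |k|⌉₊ := by
    rw [Real.mul_rpow (by positivity) (by positivity), ← Real.rpow_natCast (1 + ‖η‖) M,
      ← Real.rpow_mul (by positivity), ← Real.rpow_natCast]
    gcongr
    · linarith [norm_nonneg η]
    · exact Nat.le_ceil _
  have hp := h.pos ξ
  have hq := h.pos (ξ + η)
  refine le_trans ?_ (mul_le_mul_of_nonneg_right h1 (by positivity))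
  rcases le_total 0 k with hk | hk
  · rw [abs_of_nonneg hk, ← Real.mul_rpow (by positivity) hp.le]
    exact Real.rpow_le_rpow hq.le (hb ξ η) hk
  · have h2 := hb (ξ + η) (-η)
    rw [add_neg_cancel_right, norm_neg] at h2
    have h3 := Real.rpow_le_rpow_of_nonpos hp h2 hk
    rw [Real.mul_rpow (by positivity) hq.le] at h3
    rw [abs_of_nonpos hk, Real.rpow_neg (by positivity)]
    rw [← div_eq_inv_mul, le_div_iff₀ (by positivity)]
    linarith

/-- Mean value theorem: differentiation gains `Λ^{-1/μ}`, which is at least as good as `Λ^{-ρ}`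
because `ρ ≤ 1/μ`, and Peetre moves the weight from the segment back to `ξ`. -/
theorem abs_rpow_sub_le (h : IsWeight Λ μ) {ρ : ℝ} (hρ : ρ ≤ 1 / μ) (k : ℝ) :
    ∃ (C : ℝ) (M : ℕ), 0 < C ∧
      ∀ ξ η, |Λ (ξ + η) ^ k - Λ ξ ^ k| ≤ C * (1 + ‖η‖) ^ M * Λ ξ ^ (k - ρ) := by
  obtain ⟨C₁, hC₁, h1⟩ := h.fderiv_rpow_bound k
  obtain ⟨C₂, hC₂, h2⟩ := h.rpow_le_rpow (show k - 1 / μ ≤ k - ρ by linarith)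
  obtain ⟨C₃, M, hC₃, h3⟩ := (h.tempered_rpow (k - ρ)).peetre
  refine ⟨C₁ * C₂ * C₃, M + 1, by positivity, fun ξ η => ?_⟩
  have hd : Differentiable ℝ (fun ξ => Λ ξ ^ k) := fun ξ =>
    (h.fderiv_rpow k ξ).differentiableAt
  refine norm_sub_le_of_norm_fderiv_le_segment hd ξ η fun t ht => ?_
  refine (h1 _ _).trans ?_
  have h4 : ‖t • η‖ ≤ ‖η‖ := by
    rw [norm_smul, Real.norm_of_nonneg ht.1]
    exact mul_le_of_le_one_left (norm_nonneg _) ht.2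
  have hp : 0 < Λ ξ ^ (k - ρ) := Real.rpow_pos_of_pos (h.pos ξ) _
  have h5 := (h2 (ξ + t • η)).trans (mul_le_mul_of_nonneg_left (h3 ξ (t • η)) hC₂.le)
  calc C₁ * Λ (ξ + t • η) ^ (k - 1 / μ) * ‖η‖
      ≤ C₁ * (C₂ * (C₃ * (1 + ‖η‖) ^ M * Λ ξ ^ (k - ρ))) * (1 + ‖η‖) := by
        gcongr
        · refine h5.trans ?_
          gcongr
        · linarith
    _ = _ := by ring

end IsWeight

/-! ### Symbol classes with finitely many seminorms -/

/-- `a` is smooth and its derivatives of order at most `N` along the coordinate directions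
are bounded by `A w(ξ)`. -/
def SymB (w : Sp n → ℝ) : ℕ → ℝ → (Sp n × Sp n → ℂ) → Prop
  | 0, A, a => ContDiff ℝ ∞ a ∧ ∀ p, ‖a p‖ ≤ A * w p.2
  | N + 1, A, a => SymB w N A a ∧ ∀ j, SymB w N A (dX j a) ∧ SymB w N A (dXi j a)

namespace SymB

variable {w : Sp n → ℝ} {N : ℕ} {A B : ℝ} {a : Sp n × Sp n → ℂ}

theorem smooth (h : SymB w N A a) : ContDiff ℝ ∞ a := by
  induction N generalizing a with
  | zero => exact h.1
  | succ N ih => exact ih h.1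

theorem bound (h : SymB w N A a) (p : Sp n × Sp n) : ‖a p‖ ≤ A * w p.2 := by
  induction N generalizing a with
  | zero => exact h.2 p
  | succ N ih => exact ih h.1

theorem nonneg (hw : Tempered w) (h : SymB w N A a) : 0 ≤ A := by
  have := (norm_nonneg _).trans (h.bound (0, 0))
  exact nonneg_of_mul_nonneg_left this (hw.pos 0)

theorem mono (hw : Tempered w) (h : SymB w N A a) (hAB : A ≤ B) : SymB w N B a := by
  induction N generalizing a with
  | zero => exact ⟨h.1, fun p => (h.2 p).trans (mul_le_mul_of_nonneg_right hAB (hw.pos _).le)⟩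
  | succ N ih => exact ⟨ih h.1, fun j => ⟨ih (h.2 j).1, ih (h.2 j).2⟩⟩

theorem of_le {N' : ℕ} (h : SymB w N A a) (hN : N' ≤ N) : SymB w N' A a := by
  induction N with
  | zero => rwa [Nat.le_zero.1 hN]
  | succ N ih =>
    rcases hN.lt_or_eq with h' | h'
    · exact ih h.1 (Nat.lt_succ_iff.1 h')
    · rwa [h']

end SymB

/-! ### Translations of symbols and their differences -/

/-- Translation of a function. -/
def tr {F : Type*} (u : Sp n × Sp n) (a : Sp n × Sp n → F) : Sp n × Sp n → F := fun p => a (p + u)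

theorem dir_tr {F : Type*} [NormedAddCommGroup F] [NormedSpace ℝ F] (v u : Sp n × Sp n)
    (a : Sp n × Sp n → F) : dir v (tr u a) = tr u (dir v a) := by
  ext p
  unfold dir tr
  rw [fderiv_comp_add_right]

theorem contDiff_tr {F : Type*} [NormedAddCommGroup F] [NormedSpace ℝ F] {u : Sp n × Sp n}
    {a : Sp n × Sp n → F} (ha : ContDiff ℝ ∞ a) : ContDiff ℝ ∞ (tr u a) :=
  ha.comp (contDiff_id.add contDiff_const)

theorem SymB.tr {w : Sp n → ℝ} {N : ℕ} {A : ℝ} {a : Sp n × Sp n → ℂ} (h : SymB w N A a)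
    (u : Sp n) : SymB w N A (tr (u, 0) a) := by
  induction N generalizing a with
  | zero =>
    refine ⟨contDiff_tr h.1, fun p => ?_⟩
    have := h.2 (p + (u, 0))
    rwa [show (p + ((u, 0) : Sp n × Sp n)).2 = p.2 from add_zero _] at this
  | succ N ih =>
    refine ⟨ih h.1, fun j => ⟨?_, ?_⟩⟩
    · rw [dX, dir_tr]; exact ih (h.2 j).1
    · rw [dXi, dir_tr]; exact ih (h.2 j).2

theorem dir_tr_sub {a : Sp n × Sp n → ℂ} (ha : ContDiff ℝ ∞ a) (v u : Sp n × Sp n) :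
    dir v (tr u a - a) = tr u (dir v a) - dir v a := by
  rw [← dir_tr]
  ext p
  unfold dir
  rw [fderiv_sub ((contDiff_tr ha).differentiable (by simp) p) (ha.differentiable (by simp) p)]
  rfl

/-- Translation commutes with derivatives, so only the mean value estimate matters. The weight
ignores position, hence the bound is linear in `‖u‖`. -/
theorem symB_tr_sub_left {w : Sp n → ℝ} {N : ℕ} {A : ℝ} {a : Sp n × Sp n → ℂ}
    (ha : ContDiff ℝ ∞ a) (h : ∀ j, SymB w N A (dX j a)) (u : Sp n) :
    SymB w N (n * ‖u‖ * A) (tr (u, 0) a - a) := by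
  induction N generalizing a with
  | zero =>
    refine ⟨(contDiff_tr ha).sub ha, fun p => ?_⟩
    refine norm_sub_le_of_norm_fderiv_le_segment (ha.differentiable (by simp)) p (u, 0)
      fun t _ => ?_
    have := norm_clm_le (L := (fderiv ℝ a (p + t • (u, 0))).comp
      (ContinuousLinearMap.inl ℝ (Sp n) (Sp n))) (B := A * w p.2) (fun j => by
        have := (h j).2 (p + t • (u, 0))
        simpa [dX, dir] using this) u
    rw [mul_assoc]
    simpa using this
  | succ N ih =>
    refine ⟨ih ha fun j => (h j).1, fun j => ⟨?_, ?_⟩⟩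
    · rw [dX, dir_tr_sub ha]
      exact ih (contDiff_dir ha _) fun i => by
        have := ((h i).2 j).1
        rwa [dX, dX, dir_comm ha] at this
    · rw [dXi, dir_tr_sub ha]
      exact ih (contDiff_dir ha _) fun i => by
        have := ((h i).2 j).2
        rwa [dXi, dX, dir_comm ha] at this

/-- As in the position case, except that the weight varies along the segment. Peetre brings it back
to `ξ` at the price of `(1 + ‖u‖) ^ M`. -/
theorem symB_tr_sub_right {w : Sp n → ℝ} (hw : Tempered w) {N : ℕ} {A C : ℝ} {M : ℕ}
    (hA : 0 ≤ A) (hC : 0 ≤ C)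
    (hM : ∀ ξ η, w (ξ + η) ≤ C * (1 + ‖η‖) ^ M * w ξ) {a : Sp n × Sp n → ℂ}
    (ha : ContDiff ℝ ∞ a) (h : ∀ j, SymB w N A (dXi j a)) (u : Sp n) :
    SymB w N (n * A * C * (1 + ‖u‖) ^ (M + 1)) (tr (0, u) a - a) := by
  induction N generalizing a with
  | zero =>
    refine ⟨(contDiff_tr ha).sub ha, fun p => ?_⟩
    refine norm_sub_le_of_norm_fderiv_le_segment (ha.differentiable (by simp)) p (0, u)
      fun t ht => ?_
    have h4 : ‖t • u‖ ≤ ‖u‖ := by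
      rw [norm_smul, Real.norm_of_nonneg ht.1]
      exact mul_le_of_le_one_left (norm_nonneg _) ht.2
    have hp := hw.pos p.2
    have h5 : w (p.2 + t • u) ≤ C * (1 + ‖u‖) ^ M * w p.2 := by
      refine (hM _ _).trans ?_
      gcongr
    have := norm_clm_le (L := (fderiv ℝ a (p + t • (0, u))).comp
      (ContinuousLinearMap.inr ℝ (Sp n) (Sp n))) (B := A * (C * (1 + ‖u‖) ^ M * w p.2))
      (fun j => by
        have := (h j).2 (p + t • (0, u))
        refine le_trans (by simpa [dXi, dir] using this) ?_
        gcongr) u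
    refine le_trans (by simpa using this) ?_
    calc n * ‖u‖ * (A * (C * (1 + ‖u‖) ^ M * w p.2))
        ≤ n * (1 + ‖u‖) * (A * (C * (1 + ‖u‖) ^ M * w p.2)) := by gcongr; linarith
      _ = _ := by ring
  | succ N ih =>
    refine ⟨ih ha fun j => (h j).1, fun j => ⟨?_, ?_⟩⟩
    · rw [dX, dir_tr_sub ha]
      exact ih (contDiff_dir ha _) fun i => by
        have := ((h i).2 j).1
        rwa [dX, dXi, dir_comm ha] at this
    · rw [dXi, dir_tr_sub ha]
      exact ih (contDiff_dir ha _) fun i => by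
        have := ((h i).2 j).2
        rwa [dXi, dXi, dir_comm ha] at this

/-! ### From symbol estimates to finitely many seminorms -/

theorem IsSymbolM.isSymbolS {Λ : Sp n → ℝ} {ρ k : ℝ} {σ : Sp n → Sp n → ℂ}
    (h : IsSymbolM Λ ρ k σ) : IsSymbolS Λ ρ k σ := by
  have := h 0 (by simp)
  simpa [monomial, multiDeriv_zero] using this

/-- Only `l` of the gains `Λ^{-ρ}` are kept: `Λ` is bounded below, so those of further frequency
derivatives may be discarded, and all derivatives then share one weight. -/
theorem IsSymbolS.exists_symB_mixed {Λ : Sp n → ℝ} {μ ρ k : ℝ} (hΛ : IsWeight Λ μ) (hρ : 0 ≤ ρ)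
    {σ : Sp n → Sp n → ℂ} (h : IsSymbolS Λ ρ k σ) (N l : ℕ) (α β : Fin n → ℕ)
    (hl : l ≤ multiLength β) : ∃ A, 0 < A ∧
      SymB (fun ξ => Λ ξ ^ (k - ρ * l)) N A (mixed α β (fun p : Sp n × Sp n => σ p.1 p.2)) := by
  have hw := hΛ.tempered_rpow (k - ρ * l)
  induction N generalizing α β with
  | zero =>
    obtain ⟨C, hC, hb⟩ := h.bound α β
    obtain ⟨D, hD, hd⟩ := hΛ.rpow_le_rpow (show k - ρ * multiLength β ≤ k - ρ * l by gcongr)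
    refine ⟨C * D, by positivity, contDiff_mixed _ _ h.smooth, fun p => ?_⟩
    rw [← mixedDeriv_eq_mixed h.smooth, mul_assoc]
    exact (hb _ _).trans (mul_le_mul_of_nonneg_left (hd _) hC.le)
  | succ N ih =>
    obtain ⟨A, hA, h0⟩ := ih α β hl
    have hx : ∀ j, ∃ A, 0 < A ∧ SymB (fun ξ => Λ ξ ^ (k - ρ * l)) N A
        (dX j (mixed α β (fun p : Sp n × Sp n => σ p.1 p.2))) := fun j => by
      rw [dX_mixed j α β h.smooth]; exact ih _ _ hl
    have hy : ∀ j, ∃ A, 0 < A ∧ SymB (fun ξ => Λ ξ ^ (k - ρ * l)) N A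
        (dXi j (mixed α β (fun p : Sp n × Sp n => σ p.1 p.2))) := fun j => by
      rw [dXi_mixed j α β h.smooth]
      refine ih _ _ (hl.trans ?_)
      simp [multiLength, Finset.sum_add_distrib]
    choose Ax hAx hx using hx
    choose Ay hAy hy using hy
    have sx : ∀ j, Ax j ≤ ∑ j, Ax j := fun j =>
      Finset.single_le_sum (fun j _ => (hAx j).le) (Finset.mem_univ j)
    have sy : ∀ j, Ay j ≤ ∑ j, Ay j := fun j =>
      Finset.single_le_sum (fun j _ => (hAy j).le) (Finset.mem_univ j)
    have px : 0 ≤ ∑ j, Ax j := Finset.sum_nonneg fun j _ => (hAx j).le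
    have py : 0 ≤ ∑ j, Ay j := Finset.sum_nonneg fun j _ => (hAy j).le
    exact ⟨A + ∑ j, Ax j + ∑ j, Ay j, by positivity, h0.mono hw (by linarith), fun j =>
      ⟨(hx j).mono hw (by linarith [sx j]), (hy j).mono hw (by linarith [sy j])⟩⟩

/-- The cases `l = 0` and `l = 1`. The second makes frequency translations an error of lower order.
-/
theorem IsSymbolS.exists_symB {Λ : Sp n → ℝ} {μ ρ k : ℝ} (hΛ : IsWeight Λ μ) (hρ : 0 ≤ ρ)
    {σ : Sp n → Sp n → ℂ} (h : IsSymbolS Λ ρ k σ) (N : ℕ) : ∃ A, 0 < A ∧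
      SymB (fun ξ => Λ ξ ^ k) N A (fun p : Sp n × Sp n => σ p.1 p.2) ∧
      ∀ j, SymB (fun ξ => Λ ξ ^ (k - ρ)) N A (dXi j (fun p : Sp n × Sp n => σ p.1 p.2)) := by
  obtain ⟨A, hA, h0⟩ := h.exists_symB_mixed hΛ hρ N 0 0 0 (by simp)
  rw [mixed_zero] at h0
  have hy : ∀ j, ∃ A, 0 < A ∧ SymB (fun ξ => Λ ξ ^ (k - ρ)) N A
      (dXi j (fun p : Sp n × Sp n => σ p.1 p.2)) := fun j => by
    have := h.exists_symB_mixed hΛ hρ N 1 0 (0 + Pi.single j 1) (by simp [multiLength])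
    rw [← dXi_mixed j 0 0 h.smooth, mixed_zero] at this
    simpa using this
  choose Ay hAy hy using hy
  have sy : ∀ j, Ay j ≤ ∑ j, Ay j := fun j =>
    Finset.single_le_sum (fun j _ => (hAy j).le) (Finset.mem_univ j)
  have py : 0 ≤ ∑ j, Ay j := Finset.sum_nonneg fun j _ => (hAy j).le
  refine ⟨A + ∑ j, Ay j, by positivity, ?_, fun j => (hy j).mono (hΛ.tempered_rpow _)
    (by linarith [sy j])⟩
  have := h0.mono (hΛ.tempered_rpow _) (show A ≤ A + ∑ j, Ay j by linarith)
  simpa using this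

/-! ### Polynomially bounded functions against Schwartz functions -/

/-- A measurable function with polynomial growth. -/
structure PolyB (g : Sp n → ℂ) : Prop where
  meas : Measurable g
  bound : ∃ (C : ℝ) (M : ℕ), 0 ≤ C ∧ ∀ q, ‖g q‖ ≤ C * (1 + ‖q‖) ^ M

theorem PolyB.mul {g h : Sp n → ℂ} (hg : PolyB g) (hh : PolyB h) : PolyB (fun q => g q * h q) := by
  obtain ⟨C, M, hC, h1⟩ := hg.bound
  obtain ⟨D, K, hD, h2⟩ := hh.bound
  refine ⟨hg.meas.mul hh.meas, C * D, M + K, by positivity, fun q => ?_⟩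
  rw [norm_mul, pow_add]
  calc ‖g q‖ * ‖h q‖ ≤ (C * (1 + ‖q‖) ^ M) * (D * (1 + ‖q‖) ^ K) := by
        gcongr
        · exact h1 q
        · exact h2 q
    _ = _ := by ring

theorem PolyB.of_norm_le_one {g : Sp n → ℂ} (hg : Measurable g) (h : ∀ q, ‖g q‖ ≤ 1) : PolyB g :=
  ⟨hg, 1, 0, zero_le_one, by simpa using h⟩

theorem PolyB.const (c : ℂ) : PolyB (fun _ : Sp n => c) :=
  ⟨measurable_const, ‖c‖, 0, norm_nonneg _, by simp⟩

theorem PolyB.coord (j : Fin n) : PolyB (fun q : Sp n => Complex.I * (q j : ℂ)) := by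
  refine ⟨by fun_prop, 1, 1, zero_le_one, fun q => ?_⟩
  have := PiLp.norm_apply_le q j
  simp only [norm_mul, Complex.norm_I, Complex.norm_real, one_mul, pow_one]
  linarith

/-- Since `1 + ‖q‖` is not smooth at the origin, it is replaced by the larger polynomial `2 (1 +
‖q‖²)`, which multiplies Schwartz functions. -/
theorem PolyB.exists_schwartz {g : Sp n → ℂ} (hg : PolyB g) (f : 𝓢(Sp n, ℂ)) :
    ∃ F : 𝓢(Sp n, ℂ), ∀ q, ‖g q * f q‖ ≤ ‖F q‖ := by
  obtain ⟨C, M, hC, h1⟩ := hg.bound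
  have ht : Function.HasTemperateGrowth
      (fun q : Sp n => (((C * (2 * (1 + ‖q‖ ^ 2)) ^ M : ℝ)) : ℂ)) := by
    have := Function.hasTemperateGrowth_norm_sq (H := Sp n)
    fun_prop
  refine ⟨SchwartzMap.smulLeftCLM ℂ
    (fun q : Sp n => (((C * (2 * (1 + ‖q‖ ^ 2)) ^ M : ℝ)) : ℂ)) f, fun q => ?_⟩
  rw [SchwartzMap.smulLeftCLM_apply_apply ht, smul_eq_mul, norm_mul, norm_mul, Complex.norm_real,
    Real.norm_of_nonneg (by positivity)]
  refine mul_le_mul_of_nonneg_right ((h1 q).trans ?_) (norm_nonneg _)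
  gcongr
  nlinarith [sq_nonneg (‖q‖ - 1), norm_nonneg q]

theorem PolyB.integrable_mul {g : Sp n → ℂ} (hg : PolyB g) (f : 𝓢(Sp n, ℂ)) :
    Integrable (fun q => g q * f q) := by
  obtain ⟨F, hF⟩ := hg.exists_schwartz f
  exact F.integrable.mono (hg.meas.mul f.continuous.measurable).aestronglyMeasurable
    (ae_of_all _ hF)

theorem PolyB.memLp_mul {g : Sp n → ℂ} (hg : PolyB g) (f : 𝓢(Sp n, ℂ)) :
    MemLp (fun q => g q * f q) 2 := by
  obtain ⟨F, hF⟩ := hg.exists_schwartz f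
  exact (F.memLp 2).mono (hg.meas.mul f.continuous.measurable).aestronglyMeasurable
    (ae_of_all _ hF)

/-- Translation of a Schwartz function. -/
def trS (η : Sp n) (f : 𝓢(Sp n, ℂ)) : 𝓢(Sp n, ℂ) :=
  SchwartzMap.compCLMOfAntilipschitz ℂ (K := 1) (g := fun q => η + q)
    (by fun_prop) ((isometry_add_left η).antilipschitz) f

@[simp] theorem trS_apply (η : Sp n) (f : 𝓢(Sp n, ℂ)) (q : Sp n) : trS η f q = f (η + q) := rfl

/-- Reflection of a Schwartz function. -/
def reflS (f : 𝓢(Sp n, ℂ)) : 𝓢(Sp n, ℂ) :=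
  SchwartzMap.compCLMOfContinuousLinearEquiv ℂ (ContinuousLinearEquiv.neg ℝ) f

@[simp] theorem reflS_apply (f : 𝓢(Sp n, ℂ)) (q : Sp n) : reflS f q = f (-q) := rfl

theorem norm_cexp_I_mul (r : ℝ) : ‖Complex.exp (Complex.I * (r : ℂ))‖ = 1 := by
  rw [mul_comm, Complex.norm_exp_ofReal_mul_I]

theorem continuous_phase : Continuous (fun p : Sp n × Sp n =>
    Complex.exp (Complex.I * ((inner ℝ p.1 p.2 : ℝ) : ℂ))) := by fun_prop

theorem norm_invHat_le (G : Sp n → ℂ) (x : Sp n) : ‖invHat G x‖ ≤ cn n * ∫ q, ‖G q‖ := by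
  rw [invHat, norm_mul, Complex.norm_real, Real.norm_of_nonneg (cn_pos n).le]
  refine mul_le_mul_of_nonneg_left ((norm_integral_le_integral_norm _).trans (le_of_eq ?_))
    (cn_pos n).le
  simp only [norm_mul, norm_cexp_I_mul, one_mul]

theorem hasFDerivAt_invHat {G : Sp n → ℂ} (h1 : Integrable G)
    (h2 : Integrable (fun q => ‖q‖ * ‖G q‖)) (x : Sp n) :
    ∃ D : Sp n →L[ℝ] ℂ, HasFDerivAt (invHat G) D x ∧
      ∀ j, D (EuclideanSpace.single j 1) = invHat (fun q => Complex.I * (q j : ℂ) * G q) x := by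
  let F' : Sp n → Sp n → Sp n →L[ℝ] ℂ := fun x q =>
    (Complex.exp (Complex.I * ((inner ℝ x q : ℝ) : ℂ)) * G q * Complex.I) •
      (Complex.ofRealCLM.comp (innerSL ℝ q))
  have hm : ∀ x : Sp n, AEStronglyMeasurable
      (fun q => Complex.exp (Complex.I * ((inner ℝ x q : ℝ) : ℂ)) * G q) := fun x =>
    (by fun_prop : Continuous fun q : Sp n =>
      Complex.exp (Complex.I * ((inner ℝ x q : ℝ) : ℂ))).aestronglyMeasurable.mul h1.1
  have hb : ∀ (x q : Sp n), ‖F' x q‖ ≤ ‖q‖ * ‖G q‖ := by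
    intro x q
    simp only [F', norm_smul, norm_mul, norm_cexp_I_mul, Complex.norm_I, one_mul, mul_one]
    rw [mul_comm]
    gcongr
    refine ContinuousLinearMap.opNorm_le_bound _ (norm_nonneg _) fun v => ?_
    simpa using abs_real_inner_le_norm q v
  have hF'm : AEStronglyMeasurable (F' x) := by
    have : Continuous (fun q : Sp n => (Complex.ofRealCLM.comp (innerSL ℝ q) : Sp n →L[ℝ] ℂ)) :=
      continuous_const.clm_comp (innerSL ℝ).continuous
    exact ((hm x).mul_const _).smul this.aestronglyMeasurable
  have key := hasFDerivAt_integral_of_dominated_of_fderiv_le (𝕜 := ℝ) (μ := volume)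
    (F := fun x q => Complex.exp (Complex.I * ((inner ℝ x q : ℝ) : ℂ)) * G q) (F' := F')
    (x₀ := x) (s := Set.univ) (bound := fun q => ‖q‖ * ‖G q‖) Filter.univ_mem
    (Filter.Eventually.of_forall hm)
    (h1.mono (hm x) (ae_of_all _ fun q => by simp)) hF'm
    (ae_of_all _ fun q y _ => hb y q) h2
    (ae_of_all _ fun q y _ => by
      have e1 : HasFDerivAt (fun y : Sp n => ((inner ℝ y q : ℝ) : ℂ))
          (Complex.ofRealCLM.comp (innerSL ℝ q)) y := by
        have := (Complex.ofRealCLM.comp (innerSL ℝ q)).hasFDerivAt (x := y)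
        refine this.congr_of_eventuallyEq (Filter.Eventually.of_forall fun z => ?_)
        simp [real_inner_comm]
      have e2 := ((e1.const_mul Complex.I).cexp).mul_const (G q)
      refine e2.congr_fderiv ?_
      ext v
      simp [F']
      ring)
  refine ⟨(cn n : ℂ) • ∫ q, F' x q, key.const_mul (cn n : ℂ), fun j => ?_⟩
  have hint : Integrable (F' x) := h2.mono hF'm (ae_of_all _ fun q => by
    simpa using hb x q)
  rw [_root_.smul_apply, ContinuousLinearMap.integral_apply hint, invHat, smul_eq_mul]
  congr 2
  ext q
  simp [F', EuclideanSpace.inner_single_right]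
  ring

/-! ### The windowed transform -/

/-- The transform `(2π)^{-n/2} ∫ e^{i x·q} g(q) f(η + q) dq`. -/
def ST (g f : Sp n → ℂ) (x η : Sp n) : ℂ := invHat (fun q => g q * f (η + q)) x

section ST

variable {g : Sp n → ℂ}

/-- Plancherel in `x` with `η` frozen. -/
theorem lintegral_ST_sq (hg : PolyB g) (f : 𝓢(Sp n, ℂ)) (η : Sp n) :
    ∫⁻ x, ‖ST g f x η‖ₑ ^ 2 = ∫⁻ q, ‖g q‖ₑ ^ 2 * ‖f (η + q)‖ₑ ^ 2 := by
  have := lintegral_invHat_sq (hg.integrable_mul (trS η f)) (hg.memLp_mul (trS η f))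
  simpa [ST, mul_pow, enorm_mul] using this

theorem norm_ST_le (g f : Sp n → ℂ) (x η : Sp n) :
    ‖ST g f x η‖ ≤ cn n * ∫ q, ‖g q * f (η + q)‖ := norm_invHat_le _ _

theorem differentiable_ST (hg : PolyB g) (f : 𝓢(Sp n, ℂ)) (η : Sp n) :
    Differentiable ℝ (fun x => ST g f x η) ∧ ∀ j x, partialDeriv j (fun x => ST g f x η) x =
      ST (fun q => Complex.I * (q j : ℂ) * g q) f x η := by
  have h2 : Integrable (fun q : Sp n => ‖q‖ * ‖g q * f (η + q)‖) := by
    have h : PolyB (fun q : Sp n => (‖q‖ : ℂ) * g q) := by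
      refine PolyB.mul ⟨by fun_prop, 1, 1, zero_le_one, fun q => ?_⟩ hg
      simp
    have := (h.integrable_mul (trS η f)).norm
    simpa [mul_assoc] using this
  have key := fun x => hasFDerivAt_invHat (hg.integrable_mul (trS η f)) h2 x
  refine ⟨fun x => ?_, fun j x => ?_⟩
  · obtain ⟨D, hD, -⟩ := key x
    exact hD.differentiableAt
  · obtain ⟨D, hD, hj⟩ := key x
    have : fderiv ℝ (fun x => ST g f x η) x = D := hD.fderiv
    rw [partialDeriv, this, hj j]
    simp [ST, mul_assoc]

theorem stronglyMeasurable_ST (hg : Measurable g) {f : Sp n → ℂ} (hf : Measurable f) :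
    StronglyMeasurable (fun p : Sp n × Sp n => ST g f p.1 p.2) := by
  unfold ST invHat
  refine StronglyMeasurable.const_mul ?_ _
  refine StronglyMeasurable.integral_prod_right
    (f := fun (p : Sp n × Sp n) (q : Sp n) =>
      Complex.exp (Complex.I * ((inner ℝ p.1 q : ℝ) : ℂ)) * (g q * f (p.2 + q))) ?_
  refine Measurable.stronglyMeasurable ?_
  refine Measurable.mul (Continuous.measurable (by fun_prop)) ?_
  exact (hg.comp measurable_snd).mul (hf.comp ((measurable_snd.comp measurable_fst).add
    measurable_snd))

/-- Young's inequality with a tempered weight. -/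
theorem lintegral_weighted_conv_le {w : Sp n → ℝ} (hw : Tempered w) {C : ℝ} {M : ℕ} (hC : 0 ≤ C)
    (hM : ∀ ξ η, w (ξ + η) ≤ C * (1 + ‖η‖) ^ M * w ξ) {G F : Sp n → ℝ≥0∞} (hgm : Measurable G)
    (hfm : Measurable F) :
    ∫⁻ η, ENNReal.ofReal (w η) * ∫⁻ q, G q * F (η + q) ≤
      (∫⁻ q, G q * ENNReal.ofReal (C * (1 + ‖q‖) ^ M)) * ∫⁻ η, ENNReal.ofReal (w η) * F η := by
  have hwm : Measurable (fun η => ENNReal.ofReal (w η)) := hw.cont.measurable.ennreal_ofReal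
  calc ∫⁻ η, ENNReal.ofReal (w η) * ∫⁻ q, G q * F (η + q)
      = ∫⁻ η, ∫⁻ q, ENNReal.ofReal (w η) * (G q * F (η + q)) := by
        congr with η
        exact (lintegral_const_mul _ (hgm.mul (hfm.comp (measurable_const_add η)))).symm
    _ = ∫⁻ q, ∫⁻ η, ENNReal.ofReal (w η) * (G q * F (η + q)) := by
        rw [lintegral_lintegral_swap]
        refine Measurable.aemeasurable ?_
        exact (hwm.comp measurable_fst).mul ((hgm.comp measurable_snd).mul
          (hfm.comp (measurable_fst.add measurable_snd)))
    -- Shifting `η` puts the dependence on `q` into the weight, where Peetre separates it.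
    _ = ∫⁻ q, ∫⁻ η, ENNReal.ofReal (w (η - q)) * (G q * F η) := by
        congr with q
        rw [← lintegral_sub_right_eq_self _ q]
        simp
    _ ≤ ∫⁻ q, ∫⁻ η, (G q * ENNReal.ofReal (C * (1 + ‖q‖) ^ M)) *
          (ENNReal.ofReal (w η) * F η) := by
        refine lintegral_mono fun q => lintegral_mono fun η => ?_
        have h1 : ENNReal.ofReal (w (η - q)) ≤
            ENNReal.ofReal (C * (1 + ‖q‖) ^ M) * ENNReal.ofReal (w η) := by
          rw [← ENNReal.ofReal_mul (by positivity)]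
          have := hM η (-q)
          rw [norm_neg, ← sub_eq_add_neg] at this
          exact ENNReal.ofReal_le_ofReal this
        calc _ ≤ ENNReal.ofReal (C * (1 + ‖q‖) ^ M) * ENNReal.ofReal (w η) * (G q * F η) := by
              gcongr
          _ = _ := by ring
    _ = ∫⁻ q, (G q * ENNReal.ofReal (C * (1 + ‖q‖) ^ M)) *
          ∫⁻ η, ENNReal.ofReal (w η) * F η := by
        congr with q
        exact lintegral_const_mul _ (hwm.mul hfm)
    _ = _ := by
        rw [lintegral_mul_const]
        exact hgm.mul (Measurable.ennreal_ofReal (by fun_prop))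

/-- The weighted `L²` bound for the windowed transform. -/
theorem lintegral_ST_weighted {w : Sp n → ℝ} (hw : Tempered w) {C : ℝ} {M : ℕ} (hC : 0 ≤ C)
    (hM : ∀ ξ η, w (ξ + η) ≤ C * (1 + ‖η‖) ^ M * w ξ) (hg : PolyB g) (f : 𝓢(Sp n, ℂ)) :
    ∫⁻ η, ENNReal.ofReal (w η) * ∫⁻ x, ‖ST g f x η‖ₑ ^ 2 ≤
      (∫⁻ q, ‖g q‖ₑ ^ 2 * ENNReal.ofReal (C * (1 + ‖q‖) ^ M)) *
        ∫⁻ η, ENNReal.ofReal (w η) * ‖f η‖ₑ ^ 2 := by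
  simp only [lintegral_ST_sq hg]
  exact lintegral_weighted_conv_le hw hC hM (hg.meas.enorm.pow_const 2)
    (F := fun q => ‖f q‖ₑ ^ 2) (f.continuous.measurable.enorm.pow_const 2)

end ST

/-! ### Integration by parts -/

theorem integral_mul_sub_partialDeriv {G ψ : Sp n → ℂ} (j : Fin n)
    (hG : Differentiable ℝ G) (hψ : Differentiable ℝ ψ)
    (i1 : Integrable (fun x => G x * ψ x)) (i2 : Integrable (fun x => G x * partialDeriv j ψ x))
    (i3 : Integrable (fun x => partialDeriv j G x * ψ x)) :
    ∫ x, G x * (ψ x - partialDeriv j ψ x) = ∫ x, (G x + partialDeriv j G x) * ψ x := by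
  have := integral_mul_fderiv_eq_neg_fderiv_mul_of_integrable (μ := volume) i3 i2 i1
    (fun x _ => hG x) (fun x _ => hψ x)
  simp only [mul_sub, add_mul]
  rw [integral_sub i1 i2, integral_add i1 i3]
  change _ - (∫ x, G x * fderiv ℝ ψ x _) = _
  rw [this, sub_neg_eq_add]
  rfl

/-! ### Product kernels -/

theorem integrable_prod_coord {F : ℝ → ℝ} (hF : Integrable F) :
    Integrable (fun q : Sp n => ∏ j, F (q j)) := by
  have := Integrable.fintype_prod (ι := Fin n) (f := fun _ => F) (μ := fun _ => volume)
    (fun _ => hF)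
  exact ((PiLp.volume_preserving_ofLp (Fin n)).integrable_comp_emb
    (MeasurableEquiv.toLp 2 (Fin n → ℝ)).symm.measurableEmbedding).2 this

theorem integral_prod_coord (F : Fin n → ℝ → ℂ) :
    ∫ q : Sp n, ∏ j, F j (q j) = ∏ j, ∫ t, F j t := by
  rw [← integral_fintype_prod_volume_eq_prod]
  exact (PiLp.volume_preserving_ofLp (Fin n)).integral_comp
    (MeasurableEquiv.toLp 2 (Fin n → ℝ)).symm.measurableEmbedding (fun x => ∏ j, F j (x j))

/-- Dominates polynomial weights by products over coordinates, so that weighted integrability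
reduces to dimension one. -/
theorem one_add_norm_le_prod (q : Sp n) : 1 + ‖q‖ ≤ ∏ j, (1 + |q j|) := by
  have h1 : ‖q‖ ≤ ∑ j, |q j| := by
    conv_lhs => rw [← sum_single_eq q]
    refine (norm_sum_le _ _).trans (le_of_eq ?_)
    simp [norm_smul]
  have h2 : ∀ s : Finset (Fin n), 1 + ∑ j ∈ s, |q j| ≤ ∏ j ∈ s, (1 + |q j|) := by
    intro s
    induction s using Finset.induction_on with
    | empty => simp
    | insert j s hj ih =>
      rw [Finset.sum_insert hj, Finset.prod_insert hj]
      have : 0 ≤ ∑ j ∈ s, |q j| := Finset.sum_nonneg fun j _ => abs_nonneg _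
      nlinarith [abs_nonneg (q j)]
  linarith [h2 Finset.univ]

/-- The one-dimensional kernel `1_{t>0} e^{-t}`. -/
def expKer (t : ℝ) : ℂ := if 0 < t then ((Real.exp (-t) : ℝ) : ℂ) else 0

/-- The kernel `∏ 1_{q_j>0} e^{-q_j}`. -/
def expKernel (q : Sp n) : ℂ := ∏ j, expKer (q j)

theorem measurable_expKer : Measurable expKer := by
  unfold expKer
  exact Measurable.ite measurableSet_Ioi (by fun_prop) measurable_const

theorem norm_expKer_le (t : ℝ) : ‖expKer t‖ ≤ 1 := by
  unfold expKer
  split_ifs with h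
  · rw [Complex.norm_real, Real.norm_of_nonneg (Real.exp_pos _).le]
    exact Real.exp_le_one_iff.2 (by linarith)
  · simp

theorem integrable_expKer_pow (M : ℕ) : Integrable (fun t => ‖expKer t‖ * (1 + |t|) ^ M) := by
  have h0 : IntegrableOn (fun t : ℝ => 2 ^ M * (M.factorial : ℝ) * Real.exp (1 / 2) *
      Real.exp (-(1 / 2) * t)) (Set.Ioi 0) :=
    (exp_neg_integrableOn_Ioi 0 (by norm_num : (0 : ℝ) < 1 / 2)).const_mul _
  have h1 := h0.integrable_indicator measurableSet_Ioi
  refine h1.mono ?_ (ae_of_all _ fun t => ?_)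
  · exact (measurable_expKer.norm.mul (by fun_prop)).aestronglyMeasurable
  · by_cases ht : 0 < t
    · rw [Set.indicator_of_mem (show t ∈ Set.Ioi 0 from ht), expKer, if_pos ht, Complex.norm_real,
        abs_of_pos ht, Real.norm_of_nonneg (by positivity), Real.norm_of_nonneg (by positivity),
        Real.norm_of_nonneg (by positivity)]
      -- Half of the exponential decay absorbs the polynomial; the other half stays integrable.
      have h2 := Real.pow_div_factorial_le_exp (x := (1 + t) / 2) (by positivity) M
      rw [div_le_iff₀ (by positivity), div_pow, div_le_iff₀ (by positivity)] at h2
      calc Real.exp (-t) * (1 + t) ^ M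
          ≤ Real.exp (-t) * (Real.exp ((1 + t) / 2) * M.factorial * 2 ^ M) := by gcongr
        _ = 2 ^ M * M.factorial * (Real.exp (-t) * Real.exp ((1 + t) / 2)) := by ring
        _ = 2 ^ M * M.factorial * Real.exp (1 / 2) * Real.exp (-(1 / 2) * t) := by
          rw [mul_assoc (2 ^ M * (M.factorial : ℝ)), ← Real.exp_add, ← Real.exp_add]
          ring_nf
        _ ≤ _ := le_rfl
    · rw [expKer, if_neg ht]
      simp

theorem integral_expKer (y : ℝ) :
    ∫ t, Complex.exp (Complex.I * ((y * t : ℝ) : ℂ)) * expKer t = (1 - Complex.I * y)⁻¹ := by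
  have h : (fun t : ℝ => Complex.exp (Complex.I * ((y * t : ℝ) : ℂ)) * expKer t) =
      (Set.Ioi (0 : ℝ)).indicator (fun t : ℝ => Complex.exp ((Complex.I * y - 1) * t)) := by
    ext t
    by_cases ht : 0 < t
    · rw [Set.indicator_of_mem (show t ∈ Set.Ioi 0 from ht), expKer, if_pos ht]
      push_cast
      rw [← Complex.exp_add]
      ring_nf
    · rw [Set.indicator_of_notMem (show t ∉ Set.Ioi 0 from ht), expKer, if_neg ht, mul_zero]
  rw [h, integral_indicator measurableSet_Ioi, integral_exp_mul_complex_Ioi (by simp)]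
  simp only [ofReal_zero, mul_zero, Complex.exp_zero]
  rw [← neg_div_neg_eq]
  simp

theorem polyB_expKernel : PolyB (expKernel (n := n)) := by
  refine PolyB.of_norm_le_one ?_ fun q => ?_
  · unfold expKernel
    exact Finset.measurable_prod _ fun j _ => measurable_expKer.comp (by fun_prop)
  · rw [expKernel, norm_prod]
    exact Finset.prod_le_one (fun j _ => norm_nonneg _) fun j _ => norm_expKer_le _

theorem lintegral_lt_top_of_prod {F : ℝ → ℝ} (hF : Integrable F) {G : Sp n → ℝ≥0∞}
    (h : ∀ q, G q ≤ ENNReal.ofReal (∏ j, F (q j))) : ∫⁻ q, G q < ⊤ :=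
  lt_of_le_of_lt (lintegral_mono h) (integrable_prod_coord hF).lintegral_lt_top

theorem lintegral_expKernel_lt_top (C : ℝ) (M : ℕ) :
    ∫⁻ q : Sp n, ‖expKernel q‖ₑ * ENNReal.ofReal (C * (1 + ‖q‖) ^ M) < ⊤ := by
  rcases le_total C 0 with hC | hC
  · have : ∀ q : Sp n, ENNReal.ofReal (C * (1 + ‖q‖) ^ M) = 0 := fun q =>
      ENNReal.ofReal_of_nonpos (mul_nonpos_of_nonpos_of_nonneg hC (by positivity))
    simp [this]
  have h : ∫⁻ q : Sp n, ‖expKernel q‖ₑ * ENNReal.ofReal ((1 + ‖q‖) ^ M) < ⊤ := by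
    refine lintegral_lt_top_of_prod (integrable_expKer_pow M) fun q => ?_
    rw [← ofReal_norm, ← ENNReal.ofReal_mul (norm_nonneg _), Finset.prod_mul_distrib, expKernel,
      norm_prod, Finset.prod_pow]
    refine ENNReal.ofReal_le_ofReal ?_
    gcongr
    exact one_add_norm_le_prod q
  simp only [ENNReal.ofReal_mul hC]
  simp only [mul_left_comm _ (ENNReal.ofReal C)]
  rw [lintegral_const_mul' _ _ ENNReal.ofReal_ne_top]
  exact ENNReal.mul_lt_top ENNReal.ofReal_lt_top h

/-! ### The resolvent multipliers -/

/-- The multiplier `∏_{j ∈ L} (1 - i q_j)⁻¹`. -/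
def hL (L : List (Fin n)) (q : Sp n) : ℂ :=
  (L.map fun j => (1 - Complex.I * (q j : ℂ))⁻¹).prod

theorem one_sub_I_ne_zero (t : ℝ) : (1 - Complex.I * (t : ℂ)) ≠ 0 := by
  intro h
  have := congrArg Complex.re h
  simp at this

theorem normSq_one_sub_I (t : ℝ) : ‖(1 - Complex.I * (t : ℂ))⁻¹‖ ^ 2 = (1 + t ^ 2)⁻¹ := by
  rw [norm_inv, inv_pow, ← Complex.normSq_eq_norm_sq, Complex.normSq_apply]
  simp
  ring

theorem hL_cons (j : Fin n) (L : List (Fin n)) (q : Sp n) :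
    hL (j :: L) q = (1 - Complex.I * (q j : ℂ))⁻¹ * hL L q := by
  simp [hL]

theorem hL_nil : hL ([] : List (Fin n)) = fun _ => 1 := by
  ext q; simp [hL]

theorem hL_append (L L' : List (Fin n)) (q : Sp n) : hL (L ++ L') q = hL L q * hL L' q := by
  simp [hL]

theorem hL_finRange (q : Sp n) :
    hL (List.finRange n) q = ∏ j, (1 - Complex.I * (q j : ℂ))⁻¹ := by
  rw [hL, Fin.prod_univ_def]

/-- Each factor is rewritten as `(1 + i q_j)(1 + q_j²)⁻¹`, a polynomial times a real power of `1 +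
|·|²`. -/
theorem hasTemperateGrowth_hL (L : List (Fin n)) : Function.HasTemperateGrowth (hL L) := by
  induction L with
  | nil => rw [hL_nil]; exact Function.HasTemperateGrowth.const 1
  | cons j L ih =>
    have h1 : Function.HasTemperateGrowth (fun q : Sp n => q j) :=
      (EuclideanSpace.proj j : Sp n →L[ℝ] ℝ).hasTemperateGrowth
    have h2 := (Function.hasTemperateGrowth_one_add_norm_sq_rpow ℝ (-1)).comp h1
    have h3 : hL (j :: L) = fun q => (1 + Complex.I * (q j : ℂ)) *
        ((((fun x : ℝ => (1 + ‖x‖ ^ 2) ^ (-1 : ℝ)) ∘ fun q : Sp n => q j) q : ℝ) : ℂ) * hL L q := by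
      ext q
      rw [hL_cons]
      congr 1
      have h4 : (1 + (q j : ℂ) ^ 2) = (1 - Complex.I * q j) * (1 + Complex.I * q j) := by
        ring_nf
        simp
      have h5 : (1 + Complex.I * (q j : ℂ)) ≠ 0 := by
        simpa using one_sub_I_ne_zero (-(q j))
      have h6 := one_sub_I_ne_zero (q j)
      simp only [Function.comp, Real.norm_eq_abs, sq_abs, Real.rpow_neg_one]
      push_cast
      rw [h4]
      field_simp
    rw [h3]
    fun_prop

theorem norm_hL_le (L : List (Fin n)) (q : Sp n) : ‖hL L q‖ ≤ 1 := by
  induction L with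
  | nil => simp [hL_nil]
  | cons j L ih =>
    rw [hL_cons, norm_mul]
    refine mul_le_one₀ ?_ (norm_nonneg _) ih
    have h := normSq_one_sub_I (q j)
    have : (1 + q j ^ 2)⁻¹ ≤ 1 := inv_le_one_of_one_le₀ (by nlinarith [sq_nonneg (q j)])
    rw [← h] at this
    exact (sq_le_one_iff₀ (norm_nonneg _)).1 this

theorem polyB_hL (L : List (Fin n)) : PolyB (hL L) :=
  PolyB.of_norm_le_one (hasTemperateGrowth_hL L).1.continuous.measurable (norm_hL_le L)

/-- Repeat every coordinate `M + 1` times: `|h_L|²` is then `∏ (1 + q_j²)^{-(M+1)}`, of which `M`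
powers absorb the weight and the last one is integrable. -/
theorem exists_hL_lintegral_lt_top (C : ℝ) (M : ℕ) : ∃ L : List (Fin n),
    ∫⁻ q : Sp n, ‖hL L q‖ₑ ^ 2 * ENNReal.ofReal (C * (1 + ‖q‖) ^ M) < ⊤ := by
  have hpow : ∀ N : ℕ, ∃ L : List (Fin n), ∀ q, hL L q = hL (List.finRange n) q ^ N := by
    intro N
    induction N with
    | zero => exact ⟨[], fun q => by simp [hL_nil]⟩
    | succ N ih =>
      obtain ⟨L, hL'⟩ := ih
      exact ⟨L ++ List.finRange n, fun q => by rw [hL_append, hL', pow_succ]⟩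
  obtain ⟨L, hL'⟩ := hpow (M + 1)
  refine ⟨L, ?_⟩
  have h1 : Integrable (fun t : ℝ => 2 ^ M * (1 + t ^ 2)⁻¹) := integrable_inv_one_add_sq.const_mul _
  rcases le_total C 0 with hC | hC
  · have : ∀ q : Sp n, ENNReal.ofReal (C * (1 + ‖q‖) ^ M) = 0 := fun q =>
      ENNReal.ofReal_of_nonpos (mul_nonpos_of_nonpos_of_nonneg hC (by positivity))
    simp [this]
  have h : ∫⁻ q : Sp n, ‖hL L q‖ₑ ^ 2 * ENNReal.ofReal ((1 + ‖q‖) ^ M) < ⊤ := by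
    refine lintegral_lt_top_of_prod h1 fun q => ?_
    rw [← ofReal_norm, ← ENNReal.ofReal_pow (norm_nonneg _), ← ENNReal.ofReal_mul (by positivity)]
    refine ENNReal.ofReal_le_ofReal ?_
    rw [hL', norm_pow, ← pow_mul, mul_comm (M + 1) 2, pow_mul, hL_finRange, norm_prod,
      ← Finset.prod_pow]
    simp only [normSq_one_sub_I]
    calc (∏ j, (1 + q j ^ 2)⁻¹) ^ (M + 1) * (1 + ‖q‖) ^ M
        ≤ (∏ j, (1 + q j ^ 2)⁻¹) ^ (M + 1) * (∏ j, (1 + |q j|)) ^ M := by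
          gcongr
          exact one_add_norm_le_prod q
      _ = ∏ j, ((1 + q j ^ 2)⁻¹ ^ (M + 1) * (1 + |q j|) ^ M) := by
          rw [Finset.prod_mul_distrib, Finset.prod_pow, Finset.prod_pow]
      _ ≤ _ := by
          refine Finset.prod_le_prod (fun j _ => by positivity) fun j _ => ?_
          have h2 : 1 + |q j| ≤ 2 * (1 + q j ^ 2) := by
            nlinarith [sq_nonneg (|q j| - 1), sq_abs (q j), abs_nonneg (q j)]
          have h3 : 0 < 1 + q j ^ 2 := by positivity
          calc (1 + q j ^ 2)⁻¹ ^ (M + 1) * (1 + |q j|) ^ M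
              ≤ (1 + q j ^ 2)⁻¹ ^ (M + 1) * (2 * (1 + q j ^ 2)) ^ M := by gcongr
            _ = _ := by
              rw [mul_pow, pow_succ, inv_pow]
              field_simp
  simp only [ENNReal.ofReal_mul hC]
  simp only [mul_left_comm _ (ENNReal.ofReal C)]
  rw [lintegral_const_mul' _ _ ENNReal.ofReal_ne_top]
  exact ENNReal.mul_lt_top ENNReal.ofReal_lt_top h

/-- The Fourier representation of the full resolvent multiplier. -/
theorem integral_phase_expKernel (y : Sp n) :
    ∫ q : Sp n, Complex.exp (Complex.I * ((inner ℝ y q : ℝ) : ℂ)) * expKernel q =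
      hL (List.finRange n) y := by
  rw [hL_finRange]
  simp only [← integral_expKer]
  rw [← integral_prod_coord]
  congr with q
  rw [Finset.prod_mul_distrib, expKernel, ← Complex.exp_sum]
  congr 2
  rw [← Finset.mul_sum, PiLp.inner_apply]
  push_cast
  simp [mul_comm]

/-! ### Integration by parts against the windowed transform -/

theorem PolyB.add {g h : Sp n → ℂ} (hg : PolyB g) (hh : PolyB h) : PolyB (fun q => g q + h q) := by
  obtain ⟨C, M, hC, h1⟩ := hg.bound
  obtain ⟨D, K, hD, h2⟩ := hh.bound
  refine ⟨hg.meas.add hh.meas, C + D, M + K, by positivity, fun q => ?_⟩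
  have h3 : (1 : ℝ) ≤ (1 + ‖q‖) := by linarith [norm_nonneg q]
  refine (norm_add_le _ _).trans ?_
  rw [add_mul]
  refine add_le_add ((h1 q).trans ?_) ((h2 q).trans ?_)
  · gcongr
    omega
  · gcongr
    omega

theorem PolyB.of_bounded {g : Sp n → ℂ} {B : ℝ} (hg : Measurable g) (h : ∀ q, ‖g q‖ ≤ B) :
    PolyB g :=
  ⟨hg, B, 0, (norm_nonneg _).trans (h 0), by simpa using h⟩

/-- The complex conjugate of a Schwartz function. -/
def conjS (ψ : 𝓢(Sp n, ℂ)) : 𝓢(Sp n, ℂ) :=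
  ψ.postcompCLM (Complex.conjCLE : ℂ →L[ℝ] ℂ)

theorem conjS_apply (ψ : 𝓢(Sp n, ℂ)) (x : Sp n) : conjS ψ x = conj (ψ x) := rfl

theorem partialDeriv_conjS (j : Fin n) (ψ : 𝓢(Sp n, ℂ)) (x : Sp n) :
    partialDeriv j (conjS ψ) x = conj (partialDeriv j ψ x) := by
  have h := (Complex.conjCLE : ℂ →L[ℝ] ℂ).hasFDerivAt.comp x
    (ψ.differentiableAt (x := x)).hasFDerivAt
  have h' : fderiv ℝ (conjS ψ) x = _ := h.fderiv
  rw [partialDeriv, h']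
  rfl

theorem integral_mul_schwartz_sub {G : Sp n → ℂ} (j : Fin n) (hG : Differentiable ℝ G)
    (h1 : PolyB G) (h2 : PolyB (partialDeriv j G)) (ψ : 𝓢(Sp n, ℂ)) :
    ∫ x, G x * (ψ x - partialDeriv j ψ x) = ∫ x, (G x + partialDeriv j G x) * ψ x :=
  integral_mul_sub_partialDeriv j hG ψ.differentiable (h1.integrable_mul ψ)
    (h1.integrable_mul (LineDeriv.lineDerivOp (EuclideanSpace.single j (1 : ℝ)) ψ))
    (h2.integrable_mul ψ)

theorem ST_add {g h : Sp n → ℂ} (hg : PolyB g) (hh : PolyB h) (f : 𝓢(Sp n, ℂ)) (x η : Sp n) :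
    ST (fun q => g q + h q) f x η = ST g f x η + ST h f x η := by
  have key : ∀ {g : Sp n → ℂ}, PolyB g → Integrable (fun q =>
      Complex.exp (Complex.I * ((inner ℝ x q : ℝ) : ℂ)) * (g q * f (η + q))) := fun {g} hg =>
    (hg.integrable_mul (trS η f)).bdd_mul (c := 1)
      (by fun_prop : Continuous fun q : Sp n =>
        Complex.exp (Complex.I * ((inner ℝ x q : ℝ) : ℂ))).aestronglyMeasurable
      (ae_of_all _ fun q => by simp)
  simp only [ST, invHat]
  rw [← mul_add, ← integral_add (key hg) (key hh)]
  simp only [add_mul, mul_add]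

/-- `ST (hL L) f · η` as a Schwartz function. -/
def STS (L : List (Fin n)) (f : 𝓢(Sp n, ℂ)) (η : Sp n) : 𝓢(Sp n, ℂ) :=
  invHatS (SchwartzMap.smulLeftCLM ℂ (hL L) (trS η f))

theorem STS_apply (L : List (Fin n)) (f : 𝓢(Sp n, ℂ)) (x η : Sp n) :
    STS L f η x = ST (hL L) f x η := by
  rw [STS, invHatS_apply, ST]
  congr 1
  ext q
  rw [SchwartzMap.smulLeftCLM_apply_apply (hasTemperateGrowth_hL L)]
  rfl

/-- In `x`, the operator `1 - ∂_j` multiplies the integrand by `1 - i q_j`, cancelling the factor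
that `j` adds to the multiplier. -/
theorem STS_step (j : Fin n) (L : List (Fin n)) (f : 𝓢(Sp n, ℂ)) (x η : Sp n) :
    STS L f η x = STS (j :: L) f η x - partialDeriv j (STS (j :: L) f η) x := by
  have h1 : (STS (j :: L) f η : Sp n → ℂ) = fun x => ST (hL (j :: L)) f x η :=
    funext fun x => STS_apply _ _ _ _
  rw [h1, (differentiable_ST (polyB_hL (j :: L)) f η).2 j x, STS_apply, eq_sub_iff_add_eq,
    ← ST_add (polyB_hL L) ((PolyB.coord j).mul (polyB_hL _))]
  congr 1
  ext q
  rw [hL_cons]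
  have := one_sub_I_ne_zero (q j)
  field_simp
  ring

/-- Integration by parts moves `1 - ∂_j` to `1 + ∂_j` on `G`: one derivative of the companion
function buys one resolvent in the window. -/
theorem integral_mul_STS (j : Fin n) (L : List (Fin n)) (f : 𝓢(Sp n, ℂ)) (η : Sp n)
    {G : Sp n → ℂ} (hG : Differentiable ℝ G) (h1 : PolyB G) (h2 : PolyB (partialDeriv j G)) :
    ∫ x, G x * STS L f η x = ∫ x, (G x + partialDeriv j G x) * STS (j :: L) f η x := by
  rw [← integral_mul_schwartz_sub j hG h1 h2]
  simp only [← STS_step]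

theorem integral_mul_conj_STS (j : Fin n) (L : List (Fin n)) (f : 𝓢(Sp n, ℂ)) (η : Sp n)
    {G : Sp n → ℂ} (hG : Differentiable ℝ G) (h1 : PolyB G) (h2 : PolyB (partialDeriv j G)) :
    ∫ x, G x * conj (STS L f η x) =
      ∫ x, (G x + partialDeriv j G x) * conj (STS (j :: L) f η x) := by
  have := integral_mul_schwartz_sub j hG h1 h2 (conjS (STS (j :: L) f η))
  simp only [partialDeriv_conjS, conjS_apply, ← map_sub, ← STS_step] at this
  exact this

theorem ST_one (φ : 𝓢(Sp n, ℂ)) (x η : Sp n) :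
    ST (hL []) (hatS φ) x η = Complex.exp (-(Complex.I * ((inner ℝ x η : ℝ) : ℂ))) * φ x := by
  rw [← invHat_hatS φ x, ST, invHat, invHat, hL_nil, mul_left_comm]
  congr 1
  rw [← integral_const_mul]
  rw [← integral_add_left_eq_self (fun q => Complex.exp (-(Complex.I * ((inner ℝ x η : ℝ) : ℂ))) *
    (Complex.exp (Complex.I * ((inner ℝ x q : ℝ) : ℂ)) * hatS φ q)) η]
  congr 1
  ext q
  rw [one_mul, ← mul_assoc, ← Complex.exp_add, inner_add_right]
  push_cast
  ring_nf

/-- Position and frequency exchange roles: as a function of `η`, the modulated `φ̂` is itself a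
windowed transform, so integration by parts in frequency applies to it. -/
theorem ST_one_reflS (φ : 𝓢(Sp n, ℂ)) (x η : Sp n) :
    ST (hL []) (reflS φ) η (-x) =
      Complex.exp (Complex.I * ((inner ℝ x η : ℝ) : ℂ)) * fourierHat φ η := by
  rw [fourierHat_eq_invHat, ST, invHat, invHat, hL_nil, mul_left_comm]
  congr 1
  rw [← integral_const_mul]
  rw [← integral_sub_left_eq_self (fun q => Complex.exp (Complex.I * ((inner ℝ x η : ℝ) : ℂ)) *
    (Complex.exp (Complex.I * ((inner ℝ (-η) q : ℝ) : ℂ)) * φ q)) volume x]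
  congr 1
  ext q
  rw [one_mul, ← mul_assoc, ← Complex.exp_add, inner_sub_right, inner_neg_left, inner_neg_left,
    real_inner_comm x η, reflS_apply, neg_add, neg_neg, sub_eq_add_neg]
  push_cast
  ring_nf
  rw [sub_eq_add_neg]

/-- Writing the resolvent multiplier as the Fourier integral of `expKernel` and exchanging integrals
turns it into an average of `φ̂` over frequency shifts. The result is again a windowed transform of
`φ̂`, now in the variable `x`. -/
theorem ST_full_reflS (φ : 𝓢(Sp n, ℂ)) (x η : Sp n) :
    ST (hL (List.finRange n)) (reflS φ) η (-x) =
      Complex.exp (Complex.I * ((inner ℝ x η : ℝ) : ℂ)) *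
        ((cn n : ℂ)⁻¹ * ST expKernel (hatS φ) x η) := by
  have hE : Integrable (expKernel (n := n)) := by
    refine ⟨polyB_expKernel.meas.aestronglyMeasurable, ?_⟩
    have := lintegral_expKernel_lt_top (n := n) 1 0
    simpa [HasFiniteIntegral] using this
  have hc : (cn n : ℂ) ≠ 0 := by exact_mod_cast (cn_pos n).ne'
  have hint : Integrable (Function.uncurry fun q p : Sp n =>
      Complex.exp (Complex.I * ((inner ℝ (η + p) q : ℝ) : ℂ)) * (reflS φ (-x + q) * expKernel p))
      (volume.prod volume) := by
    have h1 : Integrable (fun z : Sp n × Sp n => reflS φ (-x + z.1) * expKernel z.2)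
      (volume.prod volume) := (trS (-x) (reflS φ)).integrable.mul_prod hE
    exact h1.bdd_mul (c := 1) (by fun_prop : Continuous fun z : Sp n × Sp n =>
        Complex.exp (Complex.I * ((inner ℝ (η + z.2) z.1 : ℝ) : ℂ))).aestronglyMeasurable
      (ae_of_all _ fun q => by simp)
  calc ST (hL (List.finRange n)) (reflS φ) η (-x)
      = (cn n : ℂ) * ∫ q, ∫ p, Complex.exp (Complex.I * ((inner ℝ (η + p) q : ℝ) : ℂ)) *
          (reflS φ (-x + q) * expKernel p) := by
        rw [ST, invHat]
        congr 2
        ext q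
        rw [← integral_phase_expKernel, ← integral_mul_const, ← integral_const_mul]
        congr 1
        ext p
        rw [inner_add_left, real_inner_comm q p]
        push_cast
        rw [mul_add, Complex.exp_add]
        ring
    _ = ∫ p, expKernel p * ST (hL []) (reflS φ) (η + p) (-x) := by
        rw [integral_integral_swap hint, ← integral_const_mul]
        congr 1
        ext p
        rw [ST, invHat, hL_nil, mul_left_comm]
        congr 1
        rw [← integral_const_mul]
        congr 1
        ext q
        ring
    _ = _ := by
        rw [ST, invHat, inv_mul_cancel_left₀ hc, ← integral_const_mul]
        congr 1
        ext p
        rw [ST_one_reflS, ← hatS_apply, inner_add_right]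
        push_cast
        rw [mul_add, Complex.exp_add]
        ring

/-! ### The frequency derivatives -/

theorem SymB.add {w : Sp n → ℝ} {N : ℕ} {A B : ℝ} {a b : Sp n × Sp n → ℂ}
    (ha : SymB w N A a) (hb : SymB w N B b) : SymB w N (A + B) (a + b) := by
  induction N generalizing a b with
  | zero =>
    refine ⟨ha.1.add hb.1, fun p => ?_⟩
    rw [add_mul]
    exact (norm_add_le _ _).trans (add_le_add (ha.2 p) (hb.2 p))
  | succ N ih =>
    have key : ∀ v, dir v (a + b) = dir v a + dir v b := by
      intro v
      ext p
      unfold dir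
      rw [fderiv_add (ha.smooth.differentiable (by simp) p) (hb.smooth.differentiable (by simp) p)]
      rfl
    refine ⟨ih ha.1 hb.1, fun j => ⟨?_, ?_⟩⟩
    · rw [dX, key]; exact ih (ha.2 j).1 (hb.2 j).1
    · rw [dXi, key]; exact ih (ha.2 j).2 (hb.2 j).2

/-- The operator `∏_{j ∈ L} (1 + ∂_{ξ_j})`. -/
def resP : List (Fin n) → (Sp n × Sp n → ℂ) → Sp n × Sp n → ℂ
  | [], a => a
  | j :: L, a => resP L a + dXi j (resP L a)

theorem SymB.resP {w : Sp n → ℝ} {N : ℕ} {A : ℝ} {a : Sp n × Sp n → ℂ} (L : List (Fin n))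
    (ha : SymB w (N + L.length) A a) : SymB w N (2 ^ L.length * A) (resP L a) := by
  induction L generalizing N with
  | nil => simpa [MElliptic.resP] using ha
  | cons j L ih =>
    have h1 : SymB w (N + 1) (2 ^ L.length * A) (MElliptic.resP L a) :=
      ih (by rw [add_assoc, add_comm 1]; exact ha)
    have h2 := h1.1.add (h1.2 j).2
    rw [List.length_cons, pow_succ]
    convert h2 using 1
    · ring
    · rfl

theorem Tempered.exists_growth {w : Sp n → ℝ} (hw : Tempered w) :
    ∃ (C : ℝ) (M : ℕ), 0 ≤ C ∧ ∀ ξ, w ξ ≤ C * (1 + ‖ξ‖) ^ M := by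
  obtain ⟨C, M, hC, h⟩ := hw.peetre
  refine ⟨C * w 0, M, mul_nonneg hC.le (hw.pos 0).le, fun ξ => ?_⟩
  have := h 0 ξ
  rw [zero_add] at this
  linarith

theorem SymB.polyB_slice {w : Sp n → ℝ} (hw : Tempered w) {N : ℕ} {A : ℝ} {a : Sp n × Sp n → ℂ}
    (ha : SymB w N A a) (x : Sp n) : PolyB (fun η => a (x, η)) := by
  obtain ⟨C, M, hC, h⟩ := hw.exists_growth
  have hA := ha.nonneg hw
  refine ⟨(ha.smooth.continuous.comp (by fun_prop : Continuous fun η : Sp n =>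
    (x, η))).measurable, A * C, M, by positivity, fun η => ?_⟩
  rw [mul_assoc]
  exact (ha.bound (x, η)).trans (mul_le_mul_of_nonneg_left (h η) hA)

theorem contDiff_slice_right {a : Sp n × Sp n → ℂ} (ha : ContDiff ℝ ∞ a) (x : Sp n) :
    ContDiff ℝ ∞ (fun η => a (x, η)) := ha.comp (contDiff_prodMk_right x)

theorem contDiff_slice_left {a : Sp n × Sp n → ℂ} (ha : ContDiff ℝ ∞ a) (η : Sp n) :
    ContDiff ℝ ∞ (fun x => a (x, η)) := ha.comp (contDiff_prodMk_left η)

/-- The frequency half of the integration by parts: one factor `1 + ∂_{ξ_j}` lands on the symbol for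
each resolvent gained. -/
theorem integral_resP {w : Sp n → ℝ} (hw : Tempered w) {A : ℝ} {a : Sp n × Sp n → ℂ}
    (L : List (Fin n)) (ha : SymB w L.length A a) (f : 𝓢(Sp n, ℂ)) (x y : Sp n) :
    ∫ η, a (x, η) * STS [] f y η = ∫ η, resP L a (x, η) * STS L f y η := by
  induction L with
  | nil => rfl
  | cons j L ih =>
    rw [ih ha.1]
    have h1 : SymB w 1 (2 ^ L.length * A) (resP L a) :=
      SymB.resP L (by rw [add_comm]; exact ha)
    have h2 : (partialDeriv j fun η => resP L a (x, η)) = fun η => dXi j (resP L a) (x, η) :=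
      funext fun η => partialDeriv_slice_right h1.smooth j x η
    rw [integral_mul_STS j L f y ((contDiff_slice_right h1.smooth x).differentiable (by simp))
      (h1.polyB_slice hw x) (by rw [h2]; exact (h1.2 j).2.polyB_slice hw x), h2]
    rfl

/-! ### The weighted form bound -/

/-- The integral of `b(x, η) ST_g f(x, η) conj (ST_{h_L} f(x, η))` over `x`. -/
def formR (b : Sp n × Sp n → ℂ) (g : Sp n → ℂ) (L : List (Fin n)) (f : 𝓢(Sp n, ℂ)) (η : Sp n) : ℂ :=
  ∫ x, b (x, η) * ST g f x η * conj (STS L f η x)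

theorem stronglyMeasurable_formR_integrand {b : Sp n × Sp n → ℂ} (hb : Continuous b)
    {g : Sp n → ℂ} (hg : Measurable g) (L : List (Fin n)) (f : 𝓢(Sp n, ℂ)) :
    StronglyMeasurable (fun p : Sp n × Sp n =>
      b p * ST g f p.1 p.2 * conj (STS L f p.2 p.1)) := by
  have hf := f.continuous.measurable
  simp only [STS_apply]
  exact (hb.stronglyMeasurable.mul (stronglyMeasurable_ST hg hf)).mul
    (Complex.continuous_conj.comp_stronglyMeasurable (stronglyMeasurable_ST (polyB_hL L).meas hf))

theorem stronglyMeasurable_formR {b : Sp n × Sp n → ℂ} (hb : Continuous b)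
    {g : Sp n → ℂ} (hg : Measurable g) (L : List (Fin n)) (f : 𝓢(Sp n, ℂ)) :
    StronglyMeasurable (formR b g L f) :=
  (stronglyMeasurable_formR_integrand hb hg L f).integral_prod_left'

theorem polyB_ST {g : Sp n → ℂ} (hg : PolyB g) (f : 𝓢(Sp n, ℂ)) (η : Sp n) :
    PolyB (fun x => ST g f x η) :=
  PolyB.of_bounded (differentiable_ST hg f η).1.continuous.measurable fun x => norm_ST_le g f x η

theorem polyB_slice_left {w : Sp n → ℝ} {N : ℕ} {A : ℝ} {b : Sp n × Sp n → ℂ}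
    (hb : SymB w N A b) (η : Sp n) : PolyB (fun x => b (x, η)) :=
  PolyB.of_bounded (B := A * w η) (contDiff_slice_left hb.smooth η).continuous.measurable fun x =>
    hb.bound (x, η)

/-- Leibniz rule after integrating by parts in `x`: the derivative falls on `b` or on the windowed
transform, where it multiplies the window by `i q_j`. -/
theorem formR_step {w : Sp n → ℝ} {A : ℝ} {b : Sp n × Sp n → ℂ} (hb : SymB w 1 A b)
    {g : Sp n → ℂ} (hg : PolyB g) (j : Fin n) (L : List (Fin n)) (f : 𝓢(Sp n, ℂ)) (η : Sp n) :
    formR b g L f η = formR b g (j :: L) f η + formR (dX j b) g (j :: L) f η +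
      formR b (fun q => Complex.I * (q j : ℂ) * g q) (j :: L) f η := by
  have hg' : PolyB (fun q => Complex.I * (q j : ℂ) * g q) := (PolyB.coord j).mul hg
  have hd1 : Differentiable ℝ (fun x => b (x, η)) :=
    (contDiff_slice_left hb.smooth η).differentiable (by simp)
  obtain ⟨hd2, hd2'⟩ := differentiable_ST hg f η
  have hG : Differentiable ℝ (fun x => b (x, η) * ST g f x η) := hd1.mul hd2
  have e : partialDeriv j (fun x => b (x, η) * ST g f x η) = fun x =>
      dX j b (x, η) * ST g f x η + b (x, η) * ST (fun q => Complex.I * (q j : ℂ) * g q) f x η := by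
    ext x
    rw [← hd2' j x, ← partialDeriv_slice_left hb.smooth j x η, partialDeriv, partialDeriv,
      partialDeriv]
    have := fderiv_mul (hd1 x) (hd2 x)
    change fderiv ℝ (fun x => b (x, η) * ST g f x η) x = _ at this
    rw [this]
    simp
    ring
  have p1 := (polyB_slice_left hb η).mul (polyB_ST hg f η)
  have p2 := (polyB_slice_left (hb.2 j).1 η).mul (polyB_ST hg f η)
  have p3 := (polyB_slice_left hb η).mul (polyB_ST hg' f η)
  have i : ∀ {G : Sp n → ℂ}, PolyB G → Integrable fun x => G x * conj (STS (j :: L) f η x) :=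
    fun p => p.integrable_mul (conjS (STS (j :: L) f η))
  rw [formR, integral_mul_conj_STS j L f η hG p1 (by rw [e]; exact p2.add p3), e]
  simp only [formR]
  have i12 : Integrable fun x => b (x, η) * ST g f x η * conj (STS (j :: L) f η x) +
      dX j b (x, η) * ST g f x η * conj (STS (j :: L) f η x) := (i p1).add (i p2)
  rw [← integral_add (i p1) (i p2), ← integral_add i12 (i p3)]
  congr 1
  ext x
  ring

theorem mul_le_sq_add_sq (a b : ℝ≥0∞) : a * b ≤ a ^ 2 + b ^ 2 := by
  rcases le_total a b with h | h
  · calc a * b ≤ b * b := by gcongr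
      _ = b ^ 2 := (sq b).symm
      _ ≤ _ := le_add_self
  · calc a * b ≤ a * a := by gcongr
      _ = a ^ 2 := (sq a).symm
      _ ≤ _ := le_self_add

/-- Polynomially bounded functions all of whose weighted `L²` norms are finite. -/
structure RapidL2 (g : Sp n → ℂ) : Prop where
  polyB : PolyB g
  fin : ∀ (C : ℝ) (M : ℕ), ∫⁻ q, ‖g q‖ₑ ^ 2 * ENNReal.ofReal (C * (1 + ‖q‖) ^ M) < ⊤

theorem RapidL2.coord_mul {g : Sp n → ℂ} (hg : RapidL2 g) (j : Fin n) :
    RapidL2 (fun q => Complex.I * (q j : ℂ) * g q) := by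
  refine ⟨(PolyB.coord j).mul hg.polyB, fun C M => lt_of_le_of_lt ?_ (hg.fin C (M + 2))⟩
  refine lintegral_mono fun q => ?_
  rcases le_total C 0 with hC | hC
  · rw [ENNReal.ofReal_of_nonpos (mul_nonpos_of_nonpos_of_nonneg hC (by positivity))]
    simp
  have h1 : ‖Complex.I * (q j : ℂ)‖ ≤ 1 + ‖q‖ := by
    have := PiLp.norm_apply_le q j
    simp only [norm_mul, Complex.norm_I, Complex.norm_real, one_mul]
    linarith
  have h2 : ‖Complex.I * (q j : ℂ)‖ₑ ≤ ENNReal.ofReal (1 + ‖q‖) := by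
    rw [← ofReal_norm]
    exact ENNReal.ofReal_le_ofReal h1
  have h3 : ENNReal.ofReal (C * (1 + ‖q‖) ^ (M + 2)) =
      ENNReal.ofReal (1 + ‖q‖) ^ 2 * ENNReal.ofReal (C * (1 + ‖q‖) ^ M) := by
    rw [← ENNReal.ofReal_pow (by positivity), ← ENNReal.ofReal_mul (by positivity)]
    ring_nf
  rw [h3, enorm_mul, mul_pow]
  calc ‖Complex.I * (q j : ℂ)‖ₑ ^ 2 * ‖g q‖ₑ ^ 2 * ENNReal.ofReal (C * (1 + ‖q‖) ^ M)
      ≤ ENNReal.ofReal (1 + ‖q‖) ^ 2 * ‖g q‖ₑ ^ 2 * ENNReal.ofReal (C * (1 + ‖q‖) ^ M) := by gcongr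
    _ = _ := by ring

theorem rapidL2_expKernel : RapidL2 (expKernel (n := n)) := by
  refine ⟨polyB_expKernel, fun C M => lt_of_le_of_lt ?_ (lintegral_expKernel_lt_top (n := n) C M)⟩
  refine lintegral_mono fun q => ?_
  have : ‖expKernel q‖ₑ ≤ 1 := by
    rw [← ofReal_norm, ← ENNReal.ofReal_one]
    refine ENNReal.ofReal_le_ofReal ?_
    rw [expKernel, norm_prod]
    exact Finset.prod_le_one (fun j _ => norm_nonneg _) fun j _ => norm_expKer_le _
  gcongr
  rw [sq]
  exact mul_le_of_le_one_left' this

/-- Once `h_L` is square integrable against the Peetre factor, no derivative is needed: bound the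
product by the sum of squares and apply the weighted `L²` estimate to each. -/
theorem lintegral_formR_base {w : Sp n → ℝ} (hw : Tempered w) {C : ℝ} {M : ℕ} (hC : 0 ≤ C)
    (hM : ∀ ξ η, w (ξ + η) ≤ C * (1 + ‖η‖) ^ M * w ξ) {A : ℝ} {b : Sp n × Sp n → ℂ}
    (hb : SymB w 0 A b) {g : Sp n → ℂ} (hg : PolyB g) (L : List (Fin n)) (f : 𝓢(Sp n, ℂ)) :
    ∫⁻ η, ‖formR b g L f η‖ₑ ≤
      ((∫⁻ q, ‖g q‖ₑ ^ 2 * ENNReal.ofReal (C * (1 + ‖q‖) ^ M)) +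
        ∫⁻ q, ‖hL L q‖ₑ ^ 2 * ENNReal.ofReal (C * (1 + ‖q‖) ^ M)) * ENNReal.ofReal A *
        ∫⁻ η, ENNReal.ofReal (w η) * ‖f η‖ₑ ^ 2 := by
  have hA := hb.nonneg hw
  have hf := f.continuous.measurable
  have hm1 : ∀ η, Measurable fun x => ‖ST g f x η‖ₑ ^ 2 := fun η =>
    ((polyB_ST hg f η).meas.enorm).pow_const 2
  have hm2 : Measurable fun η => ∫⁻ x, ‖ST g f x η‖ₑ ^ 2 := by
    have h := ((stronglyMeasurable_ST hg.meas hf).measurable.enorm).pow_const 2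
    exact h.lintegral_prod_left'
  have hwm : Measurable (fun η => ENNReal.ofReal (w η)) := hw.cont.measurable.ennreal_ofReal
  calc ∫⁻ η, ‖formR b g L f η‖ₑ
      ≤ ∫⁻ η, ENNReal.ofReal A * (ENNReal.ofReal (w η) * (∫⁻ x, ‖ST g f x η‖ₑ ^ 2) +
          ENNReal.ofReal (w η) * ∫⁻ x, ‖ST (hL L) f x η‖ₑ ^ 2) := by
        refine lintegral_mono fun η => ?_
        refine (enorm_integral_le_lintegral_enorm _).trans ?_
        rw [← mul_add, ← lintegral_add_left (hm1 η), ← mul_assoc, ← ENNReal.ofReal_mul hA,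
          ← lintegral_const_mul' _ _ ENNReal.ofReal_ne_top]
        refine lintegral_mono fun x => ?_
        simp only
        rw [enorm_mul, enorm_mul, mul_assoc]
        refine mul_le_mul' ?_ ?_
        · rw [← ofReal_norm]
          exact ENNReal.ofReal_le_ofReal (hb.bound (x, η))
        · rw [STS_apply, show ‖conj (ST (hL L) f x η)‖ₑ = ‖ST (hL L) f x η‖ₑ by
            rw [← ofReal_norm, ← ofReal_norm, Complex.norm_conj]]
          exact mul_le_sq_add_sq _ _
    _ = ENNReal.ofReal A * ((∫⁻ η, ENNReal.ofReal (w η) * ∫⁻ x, ‖ST g f x η‖ₑ ^ 2) +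
          ∫⁻ η, ENNReal.ofReal (w η) * ∫⁻ x, ‖ST (hL L) f x η‖ₑ ^ 2) := by
        rw [lintegral_const_mul' _ _ ENNReal.ofReal_ne_top, lintegral_add_left
          (show Measurable fun η => ENNReal.ofReal (w η) * ∫⁻ x, ‖ST g f x η‖ₑ ^ 2 from hwm.mul hm2)]
    _ ≤ ENNReal.ofReal A * ((∫⁻ q, ‖g q‖ₑ ^ 2 * ENNReal.ofReal (C * (1 + ‖q‖) ^ M)) *
          (∫⁻ η, ENNReal.ofReal (w η) * ‖f η‖ₑ ^ 2) +
          (∫⁻ q, ‖hL L q‖ₑ ^ 2 * ENNReal.ofReal (C * (1 + ‖q‖) ^ M)) *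
          (∫⁻ η, ENNReal.ofReal (w η) * ‖f η‖ₑ ^ 2)) := by
        gcongr
        · exact lintegral_ST_weighted hw hC hM hg f
        · exact lintegral_ST_weighted hw hC hM (polyB_hL L) f
    _ = _ := by ring

/-- A bound for `formR` with the multiplier `h_L`, for symbols with `N` controlled derivatives. -/
def FormBound (w : Sp n → ℝ) (N : ℕ) (L : List (Fin n)) : Prop :=
  ∀ g : Sp n → ℂ, RapidL2 g → ∃ K : ℝ≥0∞, K < ⊤ ∧ ∀ (A : ℝ) (b : Sp n × Sp n → ℂ),
    SymB w N A b → ∀ f : 𝓢(Sp n, ℂ),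
      ∫⁻ η, ‖formR b g L f η‖ₑ ≤ K * ENNReal.ofReal A * ∫⁻ η, ENNReal.ofReal (w η) * ‖f η‖ₑ ^ 2

/-- Multiplication by `i q_j` preserves `RapidL2`; quantifying `FormBound` over all such windows
lets the extra Leibniz term be covered by the same hypothesis. -/
theorem FormBound.of_cons {w : Sp n → ℝ} {N : ℕ} {j : Fin n} {L : List (Fin n)}
    (h : FormBound w N (j :: L)) : FormBound w (N + 1) L := by
  intro g hg
  obtain ⟨K₁, hK₁, h1⟩ := h g hg
  obtain ⟨K₂, hK₂, h2⟩ := h _ (hg.coord_mul j)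
  refine ⟨K₁ + K₁ + K₂, by simp [hK₁, hK₂], fun A b hb f => ?_⟩
  have hb1 : SymB w 1 A b := hb.of_le (by omega)
  have hm1 := (stronglyMeasurable_formR hb.smooth.continuous hg.polyB.meas (j :: L) f).measurable
  have hm2 := (stronglyMeasurable_formR (hb.2 j).1.smooth.continuous hg.polyB.meas
    (j :: L) f).measurable
  calc ∫⁻ η, ‖formR b g L f η‖ₑ
      ≤ ∫⁻ η, (‖formR b g (j :: L) f η‖ₑ + ‖formR (dX j b) g (j :: L) f η‖ₑ +
        ‖formR b (fun q => Complex.I * (q j : ℂ) * g q) (j :: L) f η‖ₑ) := by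
        refine lintegral_mono fun η => ?_
        rw [formR_step hb1 hg.polyB j L f η]
        exact (enorm_add_le _ _).trans (by gcongr; exact enorm_add_le _ _)
    _ = (∫⁻ η, ‖formR b g (j :: L) f η‖ₑ) + (∫⁻ η, ‖formR (dX j b) g (j :: L) f η‖ₑ) +
        ∫⁻ η, ‖formR b (fun q => Complex.I * (q j : ℂ) * g q) (j :: L) f η‖ₑ := by
        rw [lintegral_add_left (show Measurable fun η => ‖formR b g (j :: L) f η‖ₑ +
          ‖formR (dX j b) g (j :: L) f η‖ₑ from hm1.enorm.add hm2.enorm), lintegral_add_left hm1.enorm]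
    _ ≤ _ := by
        rw [add_mul, add_mul, add_mul, add_mul]
        gcongr
        · exact h1 A b hb.1 f
        · exact h1 A _ (hb.2 j).1 f
        · exact h2 A b hb.1 f

/-- Start from a list `L` long enough for the base estimate and remove its entries one at a time,
paying one symbol derivative for each. -/
theorem exists_formBound {w : Sp n → ℝ} (hw : Tempered w) : ∃ N, FormBound w N [] := by
  obtain ⟨C, M, hC, hM⟩ := hw.peetre
  obtain ⟨L, hL'⟩ := exists_hL_lintegral_lt_top (n := n) C M
  have h0 : FormBound w 0 L := fun g hg =>
    ⟨_, ENNReal.add_lt_top.2 ⟨hg.fin C M, hL'⟩, fun A b hb f =>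
      lintegral_formR_base hw hC.le hM hb hg.polyB L f⟩
  have key : ∀ (L : List (Fin n)) (N : ℕ), FormBound w N L → FormBound w (N + L.length) [] := by
    intro L
    induction L with
    | nil => intro N h; exact h
    | cons j L ih =>
      intro N h
      have := ih (N + 1) h.of_cons
      rwa [List.length_cons, add_comm L.length 1, ← add_assoc]
  exact ⟨_, key L 0 h0⟩

/-! ### Reduction of the pairing to `formR` -/

theorem Tempered.polyB {w : Sp n → ℝ} (hw : Tempered w) : PolyB (fun η => (w η : ℂ)) := by
  obtain ⟨C, M, hC, h⟩ := hw.exists_growth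
  refine ⟨Complex.measurable_ofReal.comp hw.cont.measurable, C, M, hC, fun q => ?_⟩
  rw [Complex.norm_real, Real.norm_of_nonneg (hw.pos q).le]
  exact h q

theorem polyB_schwartz (f : 𝓢(Sp n, ℂ)) : PolyB f :=
  PolyB.of_bounded f.continuous.measurable fun q => f.norm_le_seminorm ℝ q

theorem Tempered.integrable_sq {w : Sp n → ℝ} (hw : Tempered w) (φ : 𝓢(Sp n, ℂ)) :
    Integrable (fun ξ => w ξ * ‖fourierHat φ ξ‖ ^ 2) := by
  have := ((hw.polyB.mul (polyB_schwartz (hatS φ))).integrable_mul (hatS φ)).norm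
  refine this.congr (ae_of_all _ fun ξ => ?_)
  simp only [norm_mul, Complex.norm_real, Real.norm_of_nonneg (hw.pos ξ).le, hatS_apply]
  ring

/-- Licenses exchanging the `x` and `η` integrals. The windowed transform is bounded uniformly in
`x` by a convolution, so decay in `x` comes from `φ` and decay in `η` from weighted Young. -/
theorem integrable_form {w : Sp n → ℝ} (hw : Tempered w) {N : ℕ} {A : ℝ} {b : Sp n × Sp n → ℂ}
    (hb : SymB w N A b) (f φ : 𝓢(Sp n, ℂ)) :
    Integrable (fun p : Sp n × Sp n => b p * ST expKernel f p.1 p.2 * conj (φ p.1)) := by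
  obtain ⟨C, M, hC, hM⟩ := hw.peetre
  have hA := hb.nonneg hw
  have hf := f.continuous.measurable
  have hφ := φ.continuous.measurable
  have hE := polyB_expKernel (n := n)
  have hwm : Measurable (fun η => ENNReal.ofReal (w η)) := hw.cont.measurable.ennreal_ofReal
  have hmeas : Measurable (fun p : Sp n × Sp n =>
      b p * ST expKernel f p.1 p.2 * conj (φ p.1)) :=
    (hb.smooth.continuous.measurable.mul (stronglyMeasurable_ST hE.meas hf).measurable).mul
      (Complex.continuous_conj.measurable.comp (hφ.comp measurable_fst))
  refine ⟨hmeas.aestronglyMeasurable, ?_⟩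
  have hST : ∀ x η, ‖ST expKernel f x η‖ₑ ≤
      ENNReal.ofReal (cn n) * ∫⁻ q, ‖expKernel q‖ₑ * ‖f (η + q)‖ₑ := by
    intro x η
    rw [ST, invHat, enorm_mul, show ‖((cn n : ℝ) : ℂ)‖ₑ = ENNReal.ofReal (cn n) by
      rw [← ofReal_norm, Complex.norm_real, Real.norm_of_nonneg (cn_pos n).le]]
    gcongr
    refine (enorm_integral_le_lintegral_enorm _).trans (lintegral_mono fun q => ?_)
    rw [enorm_mul, enorm_mul, ← ofReal_norm (Complex.exp _), norm_cexp_I_mul]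
    simp
  rw [HasFiniteIntegral, Measure.volume_eq_prod, lintegral_prod_symm' _ hmeas.enorm]
  have hφi : ∫⁻ x, ‖φ x‖ₑ < ⊤ := φ.integrable.2
  have hfi : ∫⁻ η, ENNReal.ofReal (w η) * ‖f η‖ₑ < ⊤ := by
    have := (hw.polyB.integrable_mul f).2
    rw [HasFiniteIntegral] at this
    refine lt_of_le_of_lt (lintegral_mono fun η => ?_) this
    rw [enorm_mul, ← ofReal_norm (w η : ℂ), Complex.norm_real, Real.norm_of_nonneg (hw.pos η).le]
  calc ∫⁻ η, ∫⁻ x, ‖b (x, η) * ST expKernel f x η * conj (φ x)‖ₑ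
      ≤ ∫⁻ η, ∫⁻ x, (ENNReal.ofReal A * ENNReal.ofReal (cn n) * (ENNReal.ofReal (w η) *
          ∫⁻ q, ‖expKernel q‖ₑ * ‖f (η + q)‖ₑ)) * ‖φ x‖ₑ := by
        refine lintegral_mono fun η => lintegral_mono fun x => ?_
        rw [enorm_mul, enorm_mul, show ‖conj (φ x)‖ₑ = ‖φ x‖ₑ by
          rw [← ofReal_norm, ← ofReal_norm, Complex.norm_conj]]
        refine mul_le_mul' ?_ le_rfl
        calc ‖b (x, η)‖ₑ * ‖ST expKernel f x η‖ₑ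
            ≤ (ENNReal.ofReal A * ENNReal.ofReal (w η)) *
              (ENNReal.ofReal (cn n) * ∫⁻ q, ‖expKernel q‖ₑ * ‖f (η + q)‖ₑ) := by
              gcongr
              · rw [← ofReal_norm, ← ENNReal.ofReal_mul hA]
                exact ENNReal.ofReal_le_ofReal (hb.bound (x, η))
              · exact hST x η
          _ = _ := by ring
    _ = ENNReal.ofReal A * ENNReal.ofReal (cn n) * (∫⁻ η, ENNReal.ofReal (w η) *
          ∫⁻ q, ‖expKernel q‖ₑ * ‖f (η + q)‖ₑ) * ∫⁻ x, ‖φ x‖ₑ := by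
        simp only [lintegral_const_mul _ hφ.enorm]
        rw [lintegral_mul_const' _ _ hφi.ne, lintegral_const_mul' _ _ (by finiteness)]
    _ < ⊤ := by
        refine ENNReal.mul_lt_top (ENNReal.mul_lt_top (by finiteness) ?_) hφi
        exact lt_of_le_of_lt (lintegral_weighted_conv_le hw hC.le hM hE.meas.enorm
          (F := fun q => ‖f q‖ₑ) hf.enorm)
          (ENNReal.mul_lt_top (lintegral_expKernel_lt_top C M) hfi)

/-- Integrating by parts once in each frequency variable replaces `φ̂` by its `expKernel` transform.
After Fubini the remaining phase joins `conj φ` to form the conjugate transform with trivial window,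
ready for integration by parts in `x`. -/
theorem pairing_pseudoDiff_eq {w : Sp n → ℝ} (hw : Tempered w) {A : ℝ} {a : Sp n × Sp n → ℂ}
    (ha : SymB w n A a) (φ : 𝓢(Sp n, ℂ)) :
    pairing (pseudoDiff (fun x ξ => a (x, ξ)) φ) φ =
      ∫ η, formR (resP (List.finRange n) a) expKernel [] (hatS φ) η := by
  have hl : (List.finRange n).length = n := List.length_finRange
  have hb : SymB w 0 (2 ^ (List.finRange n).length * A) (resP (List.finRange n) a) :=
    SymB.resP _ (by rw [hl, zero_add]; exact ha)
  have hc : (cn n : ℂ) ≠ 0 := by exact_mod_cast (cn_pos n).ne'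
  have hint : Integrable (Function.uncurry fun x η : Sp n =>
      Complex.exp (Complex.I * ((inner ℝ x η : ℝ) : ℂ)) *
        (resP (List.finRange n) a (x, η) * ST expKernel (hatS φ) x η * conj (φ x)))
      (volume.prod volume) :=
    (integrable_form hw hb (hatS φ) φ).bdd_mul (c := 1)
      continuous_phase.aestronglyMeasurable (ae_of_all _ fun q => by simp)
  calc pairing (pseudoDiff (fun x ξ => a (x, ξ)) φ) φ
      = ∫ x, ∫ η, Complex.exp (Complex.I * ((inner ℝ x η : ℝ) : ℂ)) *
        (resP (List.finRange n) a (x, η) * ST expKernel (hatS φ) x η * conj (φ x)) := by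
        rw [pairing]
        congr with x
        have h1 : ∫ ξ, Complex.exp (Complex.I * ((inner ℝ x ξ : ℝ) : ℂ)) * a (x, ξ) *
            fourierHat φ ξ = ∫ η, a (x, η) * STS [] (reflS φ) (-x) η := by
          congr with η
          rw [STS_apply, ST_one_reflS]
          ring
        rw [pseudoDiff, h1, integral_resP hw (List.finRange n) (by rw [hl]; exact ha),
          mul_right_comm, ← integral_const_mul]
        congr with η
        rw [STS_apply, ST_full_reflS]
        change (cn n : ℂ) * _ * _ = _
        field_simp
    _ = _ := by
        rw [integral_integral_swap hint]
        congr with η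
        rw [formR]
        congr with x
        rw [STS_apply, ST_one, map_mul, ← Complex.exp_conj]
        simp only [map_neg, map_mul, Complex.conj_I, Complex.conj_ofReal]
        ring_nf

/-- The weighted form bound: operators whose symbol is bounded by `w(ξ)` together with its
derivatives are form bounded with respect to the weighted norm. -/
theorem exists_form_bound {w : Sp n → ℝ} (hw : Tempered w) : ∃ (N : ℕ) (K : ℝ), 0 < K ∧
    ∀ (A : ℝ) (a : Sp n × Sp n → ℂ), SymB w N A a → ∀ φ : 𝓢(Sp n, ℂ),
      ‖pairing (pseudoDiff (fun x ξ => a (x, ξ)) φ) φ‖ ≤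
        K * A * ∫ ξ, w ξ * ‖fourierHat φ ξ‖ ^ 2 := by
  obtain ⟨N, hN⟩ := exists_formBound hw
  obtain ⟨K, hK, h⟩ := hN _ rapidL2_expKernel
  have hl : (List.finRange n).length = n := List.length_finRange
  -- The `n` extra derivatives and the factor `2 ^ n` pay for `resP`; the `+ 1` only secures
  -- positivity.
  refine ⟨N + n, (K.toReal + 1) * 2 ^ n, by positivity, fun A a ha φ => ?_⟩
  have hA := ha.nonneg hw
  have hb := SymB.resP (List.finRange n) (N := N) (by rw [hl]; exact ha)
  have h1 := h _ _ hb (hatS φ)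
  rw [pairing_pseudoDiff_eq hw (ha.of_le (by omega)) φ]
  have hi := hw.integrable_sq φ
  have h2 : ∫⁻ η, ENNReal.ofReal (w η) * ‖hatS φ η‖ₑ ^ 2 =
      ENNReal.ofReal (∫ ξ, w ξ * ‖fourierHat φ ξ‖ ^ 2) := by
    rw [ofReal_integral_eq_lintegral_ofReal hi
      (ae_of_all _ fun ξ => mul_nonneg (hw.pos ξ).le (by positivity))]
    congr with ξ
    rw [ENNReal.ofReal_mul (hw.pos ξ).le, ENNReal.ofReal_pow (norm_nonneg _), ofReal_norm,
      hatS_apply]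
  have hI : 0 ≤ ∫ ξ, w ξ * ‖fourierHat φ ξ‖ ^ 2 :=
    integral_nonneg fun ξ => mul_nonneg (hw.pos ξ).le (by positivity)
  rw [h2, hl, ← ENNReal.ofReal_toReal hK.ne, ← ENNReal.ofReal_mul ENNReal.toReal_nonneg,
    ← ENNReal.ofReal_mul (by positivity)] at h1
  have h3 := (enorm_integral_le_lintegral_enorm _).trans h1
  rw [← ofReal_norm, ENNReal.ofReal_le_ofReal_iff (by positivity)] at h3
  refine h3.trans (mul_le_mul_of_nonneg_right ?_ hI)
  have : 0 ≤ 2 ^ n * A := by positivity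
  linarith

/-! ### The form of an operator as an integral over phase space -/

/-- The integrand of the form `(T_a φ, φ)` over phase space, without the symbol. -/
def formKer (φ : 𝓢(Sp n, ℂ)) (p : Sp n × Sp n) : ℂ :=
  (cn n : ℂ) * Complex.exp (Complex.I * ((inner ℝ p.1 p.2 : ℝ) : ℂ)) * fourierHat φ p.2 *
    conj (φ p.1)

theorem continuous_formKer (φ : 𝓢(Sp n, ℂ)) : Continuous (formKer φ) := by
  have h1 : Continuous fun p : Sp n × Sp n => fourierHat φ p.2 := by
    simp only [← hatS_apply]
    exact (hatS φ).continuous.comp continuous_snd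
  have h2 : Continuous fun p : Sp n × Sp n => conj (φ p.1) :=
    Complex.continuous_conj.comp (φ.continuous.comp continuous_fst)
  exact ((continuous_const.mul continuous_phase).mul h1).mul h2

theorem norm_formKer (φ : 𝓢(Sp n, ℂ)) (p : Sp n × Sp n) :
    ‖formKer φ p‖ = cn n * (‖φ p.1‖ * ‖fourierHat φ p.2‖) := by
  rw [formKer, norm_mul, norm_mul, norm_mul, norm_cexp_I_mul, Complex.norm_conj, Complex.norm_real,
    Real.norm_of_nonneg (cn_pos n).le]
  ring

theorem integrable_weight_formKer {w : Sp n → ℝ} (hw : Tempered w) (φ : 𝓢(Sp n, ℂ)) :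
    Integrable (fun p : Sp n × Sp n => (w p.2 : ℂ) * formKer φ p) := by
  have h1 : Integrable (fun p : Sp n × Sp n => φ p.1 * ((w p.2 : ℂ) * hatS φ p.2))
      (volume.prod volume) := φ.integrable.mul_prod (hw.polyB.integrable_mul (hatS φ))
  refine (h1.const_mul (cn n : ℂ)).mono ?_ (ae_of_all _ fun p => ?_)
  · have : Continuous fun p : Sp n × Sp n => (w p.2 : ℂ) :=
      Complex.continuous_ofReal.comp (hw.cont.comp continuous_snd)
    exact (this.mul (continuous_formKer φ)).aestronglyMeasurable
  · rw [norm_mul, norm_formKer, norm_mul, norm_mul, norm_mul, hatS_apply, Complex.norm_real (cn n),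
      Real.norm_of_nonneg (cn_pos n).le]
    apply le_of_eq
    ring

theorem SymB.integrable_mul_formKer {w : Sp n → ℝ} (hw : Tempered w) {N : ℕ} {A : ℝ}
    {a : Sp n × Sp n → ℂ} (ha : SymB w N A a) (φ : 𝓢(Sp n, ℂ)) :
    Integrable (fun p => a p * formKer φ p) := by
  refine ((integrable_weight_formKer hw φ).const_mul (A : ℂ)).mono
    (ha.smooth.continuous.mul (continuous_formKer φ)).aestronglyMeasurable (ae_of_all _ fun p => ?_)
  rw [norm_mul, norm_mul, norm_mul, ← mul_assoc]
  refine mul_le_mul_of_nonneg_right ?_ (norm_nonneg _)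
  rw [Complex.norm_real, Complex.norm_real, Real.norm_of_nonneg (ha.nonneg hw),
    Real.norm_of_nonneg (hw.pos _).le]
  exact ha.bound p

theorem SymB.pairing_eq {w : Sp n → ℝ} (hw : Tempered w) {N : ℕ} {A : ℝ}
    {a : Sp n × Sp n → ℂ} (ha : SymB w N A a) (φ : 𝓢(Sp n, ℂ)) :
    pairing (pseudoDiff (fun x ξ => a (x, ξ)) φ) φ = ∫ p, a p * formKer φ p := by
  rw [Measure.volume_eq_prod, integral_prod _ (by
    rw [← Measure.volume_eq_prod]; exact ha.integrable_mul_formKer hw φ), pairing]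
  congr with x
  rw [pseudoDiff, mul_right_comm, ← integral_const_mul]
  congr with ξ
  rw [formKer]
  change (cn n : ℂ) * _ * _ = _
  ring

/-- The form of a Fourier multiplier. -/
theorem integral_multiplier_formKer {b : Sp n → ℂ} (hb : PolyB b) (φ : 𝓢(Sp n, ℂ)) :
    ∫ p : Sp n × Sp n, b p.2 * formKer φ p = ∫ ξ, b ξ * ((‖fourierHat φ ξ‖ ^ 2 : ℝ) : ℂ) := by
  have h1 : Integrable (fun p : Sp n × Sp n => conj (φ p.1) * (b p.2 * hatS φ p.2))
      (volume.prod volume) := (conjS φ).integrable.mul_prod (hb.integrable_mul (hatS φ))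
  have h2 : Integrable (fun p : Sp n × Sp n => b p.2 * formKer φ p) (volume.prod volume) := by
    have h3 := ((h1.bdd_mul (c := 1) continuous_phase.aestronglyMeasurable
      (ae_of_all _ fun q => by simp))).const_mul (cn n : ℂ)
    refine h3.congr (ae_of_all _ fun p => ?_)
    simp only [formKer, hatS_apply]
    ring
  rw [Measure.volume_eq_prod, integral_prod_symm _ h2]
  congr with ξ
  have h4 : (((‖fourierHat φ ξ‖ ^ 2 : ℝ)) : ℂ) = fourierHat φ ξ * conj (fourierHat φ ξ) := by
    rw [Complex.mul_conj, Complex.normSq_eq_norm_sq]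
  have h5 : conj (fourierHat φ ξ) = (cn n : ℂ) * ∫ x, Complex.exp (Complex.I *
      ((inner ℝ x ξ : ℝ) : ℂ)) * conj (φ x) := by
    rw [fourierHat, map_mul, ← integral_conj, Complex.conj_ofReal]
    congr 2
    ext x
    rw [map_mul, ← Complex.exp_conj]
    simp
  rw [h4, h5, ← integral_const_mul, ← integral_const_mul, ← integral_const_mul]
  congr with x
  simp only [formKer]
  ring

/-! ### Anti-Wick quantization -/

/-- The short-time Fourier transform of `φ` with window `χ`. -/
def stft (χ φ : 𝓢(Sp n, ℂ)) (z ξ : Sp n) : ℂ :=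
  (cn n : ℂ) * ∫ ζ, Complex.exp (-(Complex.I * ((inner ℝ z ζ : ℝ) : ℂ))) *
    (fourierHat χ ζ * fourierHat φ (ξ - ζ))

/-- The position-side formula for the transform, whose definition is on the frequency side.
Multiplying one expression by the other yields an integral over all of phase space. -/
theorem conj_stft (χ φ : 𝓢(Sp n, ℂ)) (z ξ : Sp n) :
    conj (stft χ φ z ξ) = (cn n : ℂ) * ∫ w, Complex.exp (Complex.I *
      ((inner ℝ (z + w) ξ : ℝ) : ℂ)) * (conj (χ w) * conj (φ (z + w))) := by
  have hint : Integrable (Function.uncurry fun ζ x : Sp n =>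
      Complex.exp (-(Complex.I * ((inner ℝ z ζ : ℝ) : ℂ))) *
        (Complex.exp (-(Complex.I * ((inner ℝ x (ξ - ζ) : ℝ) : ℂ))) * (hatS χ ζ * φ x)))
      (volume.prod volume) := by
    have h1 : Integrable (fun p : Sp n × Sp n => hatS χ p.1 * φ p.2) (volume.prod volume) :=
      (hatS χ).integrable.mul_prod φ.integrable
    have hn : ∀ r : ℝ, ‖Complex.exp (-(Complex.I * (r : ℂ)))‖ = 1 := fun r => by
      have := norm_cexp_I_mul (-r)
      simpa using this
    refine (h1.bdd_mul (c := 1) (f := fun p : Sp n × Sp n =>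
      Complex.exp (-(Complex.I * ((inner ℝ p.2 (ξ - p.1) : ℝ) : ℂ))))
      (by fun_prop) (ae_of_all _ fun p => (hn _).le)).bdd_mul (c := 1)
      (f := fun p : Sp n × Sp n => Complex.exp (-(Complex.I * ((inner ℝ z p.1 : ℝ) : ℂ))))
      (by fun_prop) (ae_of_all _ fun p => (hn _).le)
  have key : stft χ φ z ξ = (cn n : ℂ) * ∫ w, Complex.exp (-(Complex.I *
      ((inner ℝ (z + w) ξ : ℝ) : ℂ))) * (χ w * φ (z + w)) := by
    rw [stft]
    congr 1
    calc _ = ∫ ζ, ∫ x, (cn n : ℂ) * (Complex.exp (-(Complex.I * ((inner ℝ z ζ : ℝ) : ℂ))) *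
        (Complex.exp (-(Complex.I * ((inner ℝ x (ξ - ζ) : ℝ) : ℂ))) * (hatS χ ζ * φ x))) := by
          congr with ζ
          have h : fourierHat φ (ξ - ζ) = (cn n : ℂ) * ∫ x, Complex.exp (-(Complex.I *
            ((inner ℝ x (ξ - ζ) : ℝ) : ℂ))) * φ x := rfl
          rw [h, hatS_apply, ← integral_const_mul, ← integral_const_mul, ← integral_const_mul]
          congr with x
          ring
      _ = ∫ x, Complex.exp (-(Complex.I * ((inner ℝ x ξ : ℝ) : ℂ))) * (χ (x - z) * φ x) := by
          rw [integral_integral_swap (hint.const_mul (cn n : ℂ))]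
          congr with x
          have h : χ (x - z) = (cn n : ℂ) * ∫ ζ, Complex.exp (Complex.I *
            ((inner ℝ (x - z) ζ : ℝ) : ℂ)) * hatS χ ζ := (invHat_hatS χ (x - z)).symm
          rw [h, mul_comm _ (φ x), ← integral_const_mul, ← integral_const_mul,
            ← integral_const_mul]
          congr with ζ
          have e : Complex.exp (-(Complex.I * ((inner ℝ z ζ : ℝ) : ℂ))) *
              Complex.exp (-(Complex.I * ((inner ℝ x (ξ - ζ) : ℝ) : ℂ))) =
              Complex.exp (-(Complex.I * ((inner ℝ x ξ : ℝ) : ℂ))) *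
              Complex.exp (Complex.I * ((inner ℝ (x - z) ζ : ℝ) : ℂ)) := by
            rw [← Complex.exp_add, ← Complex.exp_add, inner_sub_right, inner_sub_left]
            congr 1
            push_cast
            ring
          linear_combination (cn n * hatS χ ζ * φ x) * e
      _ = _ := by
          rw [← integral_add_left_eq_self _ z]
          simp
  rw [key, map_mul, ← integral_conj, Complex.conj_ofReal]
  congr 2
  ext x
  rw [map_mul, map_mul, ← Complex.exp_conj]
  simp

instance isAddRightInvariant_volume_prod :
    (volume : Measure (Sp n × Sp n)).IsAddRightInvariant :=
  inferInstanceAs ((volume : Measure (Sp n)).prod volume).IsAddRightInvariant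

/-- The form of the operator with symbol `a` at the Schwartz function `φ`. -/
def form (a : Sp n × Sp n → ℂ) (φ : 𝓢(Sp n, ℂ)) : ℂ := ∫ p, a p * formKer φ p

/-- Expand `conj V · V` with `conj V` as a position integral and `V` as a frequency integral; the
phases recombine into those of the two kernels. This identity is the source of the averaging
formula. -/
theorem integral_formKer_mul_formKer_add (χ φ : 𝓢(Sp n, ℂ)) (p : Sp n × Sp n) :
    ∫ q : Sp n × Sp n, formKer χ q * formKer φ (p + (q.1, -q.2)) =
      ((‖stft χ φ p.1 p.2‖ ^ 2 : ℝ) : ℂ) := by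
  have h4 : ((‖stft χ φ p.1 p.2‖ ^ 2 : ℝ) : ℂ) = conj (stft χ φ p.1 p.2) * stft χ φ p.1 p.2 := by
    rw [mul_comm, Complex.mul_conj, Complex.normSq_eq_norm_sq]
  rw [h4, conj_stft, stft, ← integral_const_mul, ← integral_const_mul, Measure.volume_eq_prod,
    ← integral_prod_mul]
  congr with q
  have e : Complex.exp (Complex.I * ((inner ℝ q.1 q.2 : ℝ) : ℂ)) *
      Complex.exp (Complex.I * ((inner ℝ (p.1 + q.1) (p.2 - q.2) : ℝ) : ℂ)) =
      Complex.exp (Complex.I * ((inner ℝ (p.1 + q.1) p.2 : ℝ) : ℂ)) *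
      Complex.exp (-(Complex.I * ((inner ℝ p.1 q.2 : ℝ) : ℂ))) := by
    rw [← Complex.exp_add, ← Complex.exp_add, inner_sub_right, inner_add_left _ _ q.2]
    congr 1
    push_cast
    ring
  simp only [formKer, Prod.fst_add, Prod.snd_add, ← sub_eq_add_neg]
  linear_combination (cn n ^ 2 * fourierHat χ q.2 * conj (χ q.1) * fourierHat φ (p.2 - q.2) *
    conj (φ (p.1 + q.1))) * e

theorem integrable_mul_formKer_of_le {w : Sp n → ℝ} (hw : Tempered w) {a : Sp n × Sp n → ℂ}
    (ha : Continuous a) {A : ℝ} (h : ∀ p, ‖a p‖ ≤ A * w p.2) (φ : 𝓢(Sp n, ℂ)) :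
    Integrable (fun p => a p * formKer φ p) ∧
      ∫ p, ‖a p * formKer φ p‖ ≤ A * ∫ p, w p.2 * ‖formKer φ p‖ := by
  have hn : ∀ p : Sp n × Sp n, ‖(w p.2 : ℂ) * formKer φ p‖ = w p.2 * ‖formKer φ p‖ := fun p => by
    rw [norm_mul, Complex.norm_real, Real.norm_of_nonneg (hw.pos _).le]
  have hi := (integrable_weight_formKer hw φ).norm
  simp only [hn] at hi
  have hb : ∀ p, ‖a p * formKer φ p‖ ≤ A * (w p.2 * ‖formKer φ p‖) := fun p => by
    rw [norm_mul, ← mul_assoc]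
    exact mul_le_mul_of_nonneg_right (h p) (norm_nonneg _)
  have h1 : Integrable (fun p => a p * formKer φ p) :=
    (hi.const_mul A).mono' (ha.mul (continuous_formKer φ)).aestronglyMeasurable (ae_of_all _ hb)
  refine ⟨h1, ?_⟩
  rw [← integral_const_mul]
  exact integral_mono h1.norm (hi.const_mul A) hb

theorem tempered_one_add_norm_pow (M : ℕ) : Tempered (fun ξ : Sp n => (1 + ‖ξ‖) ^ M) := by
  refine ⟨fun ξ => by positivity, by fun_prop, 1, M, one_pos, fun ξ η => ?_⟩
  rw [one_mul, ← mul_pow]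
  gcongr
  nlinarith [norm_add_le ξ η, norm_nonneg ξ, norm_nonneg η, mul_nonneg (norm_nonneg ξ) (norm_nonneg η)]

theorem integrable_formKer_moments (χ : 𝓢(Sp n, ℂ)) (M : ℕ) :
    Integrable (fun q : Sp n × Sp n => ‖formKer χ q‖ * (1 + ‖q.2‖) ^ M) := by
  have := (integrable_weight_formKer (tempered_one_add_norm_pow M) χ).norm
  refine this.congr (ae_of_all _ fun q => ?_)
  simp only
  rw [norm_mul, Complex.norm_real, Real.norm_of_nonneg (by positivity), mul_comm]

/-- Translate the symbol rather than `formKer φ`: Peetre then costs a power of `1 + ‖q.2‖`, which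
the moments of `formKer χ` absorb. -/
theorem SymB.integrable_formKer_translates {w : Sp n → ℝ} (hw : Tempered w) {N : ℕ} {A : ℝ}
    {a : Sp n × Sp n → ℂ} (ha : SymB w N A a) (χ φ : 𝓢(Sp n, ℂ)) :
    Integrable (Function.uncurry fun p q : Sp n × Sp n =>
      a p * (formKer χ q * formKer φ (p + (q.1, -q.2)))) (volume.prod volume) := by
  obtain ⟨C, M, hC, hM⟩ := hw.peetre
  have hA := ha.nonneg hw
  have hcont : Continuous (Function.uncurry fun p q : Sp n × Sp n =>
      a p * (formKer χ q * formKer φ (p + (q.1, -q.2)))) := by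
    have h1 := ha.smooth.continuous
    have h2 := continuous_formKer χ
    have h3 := continuous_formKer φ
    simp only [Function.uncurry_def]
    fun_prop
  have hq : ∀ q : Sp n × Sp n, ∀ p, MElliptic.tr (-q.1, q.2) a p * formKer φ p =
      (fun p => a p * formKer φ (p + (q.1, -q.2))) (p + (-q.1, q.2)) := fun q p => by
    simp only [MElliptic.tr]
    congr 2
    ext : 1 <;> simp
  have key : ∀ q : Sp n × Sp n, Integrable (fun p => a p * formKer φ (p + (q.1, -q.2))) ∧
      ∫ p, ‖a p * formKer φ (p + (q.1, -q.2))‖ ≤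
        A * (C * (1 + ‖q.2‖) ^ M) * ∫ p, w p.2 * ‖formKer φ p‖ := fun q => by
    have h := integrable_mul_formKer_of_le hw (a := MElliptic.tr (-q.1, q.2) a)
      (A := A * (C * (1 + ‖q.2‖) ^ M)) (contDiff_tr ha.smooth).continuous (fun p => by
        refine (ha.bound _).trans ?_
        rw [mul_assoc]
        exact mul_le_mul_of_nonneg_left (hM _ _) hA) φ
    simp only [hq q] at h
    have h0 := integral_add_right_eq_self (μ := volume)
      (fun p => ‖a p * formKer φ (p + (q.1, -q.2))‖) (-q.1, q.2)
    have h1 := h.1.comp_add_right ((q.1, -q.2) : Sp n × Sp n)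
    refine ⟨h1.congr (ae_of_all _ fun p => ?_), h0 ▸ h.2⟩
    have : p + (q.1, -q.2) + (-q.1, q.2) = p := by ext : 1 <;> simp
    simp only [this]
  rw [integrable_prod_iff' hcont.aestronglyMeasurable]
  refine ⟨ae_of_all _ fun q => ?_, ?_⟩
  · refine ((key q).1.const_mul (formKer χ q)).congr (ae_of_all _ fun p => ?_)
    simp only [Function.uncurry]
    ring
  · refine (((integrable_formKer_moments χ M).const_mul (A * C)).mul_const
      (∫ p, w p.2 * ‖formKer φ p‖)).mono' ?_ (ae_of_all _ fun q => ?_)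
    · exact hcont.aestronglyMeasurable.norm.prod_swap.integral_prod_right'
    · rw [Real.norm_of_nonneg (integral_nonneg fun p => norm_nonneg _)]
      have e : ∀ p, ‖Function.uncurry (fun p q : Sp n × Sp n =>
          a p * (formKer χ q * formKer φ (p + (q.1, -q.2)))) (p, q)‖ =
          ‖formKer χ q‖ * ‖a p * formKer φ (p + (q.1, -q.2))‖ := fun p => by
        simp only [Function.uncurry, norm_mul]
        ring
      simp only [e]
      rw [integral_const_mul]
      refine (mul_le_mul_of_nonneg_left (key q).2 (norm_nonneg _)).trans (le_of_eq ?_)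
      ring

/-- The anti-Wick form is an average of forms of translated symbols. -/
theorem SymB.antiWick_eq {w : Sp n → ℝ} (hw : Tempered w) {N : ℕ} {A : ℝ}
    {a : Sp n × Sp n → ℂ} (ha : SymB w N A a) (χ φ : 𝓢(Sp n, ℂ)) :
    Integrable (fun p => a p * ((‖stft χ φ p.1 p.2‖ ^ 2 : ℝ) : ℂ)) ∧
    Integrable (fun q : Sp n × Sp n => formKer χ q * form (MElliptic.tr (-q.1, q.2) a) φ) ∧
    ∫ p, a p * ((‖stft χ φ p.1 p.2‖ ^ 2 : ℝ) : ℂ) =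
      ∫ q : Sp n × Sp n, formKer χ q * form (MElliptic.tr (-q.1, q.2) a) φ := by
  have hint := ha.integrable_formKer_translates hw χ φ
  have hp : ∀ p : Sp n × Sp n, ∫ q : Sp n × Sp n,
      a p * (formKer χ q * formKer φ (p + (q.1, -q.2))) =
      a p * ((‖stft χ φ p.1 p.2‖ ^ 2 : ℝ) : ℂ) := fun p => by
    rw [integral_const_mul, integral_formKer_mul_formKer_add]
  have hq : ∀ q : Sp n × Sp n, ∫ p : Sp n × Sp n,
      a p * (formKer χ q * formKer φ (p + (q.1, -q.2))) =
      formKer χ q * form (MElliptic.tr (-q.1, q.2) a) φ := fun q => by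
    rw [form, ← integral_const_mul, ← integral_add_right_eq_self _ ((-q.1, q.2) : Sp n × Sp n)]
    congr with p
    have : p + (-q.1, q.2) + (q.1, -q.2) = p := by ext : 1 <;> simp
    rw [this]
    simp only [MElliptic.tr]
    ring
  have h1 := hint.integral_prod_left
  have h2 := hint.integral_prod_right
  simp only [Function.uncurry] at h1 h2
  simp only [hp] at h1
  simp only [hq] at h2
  refine ⟨h1, h2, ?_⟩
  simp only [← hp, ← hq]
  exact integral_integral_swap hint

/-! ### Comparison of the form with its anti-Wick average -/

/-- The first moment in the position variable of the kernel of a window. -/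
def posMoment (χ : 𝓢(Sp n, ℂ)) : ℝ := ∫ q : Sp n × Sp n, ‖formKer χ q‖ * ‖q.1‖

/-- The moments in the frequency variable of the kernel of a window. -/
def freqMoment (χ : 𝓢(Sp n, ℂ)) (M : ℕ) : ℝ := ∫ q : Sp n × Sp n, ‖formKer χ q‖ * (1 + ‖q.2‖) ^ M

theorem formKer_mul_norm_eq (χ : 𝓢(Sp n, ℂ)) (q : Sp n × Sp n) :
    ‖formKer χ q‖ * ‖q.1‖ = cn n * ((‖q.1‖ * ‖χ q.1‖) * ‖fourierHat χ q.2‖) := by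
  rw [norm_formKer]; ring

theorem integrable_formKer_mul_norm (χ : 𝓢(Sp n, ℂ)) :
    Integrable (fun q : Sp n × Sp n => ‖formKer χ q‖ * ‖q.1‖) := by
  simp only [formKer_mul_norm_eq, ← hatS_apply]
  have h := χ.integrable_pow_mul volume 1
  simp only [pow_one] at h
  exact (h.mul_prod (hatS χ).integrable.norm).const_mul _

theorem posMoment_eq (χ : 𝓢(Sp n, ℂ)) :
    posMoment χ = cn n * ((∫ w, ‖w‖ * ‖χ w‖) * ∫ ζ, ‖fourierHat χ ζ‖) := by
  simp only [posMoment, formKer_mul_norm_eq]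
  rw [integral_const_mul, Measure.volume_eq_prod,
    integral_prod_mul (fun w : Sp n => ‖w‖ * ‖χ w‖) (fun ζ : Sp n => ‖fourierHat χ ζ‖)]

theorem freqMoment_nonneg (χ : 𝓢(Sp n, ℂ)) (M : ℕ) : 0 ≤ freqMoment χ M :=
  integral_nonneg fun _ => by positivity

/-- As the kernel of `χ` has integral 1, `form a φ` can be subtracted inside the average, and the
bound on each translate integrates to moments of the window. -/
theorem norm_antiWick_sub_form_le {w : Sp n → ℝ} (hw : Tempered w) {N : ℕ} {A : ℝ}
    {a : Sp n × Sp n → ℂ} (ha : SymB w N A a) {χ : 𝓢(Sp n, ℂ)} (hχ : ∫ q, formKer χ q = 1)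
    (φ : 𝓢(Sp n, ℂ)) {D E : ℝ} {M : ℕ}
    (h : ∀ q : Sp n × Sp n, ‖form (tr (-q.1, q.2) a) φ - form a φ‖ ≤
      D * ‖q.1‖ + E * (1 + ‖q.2‖) ^ M) :
    ‖(∫ p, a p * ((‖stft χ φ p.1 p.2‖ ^ 2 : ℝ) : ℂ)) - form a φ‖ ≤
      D * posMoment χ + E * freqMoment χ M := by
  obtain ⟨-, h2, h3⟩ := ha.antiWick_eq hw χ φ
  -- A nonintegrable kernel would have integral 0 by convention.
  have hi : Integrable (formKer χ) := by
    by_contra hi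
    rw [integral_undef hi] at hχ
    exact zero_ne_one hχ
  have e : (∫ p, a p * ((‖stft χ φ p.1 p.2‖ ^ 2 : ℝ) : ℂ)) - form a φ =
      ∫ q : Sp n × Sp n, formKer χ q * (form (tr (-q.1, q.2) a) φ - form a φ) := by
    simp only [mul_sub]
    rw [integral_sub h2 (hi.mul_const _), integral_mul_const, hχ, one_mul, h3]
  rw [e, posMoment, freqMoment, ← integral_const_mul, ← integral_const_mul,
    ← integral_add ((integrable_formKer_mul_norm χ).const_mul _)
      ((integrable_formKer_moments χ M).const_mul _)]
  refine norm_integral_le_of_norm_le (((integrable_formKer_mul_norm χ).const_mul _).add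
      ((integrable_formKer_moments χ M).const_mul _)) (ae_of_all _ fun q => ?_)
  rw [norm_mul]
  refine (mul_le_mul_of_nonneg_left (h q) (norm_nonneg _)).trans (le_of_eq ?_)
  ring

/-! ### Windows with small position moment -/

theorem integral_formKer (χ : 𝓢(Sp n, ℂ)) :
    ∫ q, formKer χ q = ((∫ ξ, ‖fourierHat χ ξ‖ ^ 2 : ℝ) : ℂ) := by
  have := integral_multiplier_formKer (PolyB.const (n := n) 1) χ
  simp only [one_mul] at this
  rw [this, integral_complex_ofReal]

/-- Dilation of a Schwartz function. -/
def dilS (δ : ℝ) (hδ : δ ≠ 0) (χ : 𝓢(Sp n, ℂ)) : 𝓢(Sp n, ℂ) :=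
  SchwartzMap.compCLMOfContinuousLinearEquiv ℂ (scaleEquiv δ hδ) χ

theorem dilS_apply (δ : ℝ) (hδ : δ ≠ 0) (χ : 𝓢(Sp n, ℂ)) (x : Sp n) :
    dilS δ hδ χ x = χ (δ • x) := rfl

theorem fourierHat_dilS {δ : ℝ} (hδ : 0 < δ) (χ : 𝓢(Sp n, ℂ)) (ξ : Sp n) :
    fourierHat (dilS δ hδ.ne' χ) ξ = ((δ ^ n)⁻¹ : ℝ) * fourierHat χ (δ⁻¹ • ξ) := by
  have h := Measure.integral_comp_smul (volume : Measure (Sp n)) (fun x => Complex.exp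
    (-(Complex.I * ((inner ℝ x (δ⁻¹ • ξ) : ℝ) : ℂ))) * χ x) δ
  rw [finrank_euclideanSpace, Fintype.card_fin, abs_of_pos (by positivity), Complex.real_smul] at h
  rw [fourierHat, fourierHat, mul_left_comm, ← h]
  congr with x
  rw [dilS_apply, inner_smul_left, inner_smul_right]
  simp [hδ.ne']

theorem integral_comp_smul_pos (f : Sp n → ℝ) {δ : ℝ} (hδ : 0 < δ) :
    ∫ x, f (δ • x) = (δ ^ n)⁻¹ * ∫ x, f x := by
  rw [Measure.integral_comp_smul, finrank_euclideanSpace, Fintype.card_fin,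
    abs_of_pos (by positivity), smul_eq_mul]

theorem integral_sq_fourierHat_dilS {δ : ℝ} (hδ : 0 < δ) (χ : 𝓢(Sp n, ℂ)) :
    ∫ ξ, ‖fourierHat (dilS δ hδ.ne' χ) ξ‖ ^ 2 = (δ ^ n)⁻¹ * ∫ ξ, ‖fourierHat χ ξ‖ ^ 2 := by
  simp only [fourierHat_dilS hδ, norm_mul, mul_pow]
  rw [integral_const_mul, integral_comp_smul_pos (fun ξ => ‖fourierHat χ ξ‖ ^ 2) (inv_pos.2 hδ),
    Complex.norm_real, Real.norm_of_nonneg (by positivity), inv_pow δ, inv_inv]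
  field_simp

/-- The total mass of the kernel scales by `δ^{-n}` and the position moment by `δ^{-n-1}`, so after
normalization the moment tends to 0 as `δ` grows. -/
theorem posMoment_dilS {δ : ℝ} (hδ : 0 < δ) (χ : 𝓢(Sp n, ℂ)) :
    posMoment (dilS δ hδ.ne' χ) = δ⁻¹ * (δ ^ n)⁻¹ * posMoment χ := by
  have h1 : ∫ w, ‖w‖ * ‖dilS δ hδ.ne' χ w‖ = δ⁻¹ * ((δ ^ n)⁻¹ * ∫ w, ‖w‖ * ‖χ w‖) := by
    rw [← integral_comp_smul_pos (fun w => ‖w‖ * ‖χ w‖) hδ, ← integral_const_mul]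
    congr with w
    rw [dilS_apply, norm_smul, Real.norm_of_nonneg hδ.le]
    field_simp
  have h2 : ∫ ζ, ‖fourierHat (dilS δ hδ.ne' χ) ζ‖ = ∫ ζ, ‖fourierHat χ ζ‖ := by
    simp only [fourierHat_dilS hδ, norm_mul]
    rw [integral_const_mul, integral_comp_smul_pos (fun ξ => ‖fourierHat χ ξ‖) (inv_pos.2 hδ),
      Complex.norm_real, Real.norm_of_nonneg (by positivity), inv_pow, inv_inv]
    field_simp
  rw [posMoment_eq, posMoment_eq, h1, h2]
  ring

theorem formKer_smul (r : ℝ) (χ : 𝓢(Sp n, ℂ)) (q : Sp n × Sp n) :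
    formKer ((r : ℂ) • χ) q = (r : ℂ) ^ 2 * formKer χ q := by
  have : fourierHat ((r : ℂ) • χ : 𝓢(Sp n, ℂ)) q.2 = r * fourierHat χ q.2 := by
    rw [fourierHat, fourierHat, mul_left_comm, ← integral_const_mul (r : ℂ)]
    congr with x
    simp only [smul_apply, smul_eq_mul]
    ring
  rw [formKer, formKer, this]
  simp only [smul_apply, smul_eq_mul, map_mul, Complex.conj_ofReal]
  ring

theorem exists_schwartz_apply_zero (n : ℕ) : ∃ χ : 𝓢(Sp n, ℂ), χ 0 ≠ 0 := by
  let f : ContDiffBump (0 : Sp n) := ⟨1, 2, one_pos, one_lt_two⟩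
  have hc : HasCompactSupport (fun x => (f x : ℂ)) := f.hasCompactSupport.comp_left Complex.ofReal_zero
  have hd : ContDiff ℝ ∞ (fun x => (f x : ℂ)) := Complex.ofRealCLM.contDiff.comp f.contDiff
  refine ⟨hc.toSchwartzMap hd, ?_⟩
  have : f 0 = 1 := f.one_of_mem_closedBall (by simp [f])
  change ((f 0 : ℝ) : ℂ) ≠ 0
  simp [this]

theorem integral_sq_fourierHat_pos {χ : 𝓢(Sp n, ℂ)} (h : χ 0 ≠ 0) :
    0 < ∫ ξ, ‖fourierHat χ ξ‖ ^ 2 := by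
  refine lt_of_le_of_ne (integral_nonneg fun _ => by positivity) fun h0 => h ?_
  have hi : Integrable (fun ξ => ‖hatS χ ξ‖ ^ 2) := ((hatS χ).memLp 2).integrable_norm_pow (by simp)
  simp only [← hatS_apply] at h0
  rw [eq_comm, integral_eq_zero_iff_of_nonneg (fun _ => by positivity) hi,
    Continuous.ae_eq_iff_eq (f := fun ξ => ‖hatS χ ξ‖ ^ 2) volume (by exact (hatS χ).continuous.norm.pow 2) continuous_zero] at h0
  have h1 : ∀ ξ, hatS χ ξ = 0 := fun ξ => by simpa using congrFun h0 ξ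
  rw [← invHat_hatS χ 0, invHat]
  simp [h1]

theorem exists_window {ε : ℝ} (hε : 0 < ε) :
    ∃ χ : 𝓢(Sp n, ℂ), ∫ q, formKer χ q = 1 ∧ posMoment χ ≤ ε := by
  obtain ⟨χ, h0⟩ := exists_schwartz_apply_zero n
  set I := ∫ ξ, ‖fourierHat χ ξ‖ ^ 2 with hI
  have hIp : 0 < I := integral_sq_fourierHat_pos h0
  have hP : 0 ≤ posMoment χ := integral_nonneg fun _ => by positivity
  -- The normalized moment is `posMoment χ / (I δ)`; the `+ 1` keeps `δ` positive even if the moment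
  -- vanishes.
  set δ : ℝ := posMoment χ / (I * ε) + 1 with hδ'
  have hδ : 0 < δ := by positivity
  set J : ℝ := (δ ^ n)⁻¹ * I with hJ
  have hJp : 0 < J := by positivity
  -- The kernel is quadratic in the window, hence the square root.
  set r : ℝ := (√J)⁻¹
  have hr : r ^ 2 = J⁻¹ := by simp only [r, inv_pow, Real.sq_sqrt hJp.le]
  refine ⟨(r : ℂ) • dilS δ hδ.ne' χ, ?_, ?_⟩
  · simp only [formKer_smul]
    rw [integral_const_mul, integral_formKer, integral_sq_fourierHat_dilS hδ, ← hI, ← hJ]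
    norm_cast
    rw [hr, inv_mul_cancel₀ hJp.ne']
  · have : posMoment ((r : ℂ) • dilS δ hδ.ne' χ) = r ^ 2 * posMoment (dilS δ hδ.ne' χ) := by
      simp only [posMoment, formKer_smul]
      rw [← integral_const_mul]
      congr with q
      rw [norm_mul, norm_pow, Complex.norm_real, Real.norm_eq_abs, sq_abs, mul_assoc]
    rw [this, posMoment_dilS hδ, hr, hJ]
    have : ((δ ^ n)⁻¹ * I)⁻¹ * (δ⁻¹ * (δ ^ n)⁻¹ * posMoment χ) = posMoment χ / (I * δ) := by
      field_simp
    rw [this, div_le_iff₀ (by positivity), hδ']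
    have : ε * (I * (posMoment χ / (I * ε) + 1)) = posMoment χ + ε * I := by field_simp
    rw [this]
    linarith [mul_pos hε hIp]

/-! ### Fourier multipliers and Sobolev norms -/

/-- The form of the Fourier multiplier with weight `w`. -/
def weightedSq (w : Sp n → ℝ) (φ : 𝓢(Sp n, ℂ)) : ℝ := ∫ ξ, w ξ * ‖fourierHat φ ξ‖ ^ 2

theorem weightedSq_nonneg {w : Sp n → ℝ} (hw : Tempered w) (φ : 𝓢(Sp n, ℂ)) :
    0 ≤ weightedSq w φ :=
  integral_nonneg fun ξ => mul_nonneg (hw.pos ξ).le (by positivity)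

/-- Plancherel for the multiplier `Λ^k`; squaring doubles the exponent. -/
theorem sobolevNorm_sq {Λ : Sp n → ℝ} {μ : ℝ} (hΛ : IsWeight Λ μ) (k : ℝ) (φ : 𝓢(Sp n, ℂ)) :
    sobolevNorm Λ k φ ^ 2 = weightedSq (fun ξ => Λ ξ ^ (2 * k)) φ := by
  have hw := hΛ.tempered_rpow k
  have e : besselJ Λ (-k) φ = invHat (fun ξ => ((Λ ξ ^ k : ℝ) : ℂ) * hatS φ ξ) := by
    ext x
    rw [besselJ, pseudoDiff, invHat]
    simp only [neg_neg, hatS_apply, mul_assoc]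
    rfl
  have h1 := lintegral_invHat_sq (hw.polyB.integrable_mul (hatS φ)) (hw.polyB.memLp_mul (hatS φ))
  have h2 : ∀ ξ, ‖((Λ ξ ^ k : ℝ) : ℂ) * hatS φ ξ‖ₑ ^ 2 =
      ENNReal.ofReal (Λ ξ ^ (2 * k) * ‖fourierHat φ ξ‖ ^ 2) := fun ξ => by
    rw [← ofReal_norm, ← ENNReal.ofReal_pow (norm_nonneg _), norm_mul, mul_pow, Complex.norm_real,
      Real.norm_of_nonneg (hw.pos ξ).le, hatS_apply, ← Real.rpow_natCast,
      ← Real.rpow_mul (hΛ.pos ξ).le, mul_comm k]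
    rfl
  simp only [h2] at h1
  have hi := (hΛ.tempered_rpow (2 * k)).integrable_sq φ
  have hp : ∀ ξ, 0 ≤ Λ ξ ^ (2 * k) * ‖fourierHat φ ξ‖ ^ 2 := fun ξ =>
    mul_nonneg (Real.rpow_nonneg (hΛ.pos ξ).le _) (by positivity)
  rw [← ofReal_integral_eq_lintegral_ofReal hi (ae_of_all _ hp)] at h1
  rw [sobolevNorm, e, ← ENNReal.toReal_pow,
    eLpNorm_eq_lintegral_rpow_enorm_toReal (by norm_num) (by norm_num), ← ENNReal.rpow_natCast,
    ← ENNReal.rpow_mul]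
  simp only [ENNReal.toReal_ofNat, Nat.cast_ofNat, ENNReal.rpow_ofNat]
  rw [h1, div_mul_cancel₀ _ (by norm_num), ENNReal.rpow_one,
    ENNReal.toReal_ofReal (integral_nonneg hp), weightedSq]

theorem Tempered.translate {w : Sp n → ℝ} (hw : Tempered w) (ζ : Sp n) :
    Tempered (fun ξ => w (ξ + ζ)) := by
  obtain ⟨C, M, hC, h⟩ := hw.peetre
  refine ⟨fun ξ => hw.pos _, hw.cont.comp (by fun_prop), C, M, hC, fun ξ η => ?_⟩
  rw [add_right_comm]
  exact h _ _

/-- A weight as a symbol. -/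
def mult (w : Sp n → ℝ) (p : Sp n × Sp n) : ℂ := (w p.2 : ℂ)

theorem form_mult {w : Sp n → ℝ} (hw : Tempered w) (φ : 𝓢(Sp n, ℂ)) :
    form (mult w) φ = (weightedSq w φ : ℂ) := by
  simp only [form, mult]
  rw [integral_multiplier_formKer hw.polyB, weightedSq, ← integral_complex_ofReal]
  push_cast
  rfl

theorem symB_mult {w : Sp n → ℝ} (hw : Tempered w) (hs : ContDiff ℝ ∞ w) :
    SymB w 0 1 (mult w) := by
  refine ⟨Complex.ofRealCLM.contDiff.comp (hs.comp contDiff_snd), fun p => ?_⟩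
  rw [mult, Complex.norm_real, Real.norm_of_nonneg (hw.pos _).le, one_mul]

/-- The anti-Wick form with real symbol `w(ξ)`. -/
def antiWick (χ : 𝓢(Sp n, ℂ)) (w : Sp n → ℝ) (φ : 𝓢(Sp n, ℂ)) : ℝ :=
  ∫ p : Sp n × Sp n, w p.2 * ‖stft χ φ p.1 p.2‖ ^ 2

theorem integrable_antiWick {w : Sp n → ℝ} (hw : Tempered w) (hs : ContDiff ℝ ∞ w)
    (χ φ : 𝓢(Sp n, ℂ)) : Integrable fun p : Sp n × Sp n => w p.2 * ‖stft χ φ p.1 p.2‖ ^ 2 := by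
  refine ((symB_mult hw hs).antiWick_eq hw χ φ).1.re.congr (ae_of_all _ fun p => ?_)
  simp only [mult, ← Complex.ofReal_mul]
  rfl

/-- A multiplier does not see position shifts, so `D = 0`. Its form is an explicit integral of
`|φ̂|²`, so pointwise differences suffice and no symbol derivatives are needed. -/
theorem abs_antiWick_sub_weightedSq_le {w v : Sp n → ℝ} (hw : Tempered w) (hs : ContDiff ℝ ∞ w)
    (hv : Tempered v) {C : ℝ} {M : ℕ}
    (h : ∀ ξ η, |w (ξ + η) - w ξ| ≤ C * (1 + ‖η‖) ^ M * v ξ)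
    {χ : 𝓢(Sp n, ℂ)} (hχ : ∫ q, formKer χ q = 1) (φ : 𝓢(Sp n, ℂ)) :
    |antiWick χ w φ - weightedSq w φ| ≤ C * weightedSq v φ * freqMoment χ M := by
  have h1 := norm_antiWick_sub_form_le hw (symB_mult hw hs) hχ φ (D := 0)
    (E := C * weightedSq v φ) (M := M) fun q => by
      have e : tr (-q.1, q.2) (mult w) = mult (fun ξ => w (ξ + q.2)) := rfl
      rw [e, form_mult hw, form_mult (hw.translate q.2), ← Complex.ofReal_sub, Complex.norm_real,
        weightedSq, weightedSq, ← integral_sub ((hw.translate q.2).integrable_sq φ)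
          (hw.integrable_sq φ), zero_mul, zero_add, mul_right_comm, weightedSq,
        ← integral_const_mul]
      refine norm_integral_le_of_norm_le ((hv.integrable_sq φ).const_mul _)
        (ae_of_all _ fun ξ => ?_)
      rw [← sub_mul, norm_mul, Real.norm_of_nonneg (sq_nonneg _), ← mul_assoc, Real.norm_eq_abs]
      exact mul_le_mul_of_nonneg_right (h _ _) (sq_nonneg _)
  have e : ∫ p : Sp n × Sp n, mult w p * ((‖stft χ φ p.1 p.2‖ ^ 2 : ℝ) : ℂ) =
      (antiWick χ w φ : ℂ) := by
    rw [antiWick, ← integral_complex_ofReal]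
    push_cast
    rfl
  rw [e, form_mult hw, ← Complex.ofReal_sub, Complex.norm_real, zero_mul, zero_add] at h1
  exact h1

/-! ### Comparison for symbols -/

theorem form_sub {w : Sp n → ℝ} (hw : Tempered w) {N N' : ℕ} {A B : ℝ} {a b : Sp n × Sp n → ℂ}
    (ha : SymB w N A a) (hb : SymB w N' B b) (φ : 𝓢(Sp n, ℂ)) :
    form (a - b) φ = form a φ - form b φ := by
  simp only [form, Pi.sub_apply, sub_mul]
  exact integral_sub (ha.integrable_mul_formKer hw φ) (hb.integrable_mul_formKer hw φ)

/-- Split each translation into a position shift, which keeps the weight `Λ^k`, and a frequency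
shift, which gains `Λ^{-ρ}`; the form bound applies to each difference with its own weight. The
constants do not depend on the window, so the window may be chosen after `D`. -/
theorem IsSymbolS.exists_antiWick_bound {Λ : Sp n → ℝ} {μ ρ k : ℝ} (hΛ : IsWeight Λ μ)
    (hρ : 0 ≤ ρ) {σ : Sp n → Sp n → ℂ} (h : IsSymbolS Λ ρ k σ) :
    ∃ (D E : ℝ) (M : ℕ), 0 < D ∧ 0 < E ∧ ∀ (χ : 𝓢(Sp n, ℂ)), ∫ q, formKer χ q = 1 →
      ∀ φ : 𝓢(Sp n, ℂ),
      ‖(∫ p : Sp n × Sp n, σ p.1 p.2 * ((‖stft χ φ p.1 p.2‖ ^ 2 : ℝ) : ℂ)) -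
        pairing (pseudoDiff σ φ) φ‖ ≤
      D * posMoment χ * weightedSq (fun ξ => Λ ξ ^ k) φ +
        E * freqMoment χ M * weightedSq (fun ξ => Λ ξ ^ (k - ρ)) φ := by
  have hw := hΛ.tempered_rpow k
  have hv := hΛ.tempered_rpow (k - ρ)
  obtain ⟨N₁, K₁, hK₁, hb₁⟩ := exists_form_bound hw
  obtain ⟨N₂, K₂, hK₂, hb₂⟩ := exists_form_bound hv
  obtain ⟨C, M, hC, hM⟩ := hw.peetre
  obtain ⟨C', M', hC', hM'⟩ := hv.peetre
  -- One derivative beyond the two form bounds is spent on the mean value theorem in position.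
  obtain ⟨A, hA, ha, hXi⟩ := h.exists_symB hΛ hρ (max N₁ N₂ + 1)
  set a : Sp n × Sp n → ℂ := fun p => σ p.1 p.2
  have hform : ∀ φ : 𝓢(Sp n, ℂ), pairing (pseudoDiff σ φ) φ = form a φ := fun φ => ha.pairing_eq hw φ
  have hX : ∀ j, SymB (fun ξ => Λ ξ ^ k) N₁ A (dX j a) := fun j =>
    (ha.2 j).1.of_le (le_max_left _ _)
  have hXi' : ∀ j, SymB (fun ξ => Λ ξ ^ (k - ρ)) N₂ A (dXi j a) := fun j =>
    (hXi j).of_le ((le_max_right N₁ N₂).trans (Nat.le_succ _))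
  refine ⟨n * A * K₁ + 1, n * A * C' * K₂ + 1, M' + 1, by positivity, by positivity,
    fun χ hχ φ => ?_⟩
  rw [hform]
  have hN₁ := weightedSq_nonneg hw φ
  have hN₂ := weightedSq_nonneg hv φ
  have main := norm_antiWick_sub_form_le hw ha hχ φ
    (D := n * A * K₁ * weightedSq (fun ξ => Λ ξ ^ k) φ)
    (E := n * A * C' * K₂ * weightedSq (fun ξ => Λ ξ ^ (k - ρ)) φ) (M := M' + 1) fun q => by
      have hb := ha.tr (-q.1)
      have s1 := symB_tr_sub_left ha.smooth hX (-q.1)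
      have s2 := symB_tr_sub_right hv hA.le hC'.le hM' hb.smooth (fun j => by
        have := (hXi' j).tr (-q.1)
        rwa [dXi, ← dir_tr] at this) q.2
      have e : tr (0, q.2) (tr (-q.1, 0) a) = tr (-q.1, q.2) a := by
        ext p
        simp only [tr, add_assoc]
        congr 2
        ext : 1 <;> simp
      rw [e] at s2
      have f1 := hb₁ _ _ s1 φ
      have f2 := hb₂ _ _ s2 φ
      rw [s1.pairing_eq hw] at f1
      rw [s2.pairing_eq hv] at f2
      change ‖form _ φ‖ ≤ _ * weightedSq _ φ at f1
      change ‖form _ φ‖ ≤ _ * weightedSq _ φ at f2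
      rw [norm_neg] at f1
      have e2 : form (tr (-q.1, q.2) a) φ - form a φ =
          form (tr (-q.1, q.2) a - tr (-q.1, 0) a) φ + form (tr (-q.1, 0) a - a) φ := by
        have ht : SymB (fun ξ => Λ ξ ^ k) 0 (A * (C * (1 + ‖q.2‖) ^ M)) (tr (-q.1, q.2) a) :=
          ⟨contDiff_tr ha.smooth, fun p => by
            refine (ha.bound _).trans ?_
            rw [mul_assoc]
            exact mul_le_mul_of_nonneg_left (hM _ _) hA.le⟩
        rw [form_sub hw ht hb, form_sub hw hb ha]
        ring
      rw [e2]
      refine (norm_add_le _ _).trans ((add_le_add f2 f1).trans (le_of_eq ?_))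
      ring
  refine main.trans ?_
  have hp : 0 ≤ posMoment χ := integral_nonneg fun _ => by positivity
  have hf := freqMoment_nonneg χ (M' + 1)
  have := mul_nonneg hp hN₁
  have := mul_nonneg hf hN₂
  linarith

/-! ### Gårding's inequality -/

/-- For `‖ξ‖ ≤ R` the factor `Λ^ρ` is bounded, so there `Λ^k` is controlled by `Λ^{k-ρ}` and the
failure of ellipticity is absorbed by the lower order term. -/
theorem IsStronglyMElliptic.exists_re_lower_bound {Λ : Sp n → ℝ} {μ ρ k : ℝ} (hΛ : IsWeight Λ μ)
    (hρ : 0 < ρ) {σ : Sp n → Sp n → ℂ} (h : IsSymbolS Λ ρ k σ)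
    (hell : IsStronglyMElliptic Λ k σ) :
    ∃ c K : ℝ, 0 < c ∧ 0 < K ∧
      ∀ x ξ, c * Λ ξ ^ k - K * Λ ξ ^ (k - ρ) ≤ (σ x ξ).re := by
  obtain ⟨c, R, hc, hR, hb⟩ := hell
  obtain ⟨A, hA, ha, -⟩ := h.exists_symB hΛ hρ.le 0
  obtain ⟨C, M, hC, hg⟩ := (hΛ.tempered_rpow ρ).exists_growth
  refine ⟨c, (c + A) * (C * (1 + R) ^ M) + 1, hc, by positivity, fun x ξ => ?_⟩
  have hp := hΛ.pos ξ
  have h0 : 0 < Λ ξ ^ (k - ρ) := Real.rpow_pos_of_pos hp _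
  rcases le_total R ‖ξ‖ with hξ | hξ
  · have := hb x ξ hξ
    have : 0 ≤ ((c + A) * (C * (1 + R) ^ M) + 1) * Λ ξ ^ (k - ρ) := by positivity
    linarith
  · have h1 : ‖σ x ξ‖ ≤ A * Λ ξ ^ k := ha.bound (x, ξ)
    have h2 := (abs_le.1 ((Complex.abs_re_le_norm (σ x ξ)).trans h1)).1
    have h3 : Λ ξ ^ k = Λ ξ ^ ρ * Λ ξ ^ (k - ρ) := by rw [← Real.rpow_add hp]; ring_nf
    have h4 : Λ ξ ^ ρ ≤ C * (1 + R) ^ M := (hg ξ).trans (by gcongr)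
    have h5 : (c + A) * Λ ξ ^ k ≤ (c + A) * (C * (1 + R) ^ M) * Λ ξ ^ (k - ρ) := by
      rw [h3, ← mul_assoc]
      gcongr
    linarith

/-- The sharp form of the lower bound, with an error of lower order. -/
theorem exists_form_lower_bound {Λ : Sp n → ℝ} {μ ρ k : ℝ} (hΛ : IsWeight Λ μ)
    (hρ : 0 < ρ) (hρμ : ρ ≤ 1 / μ) {σ : Sp n → Sp n → ℂ} (h : IsSymbolS Λ ρ k σ)
    (hell : IsStronglyMElliptic Λ k σ) :
    ∃ c D : ℝ, 0 < c ∧ 0 < D ∧ ∀ φ : 𝓢(Sp n, ℂ),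
      c * weightedSq (fun ξ => Λ ξ ^ k) φ - D * weightedSq (fun ξ => Λ ξ ^ (k - ρ)) φ ≤
        (pairing (pseudoDiff σ φ) φ).re := by
  have hw := hΛ.tempered_rpow k
  have hv := hΛ.tempered_rpow (k - ρ)
  have hs : ∀ k : ℝ, ContDiff ℝ ∞ (fun ξ => Λ ξ ^ k) := fun k =>
    hΛ.smooth.rpow_const_of_ne fun ξ => (hΛ.pos ξ).ne'
  obtain ⟨c, K, hc, hK, hlow⟩ := hell.exists_re_lower_bound hΛ hρ h
  obtain ⟨D, E, M, hD, hE, hσ⟩ := h.exists_antiWick_bound hΛ hρ.le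
  obtain ⟨C₁, M₁, hC₁, h₁⟩ := hΛ.abs_rpow_sub_le hρμ k
  obtain ⟨C₂, M₂, hC₂, h₂⟩ := hv.peetre
  obtain ⟨A, hA, ha, -⟩ := h.exists_symB hΛ hρ.le 0
  -- The position error then costs at most `c / 2` of the main term. The frequency moments of this
  -- window may be large, but they only multiply the lower order norm.
  obtain ⟨χ, hχ, hχm⟩ := exists_window (n := n) (show 0 < c / (2 * D) by positivity)
  have f0 := freqMoment_nonneg χ M
  have f1 := freqMoment_nonneg χ M₁
  have f2 := freqMoment_nonneg χ M₂
  refine ⟨c / 2, E * freqMoment χ M + c * (C₁ * freqMoment χ M₁) +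
    K * (1 + (C₂ + 1) * freqMoment χ M₂) + 1, by positivity, by positivity, fun φ => ?_⟩
  have hN := weightedSq_nonneg hw φ
  have hN' := weightedSq_nonneg hv φ
  have b1 := abs_antiWick_sub_weightedSq_le hw (hs k) hv h₁ hχ φ
  -- For the lower order weight a crude comparison is enough: no gain is needed, and Peetre bounds
  -- the difference by the weight itself.
  have b2 := abs_antiWick_sub_weightedSq_le hv (hs _) hv (C := C₂ + 1) (M := M₂) (fun ξ η => by
    have p1 := hv.pos ξ
    have p2 := hv.pos (ξ + η)
    have p3 : 1 ≤ (1 + ‖η‖) ^ M₂ := one_le_pow₀ (by linarith [norm_nonneg η])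
    have p4 := h₂ ξ η
    have p5 := mul_le_mul_of_nonneg_right p3 p1.le
    have p6 : 0 ≤ C₂ * (1 + ‖η‖) ^ M₂ * Λ ξ ^ (k - ρ) := by positivity
    rw [abs_le]
    constructor <;> linarith) hχ φ
  have b3 := hσ χ hχ φ
  have hint := (ha.antiWick_eq hw χ φ).1
  -- The positivity step: the pointwise bound on `Re σ` is integrated against `|stft χ φ|² ≥ 0`.
  have b4 : c * antiWick χ (fun ξ => Λ ξ ^ k) φ - K * antiWick χ (fun ξ => Λ ξ ^ (k - ρ)) φ ≤
      (∫ p : Sp n × Sp n, σ p.1 p.2 * ((‖stft χ φ p.1 p.2‖ ^ 2 : ℝ) : ℂ)).re := by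
    have i1 := (integrable_antiWick hw (hs k) χ φ).const_mul c
    have i2 := (integrable_antiWick hv (hs _) χ φ).const_mul K
    have e : (∫ p : Sp n × Sp n, σ p.1 p.2 * ((‖stft χ φ p.1 p.2‖ ^ 2 : ℝ) : ℂ)).re =
        ∫ p : Sp n × Sp n, (σ p.1 p.2 * ((‖stft χ φ p.1 p.2‖ ^ 2 : ℝ) : ℂ)).re :=
      (integral_re hint).symm
    rw [e, antiWick, antiWick, ← integral_const_mul, ← integral_const_mul, ← integral_sub i1 i2]
    refine integral_mono (i1.sub i2) hint.re fun p => ?_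
    change _ ≤ (σ p.1 p.2 * ((‖stft χ φ p.1 p.2‖ ^ 2 : ℝ) : ℂ)).re
    rw [Complex.re_mul_ofReal, ← mul_assoc, ← mul_assoc, ← sub_mul]
    exact mul_le_mul_of_nonneg_right (hlow _ _) (sq_nonneg _)
  have b5 := (abs_le.1 ((Complex.abs_re_le_norm _).trans b3)).2
  rw [Complex.sub_re] at b5
  have b6 : D * posMoment χ * weightedSq (fun ξ => Λ ξ ^ k) φ ≤
      c / 2 * weightedSq (fun ξ => Λ ξ ^ k) φ := by
    refine mul_le_mul_of_nonneg_right ?_ hN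
    calc D * posMoment χ ≤ D * (c / (2 * D)) := by gcongr
      _ = c / 2 := by field_simp
  have b7 := mul_le_mul_of_nonneg_left (abs_le.1 b1).1 hc.le
  have b8 := mul_le_mul_of_nonneg_left (abs_le.1 b2).2 hK.le
  linarith

/-- Pointwise in frequency: where `Λ` is large, `Λ^{-ρ} ≤ ε`; where it is at most `T`, the factor
`Λ^{2s-ρ}` is bounded because `2s ≥ ρ`. -/
theorem exists_weightedSq_interpolation {Λ : Sp n → ℝ} {μ ρ k s ε : ℝ} (hΛ : IsWeight Λ μ)
    (hρ : 0 < ρ) (hs : ρ / 2 ≤ s) (hε : 0 < ε) :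
    ∃ C : ℝ, 0 < C ∧ ∀ φ : 𝓢(Sp n, ℂ), weightedSq (fun ξ => Λ ξ ^ (k - ρ)) φ ≤
      ε * weightedSq (fun ξ => Λ ξ ^ k) φ + C * weightedSq (fun ξ => Λ ξ ^ (k - 2 * s)) φ := by
  -- The threshold solving `T ^ (-ρ) = ε`.
  set T : ℝ := ε⁻¹ ^ (1 / ρ) with hT
  have hTp : 0 < T := by positivity
  refine ⟨T ^ (2 * s - ρ), by positivity, fun φ => ?_⟩
  have i0 := (hΛ.tempered_rpow (k - ρ)).integrable_sq φ
  have i1 := ((hΛ.tempered_rpow k).integrable_sq φ).const_mul ε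
  have i2 := ((hΛ.tempered_rpow (k - 2 * s)).integrable_sq φ).const_mul (T ^ (2 * s - ρ))
  simp only [weightedSq]
  rw [← integral_const_mul, ← integral_const_mul, ← integral_add i1 i2]
  refine integral_mono i0 (i1.add i2) fun ξ => ?_
  change _ ≤ _ * (_ * _) + _ * (_ * _)
  rw [← mul_assoc, ← mul_assoc, ← add_mul]
  refine mul_le_mul_of_nonneg_right ?_ (sq_nonneg _)
  have hp := hΛ.pos ξ
  rcases le_total T (Λ ξ) with hle | hle
  · have e1 : Λ ξ ^ (k - ρ) = Λ ξ ^ (-ρ) * Λ ξ ^ k := by rw [← Real.rpow_add hp]; ring_nf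
    have e2 : Λ ξ ^ (-ρ) ≤ T ^ (-ρ) := Real.rpow_le_rpow_of_nonpos hTp hle (by linarith)
    have e3 : T ^ (-ρ) = ε := by
      rw [hT, ← Real.rpow_mul (by positivity)]
      have : 1 / ρ * -ρ = -1 := by field_simp
      rw [this, Real.rpow_neg_one, inv_inv]
    have : 0 ≤ T ^ (2 * s - ρ) * Λ ξ ^ (k - 2 * s) := by positivity
    have := mul_le_mul_of_nonneg_right (e2.trans_eq e3) (Real.rpow_nonneg hp.le k)
    linarith
  · have e1 : Λ ξ ^ (k - ρ) = Λ ξ ^ (2 * s - ρ) * Λ ξ ^ (k - 2 * s) := by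
      rw [← Real.rpow_add hp]; ring_nf
    have e2 : Λ ξ ^ (2 * s - ρ) ≤ T ^ (2 * s - ρ) :=
      Real.rpow_le_rpow hp.le hle (by linarith)
    have := mul_le_mul_of_nonneg_right e2 (Real.rpow_nonneg hp.le (k - 2 * s))
    have : 0 ≤ ε * Λ ξ ^ k := by positivity
    linarith

end MElliptic

end

theorem mainTheorem3 (n : ℕ) (Λ : EuclideanSpace ℝ (Fin n) → ℝ) (μ ρ m : ℝ)
    (hΛ : MElliptic.IsWeight Λ μ) (hρ : 0 < ρ) (hρμ : ρ ≤ 1 / μ)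
    (σ : EuclideanSpace ℝ (Fin n) → EuclideanSpace ℝ (Fin n) → ℂ)
    (hσ : MElliptic.IsSymbolM Λ ρ (2 * m) σ)
    (hell : MElliptic.IsStronglyMElliptic Λ (2 * m) σ) :
    ∃ C' : ℝ, 0 < C' ∧ ∀ s : ℝ, ρ / 2 ≤ s → ∃ Cs : ℝ, 0 < Cs ∧
      ∀ φ : 𝓢(EuclideanSpace ℝ (Fin n), ℂ),
        C' * MElliptic.sobolevNorm Λ m φ ^ 2 - Cs * MElliptic.sobolevNorm Λ (m - s) φ ^ 2 ≤
          (MElliptic.pairing (MElliptic.pseudoDiff σ φ) φ).re := by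
  obtain ⟨c, D, hc, hD, h⟩ := MElliptic.exists_form_lower_bound hΛ hρ hρμ hσ.isSymbolS hell
  refine ⟨c / 2, by positivity, fun s hs => ?_⟩
  -- With this `ε` the error returns exactly `c / 2` of the main term. Since `c` and `D` were fixed
  -- before `s`, the leading constant does not depend on `s`.
  obtain ⟨C, hC, hi⟩ := MElliptic.exists_weightedSq_interpolation (k := 2 * m) (ε := c / (2 * D))
    hΛ hρ hs (by positivity)
  refine ⟨D * C, by positivity, fun φ => ?_⟩
  rw [MElliptic.sobolevNorm_sq hΛ, MElliptic.sobolevNorm_sq hΛ, mul_sub]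
  have h1 := h φ
  have h2 := mul_le_mul_of_nonneg_left (hi φ) hD.le
  have h3 : D * (c / (2 * D)) = c / 2 := by field_simp
  rw [mul_add, ← mul_assoc, ← mul_assoc, h3] at h2
  linarith
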